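/- Let $\Gamma$ be an abelian group, $F$ an injective endomorphism of $\Gamma$, and $\Sigma\subset\Gamma$ a finite symmetric set containing $0$. For a word $\sigma=a_0\cdots a_n\in\Sigma^*$ put $[\sigma]_F=a_0+F(a_1)+\cdots+F^n(a_n)$. Assume that $\Sigma$ is an *$F$-spanning set*, i.e. (C1) every element of $\Gamma$ is $[\sigma]_F$ for some $\sigma\in\Sigma^*$ (so $\Gamma$ is a finitely generated $\mathbb Z[F]$-module); (C2) $a_1+a_2+a_3\in\Sigma+F(\Sigma)$ for all $a_1,a_2,a_3\in\Sigma$; (C3) if $a_1,a_2\in\Sigma$ and $a_1+a_2=F(b)$ with $b\in\Gamma$, then $b\in\Sigma$. Assume moreover that $\Sigma\cap F(\Gamma)=\{0\}$, and let $\Sigma_0\subset\Sigma$ contain $0$ and exactly one representative of each coset of $F(\Gamma)$ that meets $\Sigma$. Define: - $I_{F,a}=\{F^n(a):n\in\mathbb N\}$ for $a\in\Sigma\setminus\{0\}$, and $I_F=\bigcup_{a\in\Sigma\setminus\{0\}}I_{F,a}$; - the preorder $\preceq$ on $I_F\cup\{0\}$: $F^i(a)\preceq F^j(b)$ iff $i\le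 j$, for $a,b\in\Sigma\setminus\{0\}$, with $0$ strictly above every element of $I_F$ (and $0\preceq 0$); - $V_F:\Gamma\to I_F\cup\{0\}$: $V_F(0)=0$, and for $g\ne0$, $V_F(g)=F^m(b_m)$, where $g=\sum_{i=m}^nF^i(b_i)$ with $b_m\in\Sigma_0\setminus\{0\}$ and $b_i\in\Sigma$ for $m<i\le n$ (such a representation exists, and $F^m(b_m)$ does not depend on it); - $R(g,u)$ iff $g=u=0$, or, for some $n\ge 0$ and $a_0,\dots,a_n\in\Sigma$ with $a_n\neq0$, $g=[a_0\cdots a_n]_F$ and $u=F^n(a_n)$; - $\Gamma_V=(\Gamma,+,F,V_F,R,I_F,\preceq,I_{F,a};a\in\Sigma\setminus\{0\})$. For an abelian group $G$ with an endomorphism, also denoted $F$, put $K(a,F^d)=\{a+F^d(a)+\cdots+F^{dn}(a):n\in\mathbb N\}$. An *elementary $F$-set* of $G$ is a set $a_0+K(a_1,F^{n_1})+\cdots+K(a_m,F^{n_m})$ with $m\ge0$, $a_i\in G$ and positive integers $n_i$. An *$F$-set* of $G$ is a finite union of sets of the form $E+H$, with $E$ an elementary $F$-set and $H$ a subgroup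 with $F(H)\subseteq H$. On $\Gamma^n$, $F$ acts coordinatewise; $(\Gamma,\mathcal F)$ is the structure with domain $\Gamma$ and a predicate for every $F$-set of every $\Gamma^n$, $n>0$. A subset $A\subseteq\Gamma^n$ is *$F$-automatic* if there are $r>0$ and an $F^r$-spanning set $T$ of $\Gamma$ such that $\{\sigma\in(T^n)^*:[\sigma]_{F^r}\in A\}$ is a regular language over the alphabet $T^n$. A structure in a language with finitely many symbols is *FA-presentable* if its elements can be represented bijectively by the words of a regular language over a finite alphabet in such a way that the basic relations and the graphs of the basic functions become regular languages of convolutions (tuples of words read in parallel from the left, shorter words being padded on the right by an extra symbol $\sharp$). Then: 1. $\Gamma_V$ is FA-presentable. 2. The first-order theory of $\Gamma_V$ is decidable: the set of Gödel numbers of the sentences true in $\Gamma_V$ is computable. 3. For every $n>0$, every $F$-set of $\Gamma^n$ is definable without parameters in $\Gamma_V$; hence $(\Gamma,\mathcal F)$ is a definable reduct of $\Gamma_V$, i.e. every set definable without parameters in $(\Gamma,\mathcal F)$ is definable without parameters in $\Gamma_V$. 4. For every $n>0$, every $F$-set of $\Gamma^n$ is $F$-automatic. -/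

import Mathlib

universe u

noncomputable section

namespace FGamma

open scoped FirstOrder

/-! ### Words over `Γ`, spanning sets -/

section Spanning

variable {G : Type u} [AddCommGroup G]

/-- The element `[a₀ a₁ ⋯ aₙ]_F = a₀ + F a₁ + ⋯ + Fⁿ aₙ` represented by a word. -/
def eval (F : AddMonoid.End G) : List G → G
  | [] => 0
  | a :: w => a + F (eval F w)

/-- The word `w` uses only letters of `S`. -/
def IsWord (S : Finset G) (w : List G) : Prop := ∀ a ∈ w, a ∈ S

/-- `S` is a (finite, symmetric, containing `0`) `F`-spanning set for `G`.
The field `span` says in particular that `S` generates `G` as a `ℤ[F]`-module, so that `G` is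
then a finitely generated `ℤ[F]`-module. -/
structure IsSpanning (F : AddMonoid.End G) (S : Finset G) : Prop where
  zero_mem : (0 : G) ∈ S
  neg_mem : ∀ a ∈ S, -a ∈ S
  span : ∀ g : G, ∃ w : List G, IsWord S w ∧ eval F w = g
  add_mem : ∀ a ∈ S, ∀ b ∈ S, ∀ c ∈ S, ∃ d ∈ S, ∃ e ∈ S, a + b + c = d + F e
  carry_mem : ∀ a ∈ S, ∀ b ∈ S, ∀ c : G, a + b = F c → c ∈ S

/-- `S₀ ⊆ S` contains `0` and exactly one representative of every coset of `F(G)` that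
meets `S`. -/
structure IsTransversal (F : AddMonoid.End G) (S S₀ : Finset G) : Prop where
  subset : S₀ ⊆ S
  zero_mem : (0 : G) ∈ S₀
  existsUnique : ∀ a ∈ S, ∃! b, b ∈ S₀ ∧ ∃ c : G, a - b = F c

end Spanning

/-! ### The basic functions and predicates of `Γ_V` -/

section Predicates

variable {G : Type u} [AddCommGroup G] (F : AddMonoid.End G) (S S₀ : Finset G)

/-- The orbit `I_{F,a} = {Fⁿ a : n ∈ ℕ}`. -/
def orbit (a : G) : Set G := {u | ∃ n : ℕ, u = (F ^ n) a}

/-- `I_F = {Fⁿ a : a ∈ S ∖ {0}, n ∈ ℕ}`. -/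
def IF : Set G := {u | ∃ a ∈ S, a ≠ 0 ∧ u ∈ orbit F a}

/-- The preorder on `I_F ∪ {0}`: `Fⁱ a ≼ Fʲ b` iff `i ≤ j`, for `a, b ∈ S ∖ {0}`, and `0` is
strictly above all of `I_F`. -/
def Preceq (u v : G) : Prop :=
  (∃ i j : ℕ, ∃ a ∈ S, ∃ b ∈ S, a ≠ 0 ∧ b ≠ 0 ∧ u = (F ^ i) a ∧ v = (F ^ j) b ∧ i ≤ j) ∨
    (u ∈ IF F S ∧ v = 0) ∨ (u = 0 ∧ v = 0)

/-- `R(g, u)`: `u = Fⁿ a` with `a ∈ S ∖ {0}` and `g = [a₀ ⋯ aₙ₋₁ a]_F` for some letters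
`a₀, …, aₙ₋₁ ∈ S`; moreover `R(0, 0)`. -/
def R (g u : G) : Prop :=
  (∃ w : List G, ∃ a ∈ S, IsWord S w ∧ a ≠ 0 ∧ g = eval F (w ++ [a]) ∧
    u = (F ^ w.length) a) ∨ (g = 0 ∧ u = 0)

/-- `g = F^m b + F^(m+1) a_(m+1) + ⋯ + Fⁿ aₙ` with `b ∈ S₀ ∖ {0}`, all `aᵢ ∈ S`, and
`u = F^m b`. -/
def IsLowestTerm (g u : G) : Prop :=
  ∃ (m : ℕ) (b : G) (w : List G), b ∈ S₀ ∧ b ≠ 0 ∧ IsWord S w ∧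
    g = (F ^ m) (eval F (b :: w)) ∧ u = (F ^ m) b

open Classical in
/-- `V_F(g)` is the lowest term of `g` for `g ≠ 0`, and `V_F(0) = 0`. -/
def V (g : G) : G :=
  if h : g ≠ 0 ∧ ∃ u, IsLowestTerm F S S₀ g u then h.2.choose else 0

variable {F S S₀}

theorem isLowestTerm_unique (hF : Function.Injective F)
    (hS : ∀ a ∈ S, (∃ c, a = F c) → a = 0) (hS₀ : IsTransversal F S S₀)
    {g u v : G} (hu : IsLowestTerm F S S₀ g u) (hv : IsLowestTerm F S S₀ g v) : u = v := by
  have hinj : ∀ m : ℕ, Function.Injective (F ^ m) := by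
    intro m
    rw [AddMonoid.End.coe_pow]
    exact hF.iterate m
  have key : ∀ (m k : ℕ) (b b' : G) (w w' : List G), b ∈ S₀ → b ≠ 0 → b' ∈ S₀ →
      (F ^ m) (eval F (b :: w)) = (F ^ (m + k)) (eval F (b' :: w')) →
      (F ^ m) b = (F ^ (m + k)) b' := by
    intro m k b b' w w' hb hb0 hb' h
    rw [pow_add] at h
    have h := hinj m h
    rcases k with _ | k
    · obtain ⟨c, -, hc⟩ := hS₀.existsUnique b (hS₀.subset hb)
      have e1 : b = c := hc b ⟨hb, 0, by simp⟩
      have e2 : b' = c := hc b' ⟨hb', eval F w' - eval F w, by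
        replace h : b + F (eval F w) = b' + F (eval F w') := h
        rw [map_sub, sub_eq_sub_iff_add_eq_add, h, add_comm]⟩
      simp [e1, e2]
    · refine absurd (hS b (hS₀.subset hb) ⟨(F ^ k) (eval F (b' :: w')) - eval F w, ?_⟩) hb0
      rw [map_sub, eq_sub_iff_add_eq]
      rw [pow_succ'] at h
      exact h
  obtain ⟨m, b, w, hb, hb0, -, rfl, rfl⟩ := hu
  obtain ⟨m', b', w', hb', hb'0, -, hg, rfl⟩ := hv
  rcases le_total m m' with hle | hle
  · obtain ⟨k, rfl⟩ := Nat.exists_eq_add_of_le hle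
    exact key m k b b' w w' hb hb0 hb' hg
  · obtain ⟨k, rfl⟩ := Nat.exists_eq_add_of_le hle
    exact (key m' k b' b w' w hb' hb'0 hb hg.symm).symm

theorem exists_isLowestTerm (hspan : IsSpanning F S)
    (hS : ∀ a ∈ S, (∃ c, a = F c) → a = 0) (hS₀ : IsTransversal F S S₀)
    {g : G} (hg : g ≠ 0) : ∃ u, IsLowestTerm F S S₀ g u := by
  obtain ⟨w, hw, rfl⟩ := hspan.span g
  induction w with
  | nil => exact absurd rfl hg
  | cons a w ih =>
    have hw' : IsWord S w := fun x hx => hw x (List.mem_cons_of_mem _ hx)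
    by_cases ha : a = 0
    · subst ha
      have hne : eval F w ≠ 0 := by
        intro h0
        exact hg (by simp [eval, h0])
      obtain ⟨u, m, b, w', h1, h2, h3, h4, h5⟩ := ih hw' hne
      refine ⟨F u, m + 1, b, w', h1, h2, h3, ?_, ?_⟩
      · simp only [eval, zero_add, pow_succ'] at h4 ⊢
        rw [h4]; rfl
      · rw [h5, pow_succ']; rfl
    · have haS := hw a List.mem_cons_self
      obtain ⟨b, ⟨hb, c, hc⟩, -⟩ := hS₀.existsUnique a haS
      obtain ⟨w', hw1, hw2⟩ := hspan.span (c + eval F w)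
      refine ⟨b, 0, b, w', hb, ?_, hw1, ?_, by simp⟩
      · rintro rfl
        exact ha (hS a haS ⟨c, by simpa using hc⟩)
      · simp only [eval, pow_zero, AddMonoid.End.coe_one, id, hw2, map_add, ← hc]
        abel

theorem isLowestTerm_V (hspan : IsSpanning F S)
    (hS : ∀ a ∈ S, (∃ c, a = F c) → a = 0) (hS₀ : IsTransversal F S S₀)
    {g : G} (hg : g ≠ 0) : IsLowestTerm F S S₀ g (V F S S₀ g) := by
  have h : g ≠ 0 ∧ ∃ u, IsLowestTerm F S S₀ g u :=
    ⟨hg, exists_isLowestTerm hspan hS hS₀ hg⟩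
  rw [V, dif_pos h]
  exact h.2.choose_spec

end Predicates

/-! ### The language and the structure `Γ_V` -/

section Structure

variable {G : Type u} [AddCommGroup G]

/-- Function symbols `+`, `F`, `V_F`. -/
inductive VFunc : ℕ → Type
  | add : VFunc 2
  | F : VFunc 1
  | V : VFunc 1

/-- Relation symbols `R`, `I_F`, `≼` and `I_{F,a}` for `a ∈ S ∖ {0}`. -/
inductive VRel (S : Finset G) : ℕ → Type u
  | R : VRel S 2
  | IF : VRel S 1
  | preceq : VRel S 2
  | orbit (a : {a : G // a ∈ S ∧ a ≠ 0}) : VRel S 1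

/-- The language `{+, F, V_F, R, I_F, ≼, I_{F,a} : a ∈ S ∖ {0}}`. -/
def LV (S : Finset G) : FirstOrder.Language.{0, u} := ⟨VFunc, VRel S⟩

instance finite_symbols_LV (S : Finset G) : Finite (LV S).Symbols := by
  have : Finite {a : G // a ∈ S ∧ a ≠ 0} :=
    Finite.of_injective (fun a => (⟨a.1, a.2.1⟩ : S)) fun a b h => by
      simpa [Subtype.ext_iff] using h
  have h1 : Finite (Σ l, (LV S).Functions l) := by
    refine Finite.of_surjective
      (fun i : Fin 3 => (![⟨2, VFunc.add⟩, ⟨1, VFunc.F⟩, ⟨1, VFunc.V⟩] i :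
        Σ l, (LV S).Functions l)) ?_
    rintro ⟨_, _ | _ | _⟩
    exacts [⟨0, rfl⟩, ⟨1, rfl⟩, ⟨2, rfl⟩]
  have h2 : Finite (Σ l, (LV S).Relations l) := by
    refine Finite.of_surjective
      (fun i : Fin 3 ⊕ {a : G // a ∈ S ∧ a ≠ 0} =>
        (Sum.elim ![⟨2, VRel.R⟩, ⟨1, VRel.IF⟩, ⟨2, VRel.preceq⟩]
          (fun a => ⟨1, VRel.orbit a⟩) i : Σ l, (LV S).Relations l)) ?_
    rintro ⟨_, _ | _ | _ | a⟩
    exacts [⟨Sum.inl 0, rfl⟩, ⟨Sum.inl 1, rfl⟩, ⟨Sum.inl 2, rfl⟩, ⟨Sum.inr a, rfl⟩]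
  exact inferInstanceAs (Finite (_ ⊕ _))

/-- The structure `Γ_V = (Γ, +, F, V_F, R, I_F, ≼, I_{F,a} : a ∈ S ∖ {0})`. -/
@[reducible] def gammaV (F : AddMonoid.End G) (S S₀ : Finset G) : (LV S).Structure G where
  funMap := fun {n} (f : VFunc n) x =>
    match n, f, x with
    | _, VFunc.add, x => x 0 + x 1
    | _, VFunc.F, x => F (x 0)
    | _, VFunc.V, x => V F S S₀ (x 0)
  RelMap := fun {n} (r : VRel S n) x =>
    match n, r, x with
    | _, VRel.R, x => R F S (x 0) (x 1)
    | _, VRel.IF, x => x 0 ∈ IF F S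
    | _, VRel.preceq, x => Preceq F S (x 0) (x 1)
    | _, VRel.orbit a, x => x 0 ∈ orbit F a.1

end Structure

/-! ### `F`-sets, the structure `(Γ, 𝓕)`, and `F`-automatic sets -/

section FSets

variable {G : Type u} [AddCommGroup G]

/-- `K(a, F) = {a + F a + ⋯ + Fⁿ a : n ∈ ℕ}`. -/
def K (a : G) (F : AddMonoid.End G) : Set G :=
  {g | ∃ n : ℕ, g = ∑ j ∈ Finset.range (n + 1), (F ^ j) a}

/-- `a₀ + K(a₁, F^{n₁}) + ⋯ + K(a_m, F^{n_m})` with `m ≥ 0` and positive `nᵢ`. -/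
def IsElementaryFSet (F : AddMonoid.End G) (A : Set G) : Prop :=
  ∃ (a₀ : G) (m : ℕ) (a : Fin m → G) (d : Fin m → ℕ), (∀ i, 0 < d i) ∧
    A = {g | ∃ x : Fin m → G, (∀ i, x i ∈ K (a i) (F ^ d i)) ∧ g = a₀ + ∑ i, x i}

/-- A finite union of sums of an elementary `F`-set and an `F`-invariant subgroup. -/
def IsFSet (F : AddMonoid.End G) (A : Set G) : Prop :=
  ∃ (k : ℕ) (E : Fin k → Set G) (H : Fin k → AddSubgroup G),
    (∀ i, IsElementaryFSet F (E i)) ∧ (∀ i, ∀ h ∈ H i, F h ∈ H i) ∧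
      A = {g | ∃ i, ∃ e ∈ E i, ∃ h ∈ H i, g = e + h}

/-- `F` acting coordinatewise on `Γⁿ`. -/
def powEnd (F : AddMonoid.End G) (n : ℕ) : AddMonoid.End (Fin n → G) :=
  AddMonoidHom.compLeft F (Fin n)

/-- The relational language with an `n`-ary symbol for each `F`-set of `Γⁿ`, `n > 0`. -/
def LF (F : AddMonoid.End G) : FirstOrder.Language.{0, u} :=
  ⟨fun _ => Empty, fun n => {A : Set (Fin n → G) // 0 < n ∧ IsFSet (powEnd F n) A}⟩

/-- The structure `(Γ, 𝓕)`. -/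
@[reducible] def gammaF (F : AddMonoid.End G) : (LF F).Structure G where
  funMap := fun {_} (f : Empty) => f.elim
  RelMap := fun {n} (A : {A : Set (Fin n → G) // 0 < n ∧ IsFSet (powEnd F n) A}) x => x ∈ A.1

/-- `A ⊆ Γⁿ` is `F`-automatic: for some `r > 0` and some `F^r`-spanning set `S` of `Γ`, the words
over the alphabet `Sⁿ` that represent (coordinatewise, in base `F^r`) an element of `A` form a
regular language. -/
def IsFAutomatic (F : AddMonoid.End G) {n : ℕ} (A : Set (Fin n → G)) : Prop :=
  ∃ r : ℕ, 0 < r ∧ ∃ S : Finset G, IsSpanning (F ^ r) S ∧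
    Language.IsRegular
      ({w | eval (powEnd (F ^ r) n) (w.map fun c i => (c i : G)) ∈ A} :
        _root_.Language (Fin n → S))

end FSets

/-! ### FA-presentable structures -/

/-- Convolution of an `n`-tuple of words: the word over `(A ∪ {♯})ⁿ` of length the maximal length
of the given words whose `k`-th letter is the tuple of their `k`-th letters, shorter words being
padded on the right by `♯ = none`. -/
def conv {A : Type} {n : ℕ} (w : Fin n → List A) : List (Fin n → Option A) :=
  (List.range (Finset.univ.sup fun i => (w i).length)).map fun k i => (w i)[k]?

/-- A structure in a language with finitely many symbols is FA-presentable (automatic): over some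
finite alphabet its elements are represented bijectively by the words of a regular language, so
that the convolutions of the tuples in each basic relation, and in the graph of each basic
function, form a regular language. -/
def IsFAPresentable (L : FirstOrder.Language) [Finite L.Symbols] (M : Type*) [L.Structure M] :
    Prop :=
  ∃ (A : Type) (_ : Finite A) (c : M → List A), Function.Injective c ∧
    Language.IsRegular (Set.range c : _root_.Language A) ∧
    (∀ (n : ℕ) (r : L.Relations n),
      Language.IsRegular ({w | ∃ x : Fin n → M, FirstOrder.Language.Structure.RelMap r x ∧
        w = conv fun i => c (x i)} : _root_.Language (Fin n → Option A))) ∧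
    ∀ (n : ℕ) (f : L.Functions n),
      Language.IsRegular ({w | ∃ x : Fin n → M,
        w = conv fun i => c ((Fin.snoc x (FirstOrder.Language.Structure.funMap f x) :
          Fin (n + 1) → M) i)} : _root_.Language (Fin (n + 1) → Option A))

/-! ### Decidability of the first-order theory of a structure -/

section Decidable

variable {L : FirstOrder.Language} (cf : (Σ n, L.Functions n) → ℕ)
  (cr : (Σ n, L.Relations n) → ℕ)

/-- Gödel number of a term, for numberings `cf` of the function symbols and `cv` of the
variables. -/
def termCode {α : Type} (cv : α → ℕ) : L.Term α → ℕ
  | .var x => Nat.pair 0 (cv x)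
  | .func (l := l) f ts =>
      Nat.pair 1 (Nat.pair (cf ⟨l, f⟩)
        (Encodable.encode (List.ofFn fun i => termCode cv (ts i))))

/-- Number of the bound variable `i`. -/
def varCode {n : ℕ} : Empty ⊕ Fin n → ℕ := Sum.elim Empty.elim fun i => i

/-- Gödel number of a formula without free variables other than the `n` variables in scope. -/
def formulaCode : {n : ℕ} → L.BoundedFormula Empty n → ℕ
  | _, .falsum => Nat.pair 0 0
  | _, .equal t₁ t₂ => Nat.pair 1 (Nat.pair (termCode cf varCode t₁) (termCode cf varCode t₂))
  | _, .rel (l := l) r ts =>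
      Nat.pair 2 (Nat.pair (cr ⟨l, r⟩)
        (Encodable.encode (List.ofFn fun i => termCode cf varCode (ts i))))
  | _, .imp φ ψ => Nat.pair 3 (Nat.pair (formulaCode φ) (formulaCode ψ))
  | _, .all φ => Nat.pair 4 (formulaCode φ)

variable {cf cr}

theorem termCode_injective (hf : Function.Injective cf) {α : Type} {cv : α → ℕ}
    (hv : Function.Injective cv) : Function.Injective (termCode (L := L) cf cv) := by
  intro s
  induction s with
  | var x =>
    rintro (y | ⟨f, ts⟩) h
    · simp only [termCode, Nat.pair_eq_pair, true_and] at h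
      rw [hv h]
    · simp [termCode, Nat.pair_eq_pair] at h
  | @func l f ts ih =>
    rintro (y | @⟨l', f', ts'⟩) h
    · simp [termCode, Nat.pair_eq_pair] at h
    · simp only [termCode, Nat.pair_eq_pair, true_and] at h
      obtain ⟨h1, h2⟩ := h
      obtain ⟨rfl, h1⟩ := Sigma.mk.inj_iff.1 (hf h1)
      obtain rfl := eq_of_heq h1
      have h3 := List.ofFn_injective (Encodable.encode_injective h2)
      congr 1
      funext i
      exact ih i (congrFun h3 i)

theorem formulaCode_injective (hf : Function.Injective cf) (hr : Function.Injective cr) {n : ℕ} :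
    Function.Injective (formulaCode (L := L) cf cr (n := n)) := by
  have hv : ∀ n, Function.Injective (varCode (n := n)) := by
    rintro n (⟨⟨⟩⟩ | i) (⟨⟨⟩⟩ | j) h
    exact congrArg Sum.inr (Fin.ext h)
  intro φ
  induction φ with
  | falsum =>
    rintro (_ | _ | _ | _ | _) h <;> simp [formulaCode, Nat.pair_eq_pair] at h ⊢
  | equal t₁ t₂ =>
    rintro (_ | ⟨s₁, s₂⟩ | _ | _ | _) h <;> simp only [formulaCode, Nat.pair_eq_pair] at h
    case equal =>
      rw [termCode_injective hf (hv _) h.2.1, termCode_injective hf (hv _) h.2.2]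
    all_goals omega
  | @rel n l r ts =>
    rintro (_ | _ | @⟨_, l', r', ts'⟩ | _ | _) h <;>
      simp only [formulaCode, Nat.pair_eq_pair] at h
    case rel =>
      obtain ⟨-, h1, h2⟩ := h
      obtain ⟨rfl, h1⟩ := Sigma.mk.inj_iff.1 (hr h1)
      obtain rfl := eq_of_heq h1
      have h3 := List.ofFn_injective (Encodable.encode_injective h2)
      congr 1
      funext i
      exact termCode_injective hf (hv _) (congrFun h3 i)
    all_goals omega
  | imp φ ψ ih₁ ih₂ =>
    rintro (_ | _ | _ | ⟨φ', ψ'⟩ | _) h <;> simp only [formulaCode, Nat.pair_eq_pair] at h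
    case imp => rw [ih₁ h.2.1, ih₂ h.2.2]
    all_goals omega
  | all φ ih =>
    rintro (_ | _ | _ | _ | φ') h <;> simp only [formulaCode, Nat.pair_eq_pair] at h
    case all => rw [ih h.2]
    all_goals omega

end Decidable

/-- The first-order theory of a structure in a language with finitely many symbols is decidable:
for every numbering of the symbols, the set of Gödel numbers of the sentences that are true in the
structure is computable. -/
def HasDecidableTheory (L : FirstOrder.Language) [Finite L.Symbols] (M : Type*) [L.Structure M] :
    Prop :=
  ∀ (cf : (Σ n, L.Functions n) → ℕ) (cr : (Σ n, L.Relations n) → ℕ),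
    Function.Injective cf → Function.Injective cr →
      ComputablePred fun k : ℕ => ∃ φ : L.Sentence, formulaCode cf cr φ = k ∧ M ⊨ φ

end FGamma

end

open scoped FirstOrder
noncomputable section
namespace FGamma

/-! ### Arithmetic of spanning sets -/

/-! Elements of `Γ` are read digit by digit, lowest digit first. Nonzero letters lie outside `F(Γ)`,
so an element with `n` digits that lies in `Fⁿ(Γ)` is `0`, while (C2) and (C3) keep all carries in a
finite set. Hence, for every basic relation `A` and every graph `A` of a basic function, the
derivatives `{v : c + F v ∈ A}` by tuples of letters generate a finite family (`Auto`). The members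
are sets of group elements and not of words, so the many spellings of an element play no role:
Boolean operations act on families directly, and projection is a subset construction that turns `k`
sets into at most `2 ^ k`. All definable sets therefore have finitely many derivatives, with a bound
computable from the nesting depth of the formula (`IsAutoStructure.auto_formula`).

FA-presentability follows by choosing one normal word for each element (`exists_isNormal`,
`IsNormal.unique`, `Auto.isRegular_conv`).

Decidability follows from a pumping argument: if a set has at most `k` derivatives, an existential
witness can be taken at most `k` digits longer than the parameters (`Auto.exists_mem_ball`). All
quantifiers become bounded, and truth is evaluated by primitive recursion on Gödel numbers.

For definability of `F`-sets, a number `n` is represented by `Fⁿ a` for a fixed nonzero letter `a`.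
With `V_F`, `R` and `≼` one defines `g ∈ Fⁿ(Γ)` and "`g` has at most `n` digits". A finite set `X ⊆
ℕ` with gaps at least `3` is represented by `∑_{i ∈ X} Fⁱ a`; the gaps make `X` recoverable by a
definable condition (`mem_iff_of_gap`, `exists_gap_iff`), which gives quantification over such sets.
Divisibility of exponents is then definable by a chain `0, D, 2D, …`, and `K(b, F^d)` by the
geometric sum (`mem_K_iff`). For an invariant subgroup `H`, a counting argument shows that `H /
F(H)` is finite (`exists_finite_cosets`). So `H` consists of the sums `∑ Fⁱ tᵢ` with `tᵢ` in a
finite subset of `H`, and sorting the indices by coefficient and residue mod `3` turns them into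
sums of boundedly many sparse sums.

Finally, `F`-sets are automatic because they are definable; `r = 1` and the given spanning set
suffice. -/

/-- The standing hypotheses: `F` is injective and `S` is an `F`-spanning set that meets `F(G)`
only in `0`. -/
structure IsSparseSpanning {G : Type u} [AddCommGroup G] (F : AddMonoid.End G) (S : Finset G) :
    Prop where
  inj : Function.Injective F
  span : IsSpanning F S
  eq_zero : ∀ a ∈ S, (∃ c, a = F c) → a = 0

section Ball

variable {G : Type u} [AddCommGroup G] {F : AddMonoid.End G} {S : Finset G}

variable (F S) in
/-- The elements represented by words of length `n`. -/
def Ball : ℕ → Set G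
  | 0 => {0}
  | n + 1 => {g | ∃ s ∈ S, ∃ h ∈ Ball n, g = s + F h}

theorem mem_ball_iff {n : ℕ} {g : G} :
    g ∈ Ball F S n ↔ ∃ w : List G, IsWord S w ∧ w.length = n ∧ eval F w = g := by
  induction n generalizing g with
  | zero =>
    constructor
    · intro h
      exact ⟨[], by simp [IsWord], rfl, (Set.mem_singleton_iff.1 h).symm⟩
    · rintro ⟨w, -, hl, rfl⟩
      rw [List.length_eq_zero_iff.1 hl]
      exact Set.mem_singleton _
  | succ n ih =>
    constructor
    · rintro ⟨s, hs, h, hh, rfl⟩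
      obtain ⟨w, hw, hl, rfl⟩ := ih.1 hh
      refine ⟨s :: w, ?_, by simp [hl], rfl⟩
      intro a ha
      rcases List.mem_cons.1 ha with rfl | ha
      exacts [hs, hw a ha]
    · rintro ⟨w, hw, hl, rfl⟩
      rcases w with _ | ⟨s, w⟩
      · simp at hl
      · exact ⟨s, hw s List.mem_cons_self, _, ih.2 ⟨w, fun a ha => hw a (List.mem_cons_of_mem _ ha),
          by simpa using hl, rfl⟩, rfl⟩

theorem pow_succ_apply' (n : ℕ) (g : G) : (F ^ (n + 1)) g = F ((F ^ n) g) := by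
  rw [pow_succ']; rfl

theorem pow_succ_apply (n : ℕ) (g : G) : (F ^ (n + 1)) g = (F ^ n) (F g) := by
  rw [pow_succ]; rfl

theorem pow_add_apply (m n : ℕ) (g : G) : (F ^ (m + n)) g = (F ^ m) ((F ^ n) g) := by
  rw [pow_add]; rfl

theorem pow_zero_apply (g : G) : (F ^ 0) g = g := by simp

theorem mem_ball_one {s : G} (hs : s ∈ S) : s ∈ Ball F S 1 :=
  ⟨s, hs, 0, Set.mem_singleton _, by simp⟩

namespace IsSparseSpanning

variable (h : IsSparseSpanning F S)
include h

theorem zero_mem : (0 : G) ∈ S := h.span.zero_mem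

theorem pow_inj (n : ℕ) : Function.Injective (F ^ n) := by
  rw [AddMonoid.End.coe_pow]
  exact h.inj.iterate n

/-- (C3) extends to three summands: by (C2) the sum is `x + F y`, and `x` is a letter in `F(G)`,
hence `0`. -/
theorem carry {a b c d : G} (ha : a ∈ S) (hb : b ∈ S) (hc : c ∈ S) (e : a + b + c = F d) :
    d ∈ S := by
  obtain ⟨x, hx, y, hy, e'⟩ := h.span.add_mem a ha b hb c hc
  have hx0 : x = 0 := h.eq_zero x hx ⟨d - y, by rw [map_sub, ← e, e']; abel⟩
  have : d = y := h.inj (by rw [← e, e', hx0, zero_add])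
  exact this ▸ hy

theorem exists_digit (g : G) : ∃ s ∈ S, ∃ k, g = s + F k := by
  obtain ⟨w, hw, rfl⟩ := h.span.span g
  rcases w with _ | ⟨s, w⟩
  · exact ⟨0, h.zero_mem, 0, by simp [eval]⟩
  · exact ⟨s, hw s List.mem_cons_self, _, rfl⟩

theorem exists_mem_ball (g : G) : ∃ n, g ∈ Ball F S n := by
  obtain ⟨w, hw, e⟩ := h.span.span g
  exact ⟨w.length, mem_ball_iff.2 ⟨w, hw, rfl, e⟩⟩

theorem zero_mem_ball (n : ℕ) : (0 : G) ∈ Ball F S n := by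
  induction n with
  | zero => exact Set.mem_singleton _
  | succ n ih => exact ⟨0, h.zero_mem, 0, ih, by simp⟩

theorem ball_succ_subset (n : ℕ) : Ball F S n ⊆ Ball F S (n + 1) := by
  induction n with
  | zero =>
    rintro g hg
    rw [Set.mem_singleton_iff.1 hg]
    exact h.zero_mem_ball 1
  | succ n ih =>
    rintro g ⟨s, hs, k, hk, rfl⟩
    exact ⟨s, hs, k, ih hk, rfl⟩

theorem ball_mono {m n : ℕ} (hmn : m ≤ n) : Ball F S m ⊆ Ball F S n :=
  monotone_nat_of_le_succ h.ball_succ_subset hmn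

/-- Schoolbook addition with incoming carry `s`: (C2) writes the sum of the two lowest digits and
the carry as a digit plus `F` of the next carry. -/
theorem letter_add_add_mem_ball {n : ℕ} {s a b : G} (hs : s ∈ S) (ha : a ∈ Ball F S n)
    (hb : b ∈ Ball F S n) : s + (a + b) ∈ Ball F S (n + 1) := by
  induction n generalizing s a b with
  | zero =>
    rw [Set.mem_singleton_iff.1 ha, Set.mem_singleton_iff.1 hb]
    simpa using mem_ball_one hs
  | succ n ih =>
    obtain ⟨x, hx, a, ha, rfl⟩ := ha
    obtain ⟨y, hy, b, hb, rfl⟩ := hb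
    obtain ⟨d, hd, e, he, hde⟩ := h.span.add_mem s hs x hx y hy
    refine ⟨d, hd, e + (a + b), ih he ha hb, ?_⟩
    rw [map_add, map_add, ← add_assoc d, ← hde]
    abel

theorem add_mem_ball {n : ℕ} {a b : G} (ha : a ∈ Ball F S n) (hb : b ∈ Ball F S n) :
    a + b ∈ Ball F S (n + 1) := by
  simpa using h.letter_add_add_mem_ball h.zero_mem ha hb

theorem neg_mem_ball {n : ℕ} {a : G} (ha : a ∈ Ball F S n) : -a ∈ Ball F S n := by
  induction n generalizing a with
  | zero => rw [Set.mem_singleton_iff.1 ha, neg_zero]; exact Set.mem_singleton _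
  | succ n ih =>
    obtain ⟨x, hx, a, ha, rfl⟩ := ha
    exact ⟨-x, h.span.neg_mem x hx, -a, ih ha, by rw [map_neg]; abel⟩

theorem sub_mem_ball {n : ℕ} {a b : G} (ha : a ∈ Ball F S n) (hb : b ∈ Ball F S n) :
    a - b ∈ Ball F S (n + 1) := by
  rw [sub_eq_add_neg]
  exact h.add_mem_ball ha (h.neg_mem_ball hb)

/-- The lowest digit is a letter in `F(G)`, hence `0`; cancel one `F` and repeat. -/
theorem eq_zero_of_mem_ball {n : ℕ} {g c : G} (hg : g ∈ Ball F S n) (e : g = (F ^ n) c) :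
    g = 0 := by
  induction n generalizing g c with
  | zero => exact hg
  | succ n ih =>
    obtain ⟨s, hs, k, hk, rfl⟩ := hg
    rw [pow_succ_apply'] at e
    have hs0 : s = 0 := h.eq_zero s hs ⟨(F ^ n) c - k, by rw [map_sub, ← e]; abel⟩
    subst hs0
    rw [zero_add] at e ⊢
    rw [ih hk (h.inj e), map_zero]

/-- The exponent is `n + 1` because a difference of two elements with `n` digits may need `n + 1`
digits. -/
theorem eq_of_sub_eq {n : ℕ} {p q c : G} (hp : p ∈ Ball F S n) (hq : q ∈ Ball F S n)
    (e : p - q = (F ^ (n + 1)) c) : p = q :=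
  sub_eq_zero.1 (h.eq_zero_of_mem_ball (h.sub_mem_ball hp hq) e)

/-- The difference `x - y` is fixed by `F ^ d`, so it is divisible by every power of `F`, although
it has only finitely many digits. -/
theorem pow_sub_injective {d : ℕ} (hd : 0 < d) {x y : G} (e : (F ^ d) x - x = (F ^ d) y - y) :
    x = y := by
  have e1 : (F ^ d) (x - y) = x - y := by rw [map_sub]; rw [sub_eq_sub_iff_add_eq_add] at e ⊢
                                          rw [e]; abel
  obtain ⟨n, hn⟩ := h.exists_mem_ball (x - y)
  have key : ∀ k, (F ^ (d * k)) (x - y) = x - y := by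
    intro k
    induction k with
    | zero => simp
    | succ k ih => rw [Nat.mul_succ, pow_add_apply, e1, ih]
  refine sub_eq_zero.1 (h.eq_zero_of_mem_ball (h.ball_mono (Nat.le_mul_of_pos_left n hd) hn)
    (key n).symm)

/-- After cancelling the smaller power of `F`, unequal exponents would put a nonzero letter into
`F(G)`. Elements of `I_F` thus determine their exponent and letter. -/
theorem pow_apply_eq_pow_apply {i j : ℕ} {a b : G} (ha : a ∈ S) (hb : b ∈ S) (ha0 : a ≠ 0)
    (hb0 : b ≠ 0) (e : (F ^ i) a = (F ^ j) b) : i = j ∧ a = b := by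
  have key : ∀ {i j : ℕ} {a b : G}, a ∈ S → a ≠ 0 → (F ^ i) a = (F ^ j) b → ¬ i < j := by
    intro i j a b ha ha0 e hij
    obtain ⟨k, rfl⟩ := Nat.exists_eq_add_of_lt hij
    rw [add_assoc, pow_add_apply, pow_succ_apply'] at e
    exact ha0 (h.eq_zero a ha ⟨_, h.pow_inj i e⟩)
  have hij : i = j := le_antisymm (not_lt.1 (key hb hb0 e.symm)) (not_lt.1 (key ha ha0 e))
  subst hij
  exact ⟨rfl, h.pow_inj i e⟩

end IsSparseSpanning

end Ball

/-! ### Sets with finitely many derivatives -/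

section Auto

variable {G : Type u} [AddCommGroup G]

/-- The derivative of `A ⊆ G^ι` by the letter `c`. -/
def deriv (F : AddMonoid.End G) {ι : Type*} (c : ι → G) (A : Set (ι → G)) : Set (ι → G) :=
  {v | (fun i => c i + F (v i)) ∈ A}

/-- `A` belongs to a family of at most `k` sets that is closed under derivatives by letters
of `S`. -/
def Auto (F : AddMonoid.End G) (S : Finset G) {ι : Type*} (k : ℕ) (A : Set (ι → G)) : Prop :=
  ∃ 𝒜 : Finset (Set (ι → G)), 𝒜.card ≤ k ∧ A ∈ 𝒜 ∧
    ∀ B ∈ 𝒜, ∀ c : ι → S, deriv F (fun i => (c i : G)) B ∈ 𝒜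

variable {F : AddMonoid.End G} {S : Finset G} {ι κ : Type*}

theorem Auto.mono {k l : ℕ} {A : Set (ι → G)} (hA : Auto F S k A) (hkl : k ≤ l) : Auto F S l A := by
  obtain ⟨𝒜, h1, h2, h3⟩ := hA
  exact ⟨𝒜, h1.trans hkl, h2, h3⟩

theorem Auto.deriv {k : ℕ} {A : Set (ι → G)} (hA : Auto F S k A) (c : ι → S) :
    Auto F S k (deriv F (fun i => (c i : G)) A) := by
  obtain ⟨𝒜, h1, h2, h3⟩ := hA
  exact ⟨𝒜, h1, h3 _ h2 c, h3⟩

open Classical in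
theorem Auto.compl {k : ℕ} {A : Set (ι → G)} (hA : Auto F S k A) : Auto F S k Aᶜ := by
  obtain ⟨𝒜, h1, h2, h3⟩ := hA
  refine ⟨𝒜.image fun B => Bᶜ, Finset.card_image_le.trans h1, Finset.mem_image_of_mem _ h2, ?_⟩
  intro B' hB' c
  obtain ⟨B, hB, rfl⟩ := Finset.mem_image.1 hB'
  exact Finset.mem_image.2 ⟨_, h3 B hB c, rfl⟩

open Classical in
theorem Auto.iInter {n : ℕ} {k : Fin n → ℕ} {A : Fin n → Set (ι → G)}
    (hA : ∀ i, Auto F S (k i) (A i)) : Auto F S (∏ i, k i) (⋂ i, A i) := by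
  choose 𝒜 h1 h2 h3 using hA
  refine ⟨(Fintype.piFinset 𝒜).image fun B => ⋂ i, B i, ?_, ?_, ?_⟩
  · refine Finset.card_image_le.trans ?_
    rw [Fintype.card_piFinset]
    exact Finset.prod_le_prod' fun i _ => h1 i
  · exact Finset.mem_image.2 ⟨A, Fintype.mem_piFinset.2 h2, rfl⟩
  · intro B' hB' c
    obtain ⟨B, hB, rfl⟩ := Finset.mem_image.1 hB'
    refine Finset.mem_image.2 ⟨fun i => FGamma.deriv F (fun i => (c i : G)) (B i),
      Fintype.mem_piFinset.2 fun i => h3 i _ (Fintype.mem_piFinset.1 hB i) c, ?_⟩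
    ext v
    simp [FGamma.deriv]

open Classical in
theorem Auto.inter {k l : ℕ} {A B : Set (ι → G)} (hA : Auto F S k A) (hB : Auto F S l B) :
    Auto F S (k * l) (A ∩ B) := by
  obtain ⟨𝒜, h1, h2, h3⟩ := hA
  obtain ⟨ℬ, g1, g2, g3⟩ := hB
  refine ⟨Finset.image₂ (· ∩ ·) 𝒜 ℬ, (Finset.card_image₂_le _ _ _).trans (Nat.mul_le_mul h1 g1),
    Finset.mem_image₂_of_mem h2 g2, ?_⟩
  intro C hC c
  obtain ⟨A, hA, B, hB, rfl⟩ := Finset.mem_image₂.1 hC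
  exact Finset.mem_image₂.2 ⟨_, h3 A hA c, _, g3 B hB c, rfl⟩

theorem Auto.union {k l : ℕ} {A B : Set (ι → G)} (hA : Auto F S k A) (hB : Auto F S l B) :
    Auto F S (k * l) (A ∪ B) := by
  have := (hA.compl.inter hB.compl).compl
  rwa [Set.compl_inter, compl_compl, compl_compl] at this

theorem auto_empty : Auto F S 1 (∅ : Set (ι → G)) :=
  ⟨{∅}, by simp, by simp, by intro B hB c; rw [Finset.mem_singleton.1 hB]; simp; rfl⟩

theorem auto_univ : Auto F S 1 (Set.univ : Set (ι → G)) := by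
  simpa using (auto_empty (F := F) (S := S) (ι := ι)).compl

open Classical in
theorem Auto.reindex {k : ℕ} {A : Set (ι → G)} (hA : Auto F S k A) (f : ι → κ) :
    Auto F S k {v : κ → G | v ∘ f ∈ A} := by
  obtain ⟨𝒜, h1, h2, h3⟩ := hA
  refine ⟨𝒜.image fun B => {v : κ → G | v ∘ f ∈ B}, Finset.card_image_le.trans h1,
    Finset.mem_image_of_mem _ h2, ?_⟩
  intro B' hB' c
  obtain ⟨B, hB, rfl⟩ := Finset.mem_image.1 hB'
  exact Finset.mem_image.2 ⟨_, h3 B hB (c ∘ f), rfl⟩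

theorem sumElim_mem_deriv {c : ι → S} {s : κ → S} {v : ι → G} {y : κ → G}
    {A : Set (ι ⊕ κ → G)} :
    Sum.elim v y ∈ deriv F (fun i => ((Sum.elim c s : ι ⊕ κ → S) i : G)) A ↔
      Sum.elim (fun i => (c i : G) + F (v i)) (fun j => (s j : G) + F (y j)) ∈ A := by
  have : (fun i => ((Sum.elim c s : ι ⊕ κ → S) i : G) + F ((Sum.elim v y : ι ⊕ κ → G) i)) =
      Sum.elim (fun i => (c i : G) + F (v i)) (fun j => (s j : G) + F (y j)) := by
    ext (i | i) <;> rfl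
  rw [← this]
  rfl

-- Subset construction. The derivative by `c` of a projection is the union, over all tuples of
-- letters `s`, of the projections of the derivatives by `(c, s)`, since every witness has some
-- lowest digits `s`. The new family consists of the projections of unions of subfamilies.
open Classical in
theorem Auto.proj (h : IsSparseSpanning F S) {k : ℕ} {A : Set (ι ⊕ κ → G)} (hA : Auto F S k A) :
    Auto F S (2 ^ k) {v : ι → G | ∃ y : κ → G, Sum.elim v y ∈ A} := by
  obtain ⟨𝒜, h1, h2, h3⟩ := hA
  refine ⟨𝒜.powerset.image fun T => {v : ι → G | ∃ B ∈ T, ∃ y : κ → G, Sum.elim v y ∈ B}, ?_, ?_, ?_⟩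
  · refine Finset.card_image_le.trans ?_
    rw [Finset.card_powerset]
    exact Nat.pow_le_pow_right (by norm_num) h1
  · exact Finset.mem_image.2 ⟨{A}, by simpa using h2, by simp⟩
  · intro B hB c
    obtain ⟨T, hT', rfl⟩ := Finset.mem_image.1 hB
    have hT := Finset.mem_powerset.1 hT'
    obtain ⟨U, hU⟩ : ∃ U : Finset (Set (ι ⊕ κ → G)), ∀ C, C ∈ U ↔ C ∈ 𝒜 ∧ ∃ B ∈ T, ∃ s : κ → S,
        C = FGamma.deriv F (fun i => ((Sum.elim c s : ι ⊕ κ → S) i : G)) B :=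
      ⟨𝒜.filter _, fun C => Finset.mem_filter⟩
    refine Finset.mem_image.2 ⟨U, Finset.mem_powerset.2 fun C hC => ((hU C).1 hC).1, ?_⟩
    ext v
    constructor
    · rintro ⟨_, hC, y, hy⟩
      obtain ⟨_, B, hB, s, rfl⟩ := (hU _).1 hC
      exact ⟨B, hB, _, sumElim_mem_deriv.1 hy⟩
    · rintro ⟨B, hB, y, hy⟩
      choose s hs y' hy' using fun i => h.exists_digit (y i)
      refine ⟨_, (hU _).2 ⟨h3 B (hT hB) (Sum.elim c fun i => ⟨s i, hs i⟩), B, hB, _, rfl⟩, y', ?_⟩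
      rw [sumElim_mem_deriv]
      simpa only [← hy'] using hy

open Classical in
/-- Solutions of finite systems of set equations `A_q = …`, given by their derivatives, have
finitely many derivatives. -/
theorem auto_of_system [Finite ι] {Q : Type*} [Finite Q] (A : Q → Set (ι → G))
    (hA : ∀ q (c : ι → S), ∃ (T : Set Q) (B : Set (ι → G)), (∃ k, Auto F S k B) ∧
      deriv F (fun i => (c i : G)) (A q) = B ∪ ⋃ q' ∈ T, A q') (q : Q) :
    ∃ k, Auto F S k (A q) := by
  have := Fintype.ofFinite Q
  have := Fintype.ofFinite ι
  choose T B hB hAB using hA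
  choose k 𝒜 h1 h2 h3 using hB
  let 𝒟 : Finset (Set (ι → G)) := Finset.univ.biUnion fun q => Finset.univ.biUnion fun c => 𝒜 q c
  have h𝒟 : ∀ q c, ∀ B ∈ 𝒜 q c, B ∈ 𝒟 := fun q c B hB =>
    Finset.mem_biUnion.2 ⟨q, Finset.mem_univ _, Finset.mem_biUnion.2 ⟨c, Finset.mem_univ _, hB⟩⟩
  have h𝒟' : ∀ B ∈ 𝒟, ∀ c : ι → S, deriv F (fun i => (c i : G)) B ∈ 𝒟 := by
    intro B hB c
    obtain ⟨q, -, hB⟩ := Finset.mem_biUnion.1 hB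
    obtain ⟨c', -, hB⟩ := Finset.mem_biUnion.1 hB
    exact h𝒟 q c' _ (h3 q c' B hB c)
  -- The closed family: unions of some of the unknowns `A q` and of some sets from the finite pool
  -- `𝒟`, which contains the inhomogeneous terms and their derivatives.
  refine ⟨_, ((Finset.univ : Finset (Finset Q)) ×ˢ 𝒟.powerset).image
    fun p => (⋃ q ∈ p.1, A q) ∪ ⋃ B ∈ p.2, B, le_rfl, ?_, ?_⟩
  · exact Finset.mem_image.2 ⟨({q}, ∅), by simp, by simp⟩
  · intro C hC c
    obtain ⟨⟨P, U⟩, hPU, rfl⟩ := Finset.mem_image.1 hC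
    have hU : U ⊆ 𝒟 := by simpa using hPU
    refine Finset.mem_image.2 ⟨(Finset.univ.filter fun q' => ∃ q ∈ P, q' ∈ T q c,
      U.image (deriv F (fun i => (c i : G))) ∪ P.image fun q => B q c), ?_, ?_⟩
    · simp only [Finset.mem_product, Finset.mem_univ, true_and, Finset.mem_powerset]
      intro D' hD'
      rcases Finset.mem_union.1 hD' with hD' | hD'
      · obtain ⟨D, hD, rfl⟩ := Finset.mem_image.1 hD'
        exact h𝒟' D (hU hD) c
      · obtain ⟨q, hq, rfl⟩ := Finset.mem_image.1 hD'
        exact h𝒟 q c _ (h2 q c)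
    · have key : ∀ q v, ((fun i => (c i : G) + F (v i)) ∈ A q) ↔
          v ∈ B q c ∨ ∃ q' ∈ T q c, v ∈ A q' := by
        intro q v
        have := Set.ext_iff.1 (hAB q c) v
        simpa [deriv] using this
      ext v
      simp only [deriv, Set.mem_union, Set.mem_iUnion, Finset.mem_filter, Finset.mem_univ,
        true_and, Finset.mem_union, Finset.mem_image, Set.mem_ofPred_eq, exists_prop, key]
      constructor
      · rintro (⟨q', ⟨q, hq, hq'⟩, hv⟩ | ⟨D, ⟨D, hD, rfl⟩ | ⟨q, hq, rfl⟩, hv⟩)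
        · exact Or.inl ⟨q, hq, Or.inr ⟨q', hq', hv⟩⟩
        · exact Or.inr ⟨D, hD, hv⟩
        · exact Or.inl ⟨q, hq, Or.inl hv⟩
      · rintro (⟨q, hq, hv | ⟨q', hq', hv⟩⟩ | ⟨D, hD, hv⟩)
        · exact Or.inr ⟨_, Or.inr ⟨q, hq, rfl⟩, hv⟩
        · exact Or.inl ⟨q', ⟨q, hq, hq'⟩, hv⟩
        · exact Or.inr ⟨_, Or.inl ⟨D, hD, rfl⟩, hv⟩

/-- The relation `ℓ(v) + κ(q) = 0` for an additive map `ℓ` that commutes with `F`. -/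
theorem auto_linear [Finite ι] {Q : Type*} [Finite Q] (ℓ : (ι → G) →+ G)
    (hℓ : ∀ v, ℓ (fun i => F (v i)) = F (ℓ v)) (val : Q → G)
    (hval : ∀ q (c : ι → S) d, ℓ (fun i => (c i : G)) + val q = F d → ∃ q', val q' = d) (q : Q) :
    ∃ k, Auto F S k {v | ℓ v + val q = 0} := by
  refine auto_of_system (fun q => {v | ℓ v + val q = 0}) (fun q c => ?_) q
  refine ⟨{q' | ℓ (fun i => (c i : G)) + val q = F (val q')}, ∅, ⟨1, auto_empty⟩, ?_⟩
  have e : ∀ v : ι → G, ℓ (fun i => (c i : G) + F (v i)) + val q =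
      ℓ (fun i => (c i : G)) + val q + F (ℓ v) := by
    intro v
    have := ℓ.map_add (fun i => (c i : G)) (fun i => F (v i))
    rw [hℓ] at this
    rw [show (fun i => (c i : G) + F (v i)) = (fun i => (c i : G)) + fun i => F (v i) from rfl, this]
    abel
  ext v
  simp only [deriv, Set.mem_ofPred_eq, e, Set.empty_union, Set.mem_iUnion, exists_prop]
  constructor
  · intro hv
    -- The equation itself makes the old carry plus the digits divisible by `F`; the quotient `-ℓ v`
    -- is the new carry.
    obtain ⟨q', hq'⟩ := hval q c (-ℓ v) (by rw [map_neg]; exact eq_neg_of_add_eq_zero_left hv)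
    refine ⟨q', ?_, by rw [hq']; abel⟩
    rw [hq', map_neg]
    exact eq_neg_of_add_eq_zero_left hv
  · rintro ⟨q', h1, h2⟩
    rw [h1, ← map_add, add_comm, h2, map_zero]

/-- A set `A` with `A = A₀ ∪ F(A)`. -/
theorem auto_of_shift [Finite ι] (h : IsSparseSpanning F S) {A A₀ : Set (ι → G)} {k : ℕ}
    (h₀ : Auto F S k A₀) (hA : ∀ v, v ∈ A ↔ v ∈ A₀ ∨ ∃ w ∈ A, v = fun i => F (w i)) :
    ∃ l, Auto F S l A := by
  refine auto_of_system (fun _ : Unit => A) (fun _ c => ?_) ()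
  -- An element of `F(A)` has lowest digit `0` in each coordinate, so for other letters `c` only
  -- `A₀` contributes.
  refine ⟨{_u | ∀ i, (c i : G) = 0}, _, ⟨k, h₀.deriv c⟩, ?_⟩
  ext v
  simp only [deriv, Set.mem_ofPred_eq, Set.mem_union, Set.mem_iUnion, exists_prop, exists_const]
  rw [hA]
  refine or_congr Iff.rfl ⟨?_, ?_⟩
  · rintro ⟨w, hw, e⟩
    have hc : ∀ i, (c i : G) = 0 := fun i => h.eq_zero _ (c i).2 ⟨w i - v i, by
      rw [map_sub, ← congrFun e i]; abel⟩
    refine ⟨hc, ?_⟩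
    convert hw using 1
    ext i
    have := congrFun e i
    simp only [hc, zero_add] at this
    exact h.inj this
  · rintro ⟨hc, hv⟩
    exact ⟨v, hv, by ext i; simp [hc]⟩

end Auto

end FGamma
end

open scoped FirstOrder
noncomputable section
namespace FGamma

/-! ### The basic relations have finitely many derivatives -/

section Basic

variable {G : Type u} [AddCommGroup G] {F : AddMonoid.End G} {S S₀ : Finset G}

theorem Auto.congr {ι : Type*} {k : ℕ} {A B : Set (ι → G)} (hA : Auto F S k A) (e : B = A) :
    Auto F S k B := e ▸ hA

theorem auto_biUnion {ι β : Type*} (T : Finset β) {A : β → Set (ι → G)}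
    (hA : ∀ b ∈ T, ∃ k, Auto F S k (A b)) : ∃ k, Auto F S k (⋃ b ∈ T, A b) := by
  classical
  induction T using Finset.induction_on with
  | empty => exact ⟨1, by simpa using auto_empty⟩
  | insert b T _ ih =>
    obtain ⟨k, hk⟩ := ih fun b hb => hA b (Finset.mem_insert_of_mem hb)
    obtain ⟨l, hl⟩ := hA b (Finset.mem_insert_self _ _)
    exact ⟨l * k, by rw [Finset.set_biUnion_insert]; exact hl.union hk⟩

/-- The condition depends only on the lowest digit, so every derivative is everything or empty. -/
theorem auto_residue {ι : Type*} [Finite ι] (b : G) (i : ι) : ∃ l, Auto F S l {v : ι → G | ∃ c, v i - b = F c} := by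
  refine auto_of_system (fun _ : Unit => {v : ι → G | ∃ c, v i - b = F c}) (fun _ c => ?_) ()
  refine ⟨∅, {_v | ∃ d, (c i : G) - b = F d}, ?_, ?_⟩
  · by_cases hd : ∃ d, (c i : G) - b = F d
    · exact ⟨1, by simpa [hd] using auto_univ⟩
    · exact ⟨1, by simpa [hd] using auto_empty⟩
  · ext v
    simp only [deriv, Set.mem_ofPred_eq, Set.mem_empty_iff_false, Set.iUnion_of_empty,
      Set.iUnion_empty, Set.union_empty]
    constructor
    · rintro ⟨d, hd⟩
      exact ⟨d - v i, by rw [map_sub, ← hd]; abel⟩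
    · rintro ⟨d, hd⟩
      exact ⟨d + v i, by rw [map_add, ← hd]; abel⟩

theorem V_zero : V F S S₀ 0 = 0 := by simp [V]

variable (h : IsSparseSpanning F S)
include h

section

variable {ι : Type*} [Finite ι]

/-- The states are the carries, which remain in `S` by `carry`. Equality is the case `s = 0`; the
other carries occur in the system for `R`. -/
theorem auto_sub_eq {s : G} (hs : s ∈ S) (i j : ι) :
    ∃ k, Auto F S k {v : ι → G | v i - v j + s = 0} := by
  refine auto_linear (Q := S) (Pi.evalAddMonoidHom (fun _ => G) i - Pi.evalAddMonoidHom _ j)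
    (fun v => by simp) (fun s => (s : G)) ?_ ⟨s, hs⟩
  intro q c d e
  have e' : (c i : G) + -(c j : G) + q = F d := by rw [← e]; simp [sub_eq_add_neg]
  exact ⟨⟨d, h.carry (c i).2 (h.span.neg_mem _ (c j).2) q.2 e'⟩, rfl⟩

theorem auto_eq (i j : ι) : ∃ k, Auto F S k {v : ι → G | v i = v j} := by
  simpa [sub_eq_zero] using auto_sub_eq h h.zero_mem i j

theorem auto_eq_letter {s : G} (hs : s ∈ S) (i : ι) : ∃ k, Auto F S k {v : ι → G | v i = s} := by
  have := auto_linear (F := F) (S := S) (Q := S) (Pi.evalAddMonoidHom (fun _ => G) i)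
    (fun v => by simp) (fun s => (s : G)) ?_ ⟨-s, h.span.neg_mem s hs⟩
  · simpa [← sub_eq_add_neg, sub_eq_zero] using this
  · intro q c d e
    have e' : (c i : G) + q + 0 = F d := by rw [← e]; simp
    exact ⟨⟨d, h.carry (c i).2 q.2 h.zero_mem e'⟩, rfl⟩

/-- Here the carries are sums of two letters. By (C2) the three digits contribute `x + F y`, and `x`
together with the old carry is three letters, so `carry` gives a letter; the new carry is that
letter plus `y`. -/
theorem auto_add (i j k : ι) : ∃ l, Auto F S l {v : ι → G | v i + v j = v k} := by
  have := auto_linear (F := F) (S := S) (Q := S × S) (Pi.evalAddMonoidHom (fun _ => G) i +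
    Pi.evalAddMonoidHom _ j - Pi.evalAddMonoidHom _ k)
    (fun v => by simp) (fun s => (s.1 : G) + s.2) ?_ (⟨0, h.zero_mem⟩, ⟨0, h.zero_mem⟩)
  · simpa [sub_eq_zero] using this
  · rintro ⟨q, q'⟩ c d e
    obtain ⟨x, hx, y, hy, e1⟩ := h.span.add_mem _ (c i).2 _ (c j).2 _ (h.span.neg_mem _ (c k).2)
    have e' : x + q + q' = F (d - y) := by
      rw [map_sub, ← e]
      simp only [AddMonoidHom.sub_apply, AddMonoidHom.add_apply, Pi.evalAddMonoidHom_apply]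
      rw [sub_eq_add_neg ((c i : G) + c j), e1]
      abel
    exact ⟨(⟨d - y, h.carry hx q.2 q'.2 e'⟩, ⟨y, hy⟩), by simp⟩

/-- The digit `c i` only takes effect one place higher, so the new carry is a letter from `carry`
plus the delayed digit `c i`. -/
theorem auto_map (i j : ι) : ∃ l, Auto F S l {v : ι → G | F (v i) = v j} := by
  have := auto_linear (F := F) (S := S) (Q := S × S) ((F : G →+ G).comp (Pi.evalAddMonoidHom (fun _ => G) i) -
    Pi.evalAddMonoidHom _ j)
    (fun v => (map_sub F _ _).symm) (fun s => (s.1 : G) + s.2) ?_ (⟨0, h.zero_mem⟩, ⟨0, h.zero_mem⟩)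
  · refine this.imp fun k hk => hk.congr ?_
    ext v
    change F (v i) = v j ↔ F (v i) - v j + (0 + 0) = 0
    rw [add_zero, add_zero, sub_eq_zero]
  · rintro ⟨q, q'⟩ c d e
    have e : F (c i) - c j + (q + q') = F d := e
    have e' : -(c j : G) + q + q' = F (d - c i) := by
      rw [map_sub, ← e]
      abel
    exact ⟨(⟨d - c i, h.carry (h.span.neg_mem _ (c j).2) q.2 q'.2 e'⟩, c i), by simp⟩

theorem auto_orbit {ι : Type*} {a : G} (ha : a ∈ S) (i : ι) :
    ∃ k, Auto F S k {v : ι → G | v i ∈ orbit F a} := by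
  suffices ∃ k, Auto F S k {v : Unit → G | v () ∈ orbit F a} by
    obtain ⟨k, hk⟩ := this
    exact ⟨k, hk.reindex fun _ => i⟩
  obtain ⟨k, hk⟩ := auto_eq_letter (ι := Unit) h ha ()
  refine auto_of_shift h hk fun v => ⟨?_, ?_⟩
  · rintro ⟨n, hn⟩
    rcases n with _ | n
    · left; simpa using hn
    · right
      exact ⟨fun _ => (F ^ n) a, ⟨n, rfl⟩, by ext; rw [← pow_succ_apply', ← hn]⟩
  · rintro (hv | ⟨w, ⟨n, hn⟩, rfl⟩)
    · exact ⟨0, by simpa using hv⟩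
    · exact ⟨n + 1, by rw [pow_succ_apply', ← hn]⟩

theorem auto_IF {ι : Type*} (i : ι) : ∃ k, Auto F S k {v : ι → G | v i ∈ IF F S} := by
  classical
  have := auto_biUnion (F := F) (S := S) (S.filter (· ≠ 0))
    (A := fun a => {v : ι → G | v i ∈ orbit F a})
    fun a ha => auto_orbit h (Finset.mem_filter.1 ha).1 i
  convert this using 3
  ext v
  simp [IF, and_assoc]

theorem auto_letter (i : ι) : ∃ k, Auto F S k {v : ι → G | v i ∈ S ∧ v i ≠ 0} := by
  classical
  have := auto_biUnion (F := F) (S := S) (S.filter (· ≠ 0)) (A := fun a => {v : ι → G | v i = a})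
    fun a ha => auto_eq_letter h (Finset.mem_filter.1 ha).1 i
  convert this using 3
  ext v
  simp

end

theorem auto_preceq : ∃ k, Auto F S k {v : Fin 2 → G | Preceq F S (v 0) (v 1)} := by
  obtain ⟨k₁, h₁⟩ := auto_letter (ι := Fin 2) h 0
  obtain ⟨k₂, h₂⟩ := auto_IF (ι := Fin 2) h 1
  obtain ⟨k₃, h₃⟩ := auto_IF (ι := Fin 2) h 0
  obtain ⟨k₄, h₄⟩ := auto_eq_letter (ι := Fin 2) h h.zero_mem 0
  obtain ⟨k₅, h₅⟩ := auto_eq_letter (ι := Fin 2) h h.zero_mem 1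
  obtain ⟨k₆, h₆⟩ : ∃ k, Auto F S k {v : Fin 2 → G | ∃ i j : ℕ, ∃ a ∈ S, ∃ b ∈ S, a ≠ 0 ∧ b ≠ 0 ∧
      v 0 = (F ^ i) a ∧ v 1 = (F ^ j) b ∧ i ≤ j} := by
    -- The relation is invariant under applying `F` to both arguments; the pairs with `i = 0` form
    -- the base layer: a nonzero letter and any element of `I_F`.
    refine auto_of_shift h (h₁.inter h₂) fun v => ⟨?_, ?_⟩
    · rintro ⟨i, j, a, ha, b, hb, ha0, hb0, e1, e2, hij⟩
      rcases i with _ | i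
      · rw [pow_zero_apply] at e1
        exact Or.inl ⟨⟨e1 ▸ ha, e1 ▸ ha0⟩, b, hb, hb0, j, e2⟩
      · obtain ⟨j, rfl⟩ : ∃ j', j = j' + 1 := ⟨j - 1, by omega⟩
        refine Or.inr ⟨![(F ^ i) a, (F ^ j) b],
          ⟨i, j, a, ha, b, hb, ha0, hb0, rfl, rfl, by omega⟩, ?_⟩
        ext t
        fin_cases t
        · simpa [pow_succ_apply'] using e1
        · simpa [pow_succ_apply'] using e2
    · rintro (⟨⟨ha, ha0⟩, b, hb, hb0, j, e⟩ | ⟨w, ⟨i, j, a, ha, b, hb, ha0, hb0, e1, e2, hij⟩, rfl⟩)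
      · exact ⟨0, j, v 0, ha, b, hb, ha0, hb0, by simp, e, by omega⟩
      · exact ⟨i + 1, j + 1, a, ha, b, hb, ha0, hb0, by simp [e1, pow_succ_apply'],
          by simp [e2, pow_succ_apply'], by omega⟩
  exact ⟨_, h₆.union ((h₃.inter h₅).union (h₄.inter h₅))⟩

/-- The word that witnesses `R` need not use the digits being read. The system therefore describes
`R (g + s) u`, where `s ∈ S` is the accumulated discrepancy between the two spellings. -/
theorem auto_R : ∃ k, Auto F S k {v : Fin 2 → G | R F S (v 0) (v 1)} := by
  obtain ⟨k₁, h₁⟩ := auto_letter (ι := Fin 2) h 1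
  obtain ⟨k₄, h₄⟩ := auto_eq_letter (ι := Fin 2) h h.zero_mem 0
  obtain ⟨k₅, h₅⟩ := auto_eq_letter (ι := Fin 2) h h.zero_mem 1
  obtain ⟨k₆, h₆⟩ := auto_of_system (F := F) (S := S) (fun s : S => {v : Fin 2 → G |
      ∃ w : List G, ∃ a ∈ S, IsWord S w ∧ a ≠ 0 ∧ v 0 + s = eval F (w ++ [a]) ∧
        v 1 = (F ^ w.length) a}) (fun s c => by
    obtain ⟨k₂, h₂⟩ := auto_sub_eq (ι := Fin 2) h s.2 0 1
    -- If the witnessing word continues after its first letter `s₁`, then `u ∈ F(G)` forces the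
    -- digit of `u` to be `0`, and the next discrepancy is `d`. If it has only one letter, then `g +
    -- s = u` is that letter; this is the inhomogeneous term.
    refine ⟨{d | (c 1 : G) = 0 ∧ ∃ s₁ ∈ S, c 0 + s - s₁ = F d}, _, ⟨_, (h₁.inter h₂).deriv c⟩, ?_⟩
    ext v
    simp only [deriv, Set.mem_ofPred_eq, Set.mem_union, Set.mem_iUnion, exists_prop, Set.mem_inter_iff]
    constructor
    · rintro ⟨w, a, ha, hw, ha0, e1, e2⟩
      rcases w with _ | ⟨s₁, w⟩
      · have e2 : (c 1 : G) + F (v 1) = a := by simpa using e2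
        rw [e2]
        refine Or.inl ⟨⟨ha, ha0⟩, ?_⟩
        rw [sub_add_eq_add_sub, e1]
        simp [eval]
      · right
        have hs₁ : s₁ ∈ S := hw _ List.mem_cons_self
        have e1 : (c 0 : G) + F (v 0) + s = s₁ + F (eval F (w ++ [a])) := e1
        have e2 : (c 1 : G) + F (v 1) = F ((F ^ w.length) a) := by
          rw [e2, List.length_cons, pow_succ_apply']
        have e3 : (c 0 : G) + -s₁ + s = F (eval F (w ++ [a]) - v 0) := by
          rw [map_sub, eq_sub_iff_add_eq, ← sub_eq_iff_eq_add'.2 e1]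
          abel
        refine ⟨⟨_, h.carry (c 0).2 (h.span.neg_mem _ hs₁) s.2 e3⟩, ⟨?_, s₁, hs₁, ?_⟩,
          w, a, ha, fun x hx => hw x (List.mem_cons_of_mem _ hx), ha0, by simp, ?_⟩
        · exact h.eq_zero _ (c 1).2 ⟨(F ^ w.length) a - v 1, by rw [map_sub, ← e2]; abel⟩
        · rw [← e3]; abel
        · have hc : (c 1 : G) = 0 :=
            h.eq_zero _ (c 1).2 ⟨(F ^ w.length) a - v 1, by rw [map_sub, ← e2]; abel⟩
          rw [hc, zero_add] at e2
          exact h.inj e2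
    · rintro (⟨⟨ha, ha0⟩, e⟩ | ⟨d, ⟨hc, s₁, hs₁, e⟩, w, a, ha, hw, ha0, e1, e2⟩)
      · refine ⟨[], _, ha, by simp [IsWord], ha0, ?_, by simp⟩
        rw [sub_add_eq_add_sub, sub_eq_zero] at e
        rw [e]
        simp [eval]
      · refine ⟨s₁ :: w, a, ha, ?_, ha0, ?_, by simp [hc, e2, pow_succ_apply']⟩
        · intro x hx
          rcases List.mem_cons.1 hx with rfl | hx
          exacts [hs₁, hw x hx]
        · change _ = s₁ + F (eval F (w ++ [a]))
          rw [← e1, map_add, ← e]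
          abel) ⟨0, h.zero_mem⟩
  refine ⟨_, (h₆.union (h₄.inter h₅)).congr ?_⟩
  ext v
  simp [R]

theorem V_of_isLowestTerm (hS₀ : IsTransversal F S S₀) {g u : G} (hg : g ≠ 0)
    (hu : IsLowestTerm F S S₀ g u) : V F S S₀ g = u :=
  isLowestTerm_unique h.inj h.eq_zero hS₀ (isLowestTerm_V h.span h.eq_zero hS₀ hg) hu

theorem V_map (hS₀ : IsTransversal F S S₀) (g : G) : V F S S₀ (F g) = F (V F S S₀ g) := by
  by_cases hg : g = 0
  · simp [hg, V_zero]
  · obtain ⟨m, b, w, h1, h2, h3, h4, h5⟩ := isLowestTerm_V h.span h.eq_zero hS₀ hg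
    refine V_of_isLowestTerm h hS₀ (fun e => hg (h.inj (by rw [e, map_zero])))
      ⟨m + 1, b, w, h1, h2, h3, ?_, ?_⟩
    · rw [pow_succ_apply', ← h4]
    · rw [pow_succ_apply', ← h5]

theorem V_of_residue (hS₀ : IsTransversal F S S₀) {g b : G} (hb : b ∈ S₀) (hb0 : b ≠ 0)
    (hg : ∃ c, g - b = F c) : V F S S₀ g = b := by
  obtain ⟨c, hc⟩ := hg
  obtain ⟨w, hw, rfl⟩ := h.span.span c
  refine V_of_isLowestTerm h hS₀ ?_ ⟨0, b, w, hb, hb0, hw, ?_, by simp⟩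
  · rintro rfl
    exact hb0 (h.eq_zero b (hS₀.subset hb) ⟨-eval F w, by rw [map_neg, ← hc]; abel⟩)
  · change g = b + F (eval F w)
    rw [← hc]; abel

/-- `V` commutes with `F`, and outside `F(G)` its value is the representative in `S₀` of the
residue; these finitely many residue classes form the base layer of a shift equation. -/
theorem auto_V (hS₀ : IsTransversal F S S₀) :
    ∃ k, Auto F S k {v : Fin 2 → G | V F S S₀ (v 0) = v 1} := by
  classical
  obtain ⟨k, hk⟩ := auto_biUnion (F := F) (S := S) (S₀.filter (· ≠ 0))
    (A := fun b => {v : Fin 2 → G | ∃ c, v 0 - b = F c} ∩ {v : Fin 2 → G | v 1 = b}) fun b hb => by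
      obtain ⟨k₁, h₁⟩ := auto_residue (F := F) (S := S) (ι := Fin 2) b 0
      obtain ⟨k₂, h₂⟩ := auto_eq_letter (ι := Fin 2) h (hS₀.subset (Finset.mem_filter.1 hb).1) 1
      exact ⟨_, h₁.inter h₂⟩
  refine auto_of_shift h hk fun v => ⟨?_, ?_⟩
  · intro e
    have e : V F S S₀ (v 0) = v 1 := e
    by_cases hv : v 0 = 0
    -- The pair `(0, 0)` is its own shift. This is harmless, because the shift equation need not be
    -- well-founded.
    · right
      refine ⟨v, e, ?_⟩
      have hv1 : v 1 = 0 := by rw [← e, hv, V_zero]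
      ext t
      fin_cases t <;> simp [hv, hv1]
    · obtain ⟨m, b, w, h1, h2, h3, h4, h5⟩ := isLowestTerm_V h.span h.eq_zero hS₀ hv
      rcases m with _ | m
      · left
        simp only [Finset.mem_filter, Set.mem_iUnion, exists_prop]
        rw [pow_zero_apply] at h4 h5
        exact ⟨b, ⟨h1, h2⟩, ⟨eval F w, by rw [h4]; simp [eval]⟩, e.symm.trans h5⟩
      · right
        rw [pow_succ_apply'] at h4 h5
        refine ⟨![(F ^ m) (eval F (b :: w)), (F ^ m) b], ?_, ?_⟩
        · apply h.inj
          rw [← V_map h hS₀]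
          change V F S S₀ (F ((F ^ m) (eval F (b :: w)))) = F ((F ^ m) b)
          rw [← h4, h5]
        · ext t
          fin_cases t
          · simpa using h4
          · simpa [e] using h5
  · rintro (hv | ⟨w, hw, rfl⟩)
    · simp only [Finset.mem_filter, Set.mem_iUnion, exists_prop] at hv
      obtain ⟨b, ⟨hb, hb0⟩, hc, e⟩ := hv
      exact (V_of_residue h hS₀ hb hb0 hc).trans e.symm
    · exact (V_map h hS₀ _).trans (congrArg F hw)

end Basic

/-! ### Definable sets have finitely many derivatives -/

section Definable

open FirstOrder Language

variable {G : Type u} [AddCommGroup G]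

/-- All symbols of `L` are at most binary and are interpreted by sets with at most `M`
derivatives. -/
structure IsAutoStructure (F : AddMonoid.End G) (S : Finset G) (L : FirstOrder.Language)
    [L.Structure G] (M : ℕ) : Prop where
  one_le : 1 ≤ M
  eq : Auto F S M {v : Fin 2 → G | v 0 = v 1}
  fn_arity : ∀ l (_ : L.Functions l), l ≤ 2
  fn : ∀ l (f : L.Functions l), Auto F S M {v : Fin l ⊕ Unit → G |
    Structure.funMap f (v ∘ Sum.inl) = v (Sum.inr ())}
  rel_arity : ∀ l (_ : L.Relations l), l ≤ 2
  rel : ∀ l (r : L.Relations l), Auto F S M {v : Fin l → G | Structure.RelMap r v}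

/-- A bound for the number of derivatives of sets defined by formulas of given rank. -/
def stateBound (M n : ℕ) : ℕ := (fun x => 2 ^ x ^ 3)^[n] M

theorem stateBound_succ (M n : ℕ) : stateBound M (n + 1) = 2 ^ stateBound M n ^ 3 :=
  Function.iterate_succ_apply' _ _ _

theorem stateBound_mono (M : ℕ) : Monotone (stateBound M) := by
  refine monotone_nat_of_le_succ fun n => ?_
  rw [stateBound_succ]
  exact (Nat.le_self_pow (by norm_num) _).trans Nat.lt_two_pow_self.le

theorem le_stateBound (M n : ℕ) : M ≤ stateBound M n := stateBound_mono M (Nat.zero_le n)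

/-- The nesting depth of a term. -/
def termRank {L : FirstOrder.Language} {α : Type*} : L.Term α → ℕ
  | .var _ => 0
  | .func _ ts => (Finset.univ.sup fun i => termRank (ts i)) + 1

/-- The nesting depth of a formula. -/
def formulaRank {L : FirstOrder.Language} {α : Type*} : {n : ℕ} → L.BoundedFormula α n → ℕ
  | _, .falsum => 0
  | _, .equal t₁ t₂ => max (termRank t₁) (termRank t₂) + 1
  | _, .rel _ ts => (Finset.univ.sup fun i => termRank (ts i)) + 1
  | _, .imp φ ψ => max (formulaRank φ) (formulaRank ψ) + 1
  | _, .all φ => formulaRank φ + 1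

namespace IsAutoStructure

variable {F : AddMonoid.End G} {S : Finset G} {L : FirstOrder.Language} [L.Structure G] {M : ℕ}
  (hM : IsAutoStructure F S L M)
include hM

theorem one_le_stateBound (n : ℕ) : 1 ≤ stateBound M n := hM.one_le.trans (le_stateBound M n)

theorem sq_le (n : ℕ) : stateBound M n * stateBound M n ≤ stateBound M (n + 1) := by
  rw [stateBound_succ]
  calc _ = stateBound M n ^ 2 := (sq _).symm
    _ ≤ stateBound M n ^ 3 := Nat.pow_le_pow_right (hM.one_le_stateBound n) (by norm_num)
    _ ≤ _ := Nat.lt_two_pow_self.le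

theorem two_pow_sq_le (n : ℕ) : 2 ^ (stateBound M n ^ 2) ≤ stateBound M (n + 1) := by
  rw [stateBound_succ]
  exact Nat.pow_le_pow_right (by norm_num)
    (Nat.pow_le_pow_right (hM.one_le_stateBound n) (by norm_num))

/-- The reason for the cube in `stateBound`: at most two arguments and the symbol itself contribute
one factor each, and the projection along the values of the arguments exponentiates the product. -/
theorem two_pow_prod_le {l n : ℕ} (hl : l ≤ 2) (r : Fin l → ℕ) (hr : ∀ i, r i ≤ n) :
    2 ^ ((∏ i, stateBound M (r i)) * M) ≤ stateBound M (n + 1) := by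
  rw [stateBound_succ]
  refine Nat.pow_le_pow_right (by norm_num) ?_
  calc _ ≤ stateBound M n ^ 2 * stateBound M n := Nat.mul_le_mul ?_ (le_stateBound M n)
    _ = _ := (pow_succ _ 2).symm
  calc _ ≤ ∏ _i : Fin l, stateBound M n := Finset.prod_le_prod' fun i _ => stateBound_mono M (hr i)
    _ = stateBound M n ^ l := by simp
    _ ≤ _ := Nat.pow_le_pow_right (hM.one_le_stateBound n) hl

/-- The graph of a compound term is the projection of the conjunction of the graphs of its arguments
and of the function symbol, along the values of the arguments. -/
theorem auto_term (h : IsSparseSpanning F S) {γ : Type*} (t : L.Term γ) :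
    Auto F S (stateBound M (termRank t))
      {v : γ ⊕ Unit → G | t.realize (v ∘ Sum.inl) = v (Sum.inr ())} := by
  induction t with
  | var x => exact hM.eq.reindex ![Sum.inl x, Sum.inr ()]
  | @func l f ts ih =>
    have h1 := (Auto.iInter fun i => (ih i).reindex
      (Sum.elim (Sum.inl ∘ Sum.inl) (fun _ => Sum.inr i) : γ ⊕ Unit → (γ ⊕ Unit) ⊕ Fin l)).inter
      ((hM.fn l f).reindex (Sum.elim Sum.inr (fun _ => Sum.inl (Sum.inr ())) :
        Fin l ⊕ Unit → (γ ⊕ Unit) ⊕ Fin l))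
    refine Auto.congr ((h1.proj h).mono (hM.two_pow_prod_le (hM.fn_arity l f) _
      fun i => Finset.le_sup (f := fun i => termRank (ts i)) (Finset.mem_univ i))) ?_
    ext v
    simp only [Set.mem_inter_iff, Set.mem_iInter, Set.mem_ofPred_eq]
    constructor
    · intro e
      exact ⟨fun i => (ts i).realize (v ∘ Sum.inl), fun i => rfl, e⟩
    · rintro ⟨y, hy, e⟩
      have : y = fun i => (ts i).realize (v ∘ Sum.inl) := funext fun i => (hy i).symm
      subst this
      exact e

theorem auto_formula (h : IsSparseSpanning F S) {α : Type*} {n : ℕ} (φ : L.BoundedFormula α n) :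
    Auto F S (stateBound M (formulaRank φ))
      {v : α ⊕ Fin n → G | φ.Realize (v ∘ Sum.inl) (v ∘ Sum.inr)} := by
  induction φ with
  | falsum => exact auto_empty.mono (hM.one_le_stateBound _)
  | @equal n t₁ t₂ =>
    have h1 := ((hM.auto_term h t₁).reindex (Sum.map id id : (α ⊕ Fin n) ⊕ Unit → _)).mono
      (stateBound_mono M (le_max_left _ (termRank t₂)))
    have h2 := ((hM.auto_term h t₂).reindex (Sum.map id id : (α ⊕ Fin n) ⊕ Unit → _)).mono
      (stateBound_mono M (le_max_right (termRank t₁) _))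
    have h3 := ((h1.inter h2).proj h).mono ((Nat.pow_le_pow_right (by norm_num)
      (sq _).symm.le).trans (hM.two_pow_sq_le _))
    refine Auto.congr (h3) ?_
    ext v
    change (_ = _) ↔ _
    have hv : Sum.elim (v ∘ Sum.inl) (v ∘ Sum.inr) = v := Sum.elim_comp_inl_inr v
    rw [hv]
    constructor
    · intro e
      exact ⟨fun _ => t₁.realize v, rfl, e.symm⟩
    · rintro ⟨y, e1, e2⟩
      exact Eq.trans e1 e2.symm
  | @rel n l r ts =>
    have h1 := (Auto.iInter fun i => (hM.auto_term h (ts i)).reindex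
      (Sum.elim Sum.inl (fun _ => Sum.inr i) : (α ⊕ Fin n) ⊕ Unit → (α ⊕ Fin n) ⊕ Fin l)).inter
      ((hM.rel l r).reindex (Sum.inr : Fin l → (α ⊕ Fin n) ⊕ Fin l))
    refine Auto.congr ((h1.proj h).mono (hM.two_pow_prod_le (hM.rel_arity l r) _
      fun i => Finset.le_sup (f := fun i => termRank (ts i)) (Finset.mem_univ i))) ?_
    ext v
    have hv : Sum.elim (v ∘ Sum.inl) (v ∘ Sum.inr) = v := Sum.elim_comp_inl_inr v
    change Structure.RelMap r _ ↔ _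
    rw [hv]
    simp only [Set.mem_inter_iff, Set.mem_iInter, Set.mem_ofPred_eq]
    constructor
    · intro e
      exact ⟨fun i => (ts i).realize v, fun i => rfl, e⟩
    · rintro ⟨y, hy, e⟩
      have : y = fun i => (ts i).realize v := funext fun i => (hy i).symm
      subst this
      exact e
  | imp φ ψ ih₁ ih₂ =>
    have h1 := ih₁.mono (stateBound_mono M (le_max_left _ (formulaRank ψ)))
    have h2 := ih₂.mono (stateBound_mono M (le_max_right (formulaRank φ) _))
    refine Auto.congr ((h1.compl.union h2).mono (hM.sq_le _)) ?_
    ext v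
    simp [imp_iff_not_or]
  | @all n φ ih =>
    -- The universal quantifier is the complement of the projection of the complement; the
    -- reindexing makes the last bound variable the projected coordinate.
    have h1 := (ih.reindex (Sum.elim (Sum.inl ∘ Sum.inl)
      (Fin.lastCases (Sum.inr ()) fun i => Sum.inl (Sum.inr i)) :
        α ⊕ Fin (n + 1) → (α ⊕ Fin n) ⊕ Unit)).compl
    have h2 := (h1.proj h).compl.mono ((Nat.pow_le_pow_right (by norm_num)
      (Nat.le_self_pow two_ne_zero _)).trans (hM.two_pow_sq_le _))
    refine Auto.congr (h2) ?_
    ext v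
    simp only [Set.mem_compl_iff, Set.mem_ofPred_eq, not_exists, not_not,
      BoundedFormula.realize_all]
    have key : ∀ y : Unit → G, ((Sum.elim v y ∘ (Sum.elim (Sum.inl ∘ Sum.inl)
        (Fin.lastCases (Sum.inr ()) fun i => Sum.inl (Sum.inr i)) :
          α ⊕ Fin (n + 1) → (α ⊕ Fin n) ⊕ Unit)) ∘ Sum.inr) =
        (Fin.snoc (v ∘ Sum.inr) (y ()) : Fin (n + 1) → G) := by
      intro y
      ext i
      refine Fin.lastCases ?_ (fun i => ?_) i <;> simp
    constructor
    · intro H y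
      rw [key]
      exact H _
    · intro H a
      have := H fun _ => a
      rw [key] at this
      exact this

end IsAutoStructure

/-- Existential quantifiers over sets with at most `k` derivatives can be bounded. -/
theorem Auto.exists_mem_ball {F : AddMonoid.End G} {S : Finset G} (h : IsSparseSpanning F S)
    {ι κ : Type*} [Finite κ] {k : ℕ} {A : Set (ι ⊕ κ → G)} (hA : Auto F S k A) {ℓ : ℕ} {v : ι → G}
    (hv : ∀ i, v i ∈ Ball F S ℓ) (hy : ∃ y : κ → G, Sum.elim v y ∈ A) :
    ∃ y : κ → G, (∀ j, y j ∈ Ball F S (ℓ + k)) ∧ Sum.elim v y ∈ A := by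
  classical
  induction ℓ generalizing A v with
  | zero =>
    obtain ⟨𝒜, h1, h2, h3⟩ := hA
    obtain rfl : v = fun _ => 0 := funext fun i => hv i
    -- With all parameters `0`, `good n` collects the members of the family that have a witness with
    -- `n` digits. By `hstep` it is determined by its predecessor, so this increasing chain stays
    -- constant once it repeats.
    let good : ℕ → Finset (Set (ι ⊕ κ → G)) := fun n => 𝒜.filter fun B =>
      ∃ y : κ → G, (∀ j, y j ∈ Ball F S n) ∧ Sum.elim (fun _ => 0) y ∈ B
    have hgood : ∀ n B, B ∈ good n ↔ B ∈ 𝒜 ∧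
        ∃ y : κ → G, (∀ j, y j ∈ Ball F S n) ∧ Sum.elim (fun _ => 0) y ∈ B :=
      fun n B => Finset.mem_filter
    have hmono : Monotone good := monotone_nat_of_le_succ fun n B hB => by
      obtain ⟨hB, y, hy, hyB⟩ := (hgood n B).1 hB
      exact (hgood _ B).2 ⟨hB, y, fun j => h.ball_succ_subset n (hy j), hyB⟩
    have hstep : ∀ n B, B ∈ good (n + 1) ↔ B ∈ 𝒜 ∧ ∃ s : κ → S, FGamma.deriv F (fun i =>
        ((Sum.elim (fun _ => ⟨0, h.zero_mem⟩) s : ι ⊕ κ → S) i : G)) B ∈ good n := by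
      intro n B
      rw [hgood]
      refine and_congr_right fun hB => ⟨?_, ?_⟩
      · rintro ⟨y, hy, hyB⟩
        choose s hs y' hy' e using hy
        refine ⟨fun j => ⟨s j, hs j⟩, (hgood _ _).2 ⟨h3 B hB _, y', hy', sumElim_mem_deriv.2 ?_⟩⟩
        simpa [← e] using hyB
      · rintro ⟨s, hs⟩
        obtain ⟨-, y, hy, hyB⟩ := (hgood _ _).1 hs
        refine ⟨_, fun j => ⟨s j, (s j).2, y j, hy j, rfl⟩, ?_⟩
        simpa using sumElim_mem_deriv.1 hyB
    have hstab : ∀ n, good n = good (n + 1) → ∀ m, good (n + m) = good n := by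
      intro n hn m
      induction m with
      | zero => rfl
      | succ m ih =>
        conv_rhs => rw [hn]
        ext B
        rw [← add_assoc, hstep, hstep, ih]
    -- A strictly increasing chain of subsets of a family of at most `k` sets has at most `k` steps.
    obtain ⟨n, hnk, hn⟩ : ∃ n ≤ k, good n = good (n + 1) := by
      by_contra! hne
      have : ∀ n ≤ k + 1, n ≤ (good n).card := by
        intro n hn
        induction n with
        | zero => exact Nat.zero_le _
        | succ n ih =>
          exact (ih (by omega)).trans_lt (Finset.card_lt_card
            ((hmono n.le_succ).lt_of_ne (hne n (by omega))))
      have := (this (k + 1) le_rfl).trans ((Finset.card_filter_le _ _).trans h1)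
      omega
    obtain ⟨y, hy⟩ := hy
    choose N hN using fun j => h.exists_mem_ball (y j)
    have := Fintype.ofFinite κ
    have hm : ∀ j, y j ∈ Ball F S (n + Finset.univ.sup N) := fun j =>
      h.ball_mono ((Finset.le_sup (Finset.mem_univ j)).trans (Nat.le_add_left _ _)) (hN j)
    have hAg : A ∈ good (n + Finset.univ.sup N) := (hgood _ _).2 ⟨h2, y, hm, hy⟩
    rw [hstab n hn] at hAg
    obtain ⟨-, y, hy, hyA⟩ := (hgood _ _).1 hAg
    exact ⟨y, fun j => h.ball_mono (by omega) (hy j), hyA⟩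
  | succ ℓ ih =>
    choose c hc v' hv' e using hv
    obtain ⟨y, hy⟩ := hy
    choose s hs y' e' using fun j => h.exists_digit (y j)
    have hc' : v = fun i => c i + F (v' i) := funext e
    have hy' : y = fun j => s j + F (y' j) := funext e'
    subst hc' hy'
    -- Parameters and witness lose their lowest digits together; the derivative has the same bound
    -- `k`.
    obtain ⟨z, hz, hzA⟩ := ih (hA.deriv (Sum.elim (fun i => ⟨c i, hc i⟩) fun j => ⟨s j, hs j⟩)) hv'
      ⟨y', sumElim_mem_deriv.2 hy⟩
    refine ⟨_, fun j => ?_, sumElim_mem_deriv.1 hzA⟩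
    rw [Nat.succ_add]
    exact ⟨s j, hs j, z j, hz j, rfl⟩

theorem exists_isAutoStructure {F : AddMonoid.End G} {S S₀ : Finset G} (h : IsSparseSpanning F S)
    (hS₀ : IsTransversal F S S₀) :
    letI : (LV S).Structure G := gammaV F S S₀
    ∃ M, IsAutoStructure F S (LV S) M := by
  let _ : (LV S).Structure G := gammaV F S S₀
  obtain ⟨k₀, h₀⟩ := auto_eq (ι := Fin 2) h 0 1
  have hfn : ∀ l (f : (LV S).Functions l), l ≤ 2 ∧ ∃ k, Auto F S k {v : Fin l ⊕ Unit → G |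
      Structure.funMap f (v ∘ Sum.inl) = v (Sum.inr ())} := by
    rintro l (_ | _ | _)
    · exact ⟨le_rfl, auto_add h (Sum.inl 0) (Sum.inl 1) (Sum.inr ())⟩
    · exact ⟨by norm_num, auto_map h (Sum.inl 0) (Sum.inr ())⟩
    · obtain ⟨k, hk⟩ := auto_V h hS₀
      exact ⟨by norm_num, k, hk.reindex ![Sum.inl 0, Sum.inr ()]⟩
  have hrel : ∀ l (r : (LV S).Relations l), l ≤ 2 ∧
      ∃ k, Auto F S k {v : Fin l → G | Structure.RelMap r v} := by
    rintro l (_ | _ | _ | a)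
    · exact ⟨le_rfl, auto_R h⟩
    · exact ⟨by norm_num, auto_IF h 0⟩
    · exact ⟨le_rfl, auto_preceq h⟩
    · exact ⟨by norm_num, auto_orbit h a.2.1 0⟩
  choose a1 k1 h1 using hfn
  choose a2 k2 h2 using hrel
  have hfin : Finite ((LV S).Symbols) := inferInstance
  have : Finite (Σ l, (LV S).Functions l) := Finite.of_injective _ (Sum.inl_injective :
    Function.Injective (Sum.inl : _ → (LV S).Symbols))
  have : Finite (Σ l, (LV S).Relations l) := Finite.of_injective _ (Sum.inr_injective :
    Function.Injective (Sum.inr : _ → (LV S).Symbols))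
  obtain ⟨M1, hM1⟩ := (Set.finite_range fun f : Σ l, (LV S).Functions l => k1 f.1 f.2).bddAbove
  obtain ⟨M2, hM2⟩ := (Set.finite_range fun f : Σ l, (LV S).Relations l => k2 f.1 f.2).bddAbove
  refine ⟨1 + k₀ + M1 + M2, by omega, h₀.mono (by omega), a1, fun l f => (h1 l f).mono ?_, a2,
    fun l r => (h2 l r).mono ?_⟩
  · have := hM1 ⟨⟨l, f⟩, rfl⟩
    simp only at this
    omega
  · have := hM2 ⟨⟨l, r⟩, rfl⟩
    simp only at this
    omega

end Definable

end FGamma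
end

open scoped FirstOrder
noncomputable section
namespace FGamma

/-! ### Regular languages -/

section Regular

variable {α : Type*}

theorem isRegular_congr {L L' : _root_.Language α} (hL : L.IsRegular) (e : ∀ w, w ∈ L' ↔ w ∈ L) :
    L'.IsRegular :=
  (show L' = L from Set.ext e) ▸ hL

/-- The easy half of Myhill–Nerode: the indices are the states, and a state accepts when its
language contains the empty word. -/
theorem isRegular_of_family {Q : Type*} [Finite Q] (Λ : Q → _root_.Language α)
    (hΛ : ∀ q a, ∃ q', ∀ v, a :: v ∈ Λ q ↔ v ∈ Λ q') (q : Q) : (Λ q).IsRegular := by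
  choose step hstep using hΛ
  have := Fintype.ofFinite Q
  refine Language.isRegular_iff.2 ⟨Q, inferInstance, ⟨step, q, {q | [] ∈ Λ q}⟩, ?_⟩
  have key : ∀ (w : List α) (q q₀ : Q),
      (⟨step, q₀, {q | [] ∈ Λ q}⟩ : DFA α Q).evalFrom q w ∈ {q | [] ∈ Λ q} ↔ w ∈ Λ q := by
    intro w
    induction w with
    | nil => intro q q₀; rfl
    | cons a w ih =>
      intro q q₀
      rw [DFA.evalFrom_cons, ih, ← hstep]
  ext w
  exact key w q q

/-- The nondeterministic version, reduced to the previous one by taking sets of indices as states.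
-/
theorem isRegular_of_family' {Q : Type*} [Finite Q] (Λ : Q → _root_.Language α)
    (hΛ : ∀ q a, ∃ T : Set Q, ∀ v, a :: v ∈ Λ q ↔ ∃ q' ∈ T, v ∈ Λ q') (q : Q) :
    (Λ q).IsRegular := by
  have := isRegular_of_family (Q := Set Q) (fun T => {w | ∃ q ∈ T, w ∈ Λ q}) (fun T a => ?_) {q}
  · refine isRegular_congr (this) fun w => ?_
    exact ⟨fun h => ⟨q, rfl, h⟩, by rintro ⟨_, rfl, h⟩; exact h⟩
  · choose U hU using hΛ
    refine ⟨{q' | ∃ q ∈ T, q' ∈ U q a}, fun v => ⟨?_, ?_⟩⟩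
    · rintro ⟨q, hq, hv⟩
      obtain ⟨q', hq', hv⟩ := (hU q a v).1 hv
      exact ⟨q', ⟨q, hq, hq'⟩, hv⟩
    · rintro ⟨q', ⟨q, hq, hq'⟩, hv⟩
      exact ⟨q, hq, (hU q a v).2 ⟨q', hq', hv⟩⟩

theorem isRegular_comap {β : Type*} {L : _root_.Language β} (hL : L.IsRegular) (f : α → β) :
    Language.IsRegular ({w | w.map f ∈ L} : _root_.Language α) := by
  obtain ⟨σ, _, M, rfl⟩ := hL
  exact ⟨σ, inferInstance, M.comap f, DFA.accepts_comap M f⟩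

theorem isRegular_forall {n : ℕ} {L : Fin n → _root_.Language α} (hL : ∀ i, (L i).IsRegular) :
    Language.IsRegular ({w | ∀ i, w ∈ L i} : _root_.Language α) := by
  induction n with
  | zero =>
    refine isRegular_of_family (Q := Unit) (fun _ => {w | ∀ i, w ∈ L i}) (fun _ _ => ⟨(), fun v => ?_⟩) ()
    exact ⟨fun _ i => i.elim0, fun _ i => i.elim0⟩
  | succ n ih =>
    refine isRegular_congr ((hL 0).inf (ih fun i => hL i.succ)) fun w => ?_
    exact Fin.forall_fin_succ

theorem isRegular_getLast?_ne (z : α) :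
    Language.IsRegular ({w | w.getLast? ≠ some z} : _root_.Language α) := by
  -- The state `q` says that the letter just read was `z`, in which case the rest of the word must
  -- not be empty.
  have := isRegular_of_family (Q := Prop)
    (fun q => ({w | w.getLast? ≠ some z ∧ (q → w ≠ [])} : _root_.Language α))
    (fun q a => ⟨a = z, fun v => ?_⟩) False
  · refine isRegular_congr (this) fun w => ?_
    exact ⟨fun h => ⟨h, False.elim⟩, fun h => h.1⟩
  · change (_ ≠ _ ∧ (_ → _)) ↔ (_ ≠ _ ∧ (_ → _))
    rcases v with _ | ⟨b, v⟩
    · simp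
    · simp [List.getLast?_cons_cons]

end Regular

/-! ### Automatic sets and automatic presentations -/

section Letter

variable {G : Type u} {S : Finset G}

variable (S) in
/-- The value of a letter of the alphabet `Fin S.card`. -/
def letter (t : Fin S.card) : G := S.equivFin.symm t

theorem letter_mem (t : Fin S.card) : letter S t ∈ S := (S.equivFin.symm t).2

theorem letter_injective : Function.Injective (letter S) :=
  Subtype.val_injective.comp S.equivFin.symm.injective

theorem exists_letter {a : G} (ha : a ∈ S) : ∃ t, letter S t = a :=
  ⟨S.equivFin ⟨a, ha⟩, by simp [letter]⟩

end Letter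

section Presentation

variable {G : Type u} [AddCommGroup G] {F : AddMonoid.End G} {S S₀ : Finset G}

/-- Reading a letter passes from the language of `B` to the language of its derivative. -/
theorem Auto.isRegular {n k : ℕ} {A : Set (Fin n → G)} (hA : Auto F S k A) :
    Language.IsRegular
      ({w | eval (powEnd F n) (w.map fun c i => (c i : G)) ∈ A} :
        _root_.Language (Fin n → S)) := by
  obtain ⟨𝒜, -, h2, h3⟩ := hA
  exact isRegular_of_family (Q := 𝒜) (fun B => ({w | eval (powEnd F n)
    (w.map fun c i => (c i : G)) ∈ B.1} : _root_.Language (Fin n → S)))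
    (fun B c => ⟨⟨_, h3 B B.2 c⟩, fun v => Iff.rfl⟩) ⟨A, h2⟩

theorem Auto.isFAutomatic (h : IsSparseSpanning F S) {n k : ℕ} {A : Set (Fin n → G)}
    (hA : Auto F S k A) : IsFAutomatic F A :=
  ⟨1, one_pos, S, by rw [pow_one]; exact h.span, by rw [pow_one]; exact hA.isRegular⟩

theorem eval_append_replicate_zero (w : List G) (k : ℕ) :
    eval F (w ++ List.replicate k 0) = eval F w := by
  induction w with
  | nil =>
    induction k with
    | zero => rfl
    | succ k ih =>
      change (0 : G) + F (eval F (List.replicate k 0)) = 0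
      rw [List.nil_append] at ih
      rw [ih]
      simp [eval]
  | cons a w ih => exact congrArg (fun x => a + F x) ih

theorem eval_powEnd_apply {n : ℕ} (w : List (Fin n → G)) (i : Fin n) :
    eval (powEnd F n) w i = eval F (w.map fun c => c i) := by
  induction w with
  | nil => rfl
  | cons a w ih => exact congrArg (fun x => a i + F x) ih

variable (F S S₀) in
/-- Normal words: the shortest words all of whose letters but the last one are in `S₀`. -/
inductive IsNormal : List (Fin S.card) → Prop
  | single (t) : IsNormal [t]
  | cons (b w) (hb : letter S b ∈ S₀) (hw : IsNormal w)
      (hS : eval F ((b :: w).map (letter S)) ∉ S) : IsNormal (b :: w)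

theorem exists_residue (h : IsSparseSpanning F S) (hS₀ : IsTransversal F S S₀) (g : G) :
    ∃ b ∈ S₀, ∃ c, g - b = F c := by
  obtain ⟨s, hs, k, rfl⟩ := h.exists_digit g
  obtain ⟨b, ⟨hb, c, hc⟩, -⟩ := hS₀.existsUnique s hs
  exact ⟨b, hb, c + k, by rw [map_add, ← hc]; abel⟩

theorem residue_unique (hS₀ : IsTransversal F S S₀) {b b' : G} (hb : b ∈ S₀) (hb' : b' ∈ S₀)
    (e : ∃ c, b - b' = F c) : b = b' :=
  (hS₀.existsUnique b (hS₀.subset hb)).unique ⟨hb, 0, by simp⟩ ⟨hb', e⟩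

/-- Carry propagation: the lowest digit `a` plus the incoming carry `s` is replaced by its
representative `b ∈ S₀`, and the excess is again a letter by `carry`. The word is cut to a single
letter as soon as the remaining value lies in `S`. -/
theorem exists_isNormal (h : IsSparseSpanning F S) (hS₀ : IsTransversal F S S₀) (g : G) :
    ∃ w, IsNormal F S S₀ w ∧ eval F (w.map (letter S)) = g := by
  have key : ∀ n, ∀ s ∈ S, ∀ g ∈ Ball F S n,
      ∃ w, IsNormal F S S₀ w ∧ eval F (w.map (letter S)) = s + g := by
    intro n
    induction n with
    | zero =>
      intro s hs g hg
      obtain ⟨t, rfl⟩ := exists_letter hs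
      rw [Set.mem_singleton_iff.1 hg]
      exact ⟨[t], .single t, by simp [eval]⟩
    | succ n ih =>
      rintro s hs _ ⟨a, ha, k, hk, rfl⟩
      obtain ⟨b, hb, e, he⟩ := exists_residue h hS₀ (s + a)
      have heS : e ∈ S := h.carry hs ha (h.span.neg_mem b (hS₀.subset hb))
        (by rw [← he, sub_eq_add_neg])
      obtain ⟨w, hw, ew⟩ := ih e heS k hk
      have e1 : s + (a + F k) = b + F (e + k) := by rw [map_add, ← he]; abel
      obtain ⟨t, rfl⟩ := exists_letter (hS₀.subset hb)
      have e2 : eval F ((t :: w).map (letter S)) = s + (a + F k) := by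
        rw [e1, ← ew]; rfl
      by_cases hs' : s + (a + F k) ∈ S
      · obtain ⟨t', ht'⟩ := exists_letter hs'
        exact ⟨[t'], .single t', by simp [eval, ht']⟩
      · exact ⟨t :: w, .cons t w hb hw (e2 ▸ hs'), e2⟩
  obtain ⟨n, hn⟩ := h.exists_mem_ball g
  simpa using key n 0 h.zero_mem g hn

/-- Whether the value lies in `S` decides whether the word has one letter. Otherwise the first
letter is the representative in `S₀` of the residue of the value, and the rest follows by
injectivity of `F`. -/
theorem IsNormal.unique (h : IsSparseSpanning F S) (hS₀ : IsTransversal F S S₀)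
    {w w' : List (Fin S.card)} (hw : IsNormal F S S₀ w) (hw' : IsNormal F S S₀ w')
    (e : eval F (w.map (letter S)) = eval F (w'.map (letter S))) : w = w' := by
  induction hw generalizing w' with
  | single t =>
    cases hw' with
    | single t' =>
      have : letter S t = letter S t' := by simpa [eval] using e
      rw [letter_injective this]
    | cons b w hb hw hS => exact absurd (by rw [← e]; simpa [eval] using letter_mem t) hS
  | cons b w hb hw hS ih =>
    cases hw' with
    | single t' => exact absurd (by rw [e]; simpa [eval] using letter_mem t') hS
    | cons b' w' hb' hw' hS' =>
      have e : letter S b + F (eval F (w.map (letter S))) =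
        letter S b' + F (eval F (w'.map (letter S))) := e
      have hbb := residue_unique hS₀ hb hb' ⟨eval F (w'.map (letter S)) -
        eval F (w.map (letter S)), by rw [map_sub, sub_eq_sub_iff_add_eq_add, e, add_comm]⟩
      rw [hbb] at e
      rw [letter_injective hbb, ih hw' (h.inj (add_left_cancel e))]

/-- Normal words padded by `♯`. -/
theorem isRegular_padded (h : IsSparseSpanning F S) :
    Language.IsRegular
      ({w | ∃ u k, IsNormal F S S₀ u ∧ w = u.map some ++ List.replicate k none} :
        _root_.Language (Option (Fin S.card))) := by
  classical
  -- State `none`: only padding is left. State `some q`: a normal word is left, and prefixing to it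
  -- the letter just read, if `q` records one, must give a value outside `S`.
  let Λ : Option (Option (Fin S.card)) → _root_.Language (Option (Fin S.card)) := fun q => match q with
    | none => {w | ∃ k, w = List.replicate k none}
    | some q => {w | ∃ u k, IsNormal F S S₀ u ∧
        (∀ p ∈ q, letter S p + F (eval F (u.map (letter S))) ∉ S) ∧
        w = u.map some ++ List.replicate k none}
  have hΛ0 : ∀ w, w ∈ Λ none ↔ ∃ k, w = List.replicate k none := fun w => Iff.rfl
  have hΛ1 : ∀ q w, w ∈ Λ (some q) ↔ ∃ u k, IsNormal F S S₀ u ∧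
        (∀ p ∈ q, letter S p + F (eval F (u.map (letter S))) ∉ S) ∧
        w = u.map some ++ List.replicate k none := fun q w => Iff.rfl
  have := isRegular_of_family' Λ (fun q a => ?_) (some none)
  · refine isRegular_congr (this) fun w => ?_
    rw [hΛ1]
    simp
    rfl
  · rcases q with _ | q
    · refine ⟨{q | q = none ∧ a = none}, fun v => ?_⟩
      simp only [hΛ0, Set.mem_ofPred_eq]
      constructor
      · rintro ⟨k, hk⟩
        rcases k with _ | k
        · simp at hk
        · rw [List.replicate_succ, List.cons.injEq] at hk
          exact ⟨none, ⟨rfl, hk.1⟩, (hΛ0 v).2 ⟨k, hk.2⟩⟩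
      · rintro ⟨_, ⟨rfl, rfl⟩, hv⟩
        obtain ⟨k, rfl⟩ := (hΛ0 v).1 hv
        exact ⟨k + 1, rfl⟩
    · refine ⟨{q' | ∃ t, a = some t ∧ ((q' = none ∧ ∀ p ∈ q, letter S p + F (letter S t) ∉ S) ∨
        (q' = some (some t) ∧ letter S t ∈ S₀))}, fun v => ?_⟩
      rw [hΛ1]
      constructor
      · rintro ⟨u, k, hu, hq, e⟩
        cases hu with
        | single t =>
          simp only [List.map_cons, List.map_nil, List.cons_append, List.nil_append,
            List.cons.injEq] at e
          exact ⟨none, ⟨t, e.1, Or.inl ⟨rfl, by simpa [eval] using hq⟩⟩, (hΛ0 v).2 ⟨k, e.2⟩⟩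
        | cons b u hb hu hS =>
          simp only [List.map_cons, List.cons_append, List.cons.injEq] at e
          refine ⟨_, ⟨b, e.1, Or.inr ⟨rfl, hb⟩⟩, (hΛ1 _ v).2 ⟨u, k, hu, ?_, e.2⟩⟩
          rintro _ ⟨⟩
          exact hS
      · rintro ⟨_, ⟨t, rfl, ⟨rfl, hq⟩ | ⟨rfl, ht⟩⟩, hv⟩
        · obtain ⟨k, rfl⟩ := (hΛ0 v).1 hv
          exact ⟨[t], k, .single t, by simpa [eval] using hq, rfl⟩
        · obtain ⟨u, k, hu, hq, rfl⟩ := (hΛ1 _ v).1 hv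
          have hS : eval F ((t :: u).map (letter S)) ∉ S := hq t rfl
          refine ⟨t :: u, k, .cons t u ht hu hS, fun p hp hpS => hS ?_, rfl⟩
          -- Being outside `S` propagates to longer words: if `p + F x ∈ S`, then adding `-p` and
          -- applying (C3) gives `x ∈ S`. Hence remembering a single letter is enough.
          exact h.span.carry_mem _ hpS _ (h.span.neg_mem _ (letter_mem p)) _ (by abel)

/-- The normal word that represents `g`. -/
def normalWord (h : IsSparseSpanning F S) (hS₀ : IsTransversal F S S₀) (g : G) :
    List (Fin S.card) :=
  (exists_isNormal h hS₀ g).choose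

section

variable (h : IsSparseSpanning F S) (hS₀ : IsTransversal F S S₀)

theorem isNormal_normalWord (g : G) : IsNormal F S S₀ (normalWord h hS₀ g) :=
  (exists_isNormal h hS₀ g).choose_spec.1

theorem eval_normalWord (g : G) : eval F ((normalWord h hS₀ g).map (letter S)) = g :=
  (exists_isNormal h hS₀ g).choose_spec.2

theorem normalWord_eval {w : List (Fin S.card)} (hw : IsNormal F S S₀ w) :
    normalWord h hS₀ (eval F (w.map (letter S))) = w :=
  (isNormal_normalWord h hS₀ _).unique h hS₀ hw (eval_normalWord h hS₀ _)

end

/-! ### Convolutions and their columns. -/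

theorem getElem?_conv {A : Type} {n : ℕ} (w : Fin n → List A) (k : ℕ) :
    (conv w)[k]? = if k < Finset.univ.sup fun i => (w i).length then some fun i => (w i)[k]?
      else none := by
  rw [conv, List.getElem?_map]
  split_ifs with hk
  · rw [List.getElem?_range hk]; rfl
  · rw [List.getElem?_eq_none (by simpa using hk)]; rfl

theorem conv_column {A : Type} {n : ℕ} (w : Fin n → List A) (i : Fin n) :
    (conv w).map (fun c => c i) = (w i).map some ++
      List.replicate ((Finset.univ.sup fun i => (w i).length) - (w i).length) none := by
  have hi : (w i).length ≤ Finset.univ.sup fun i => (w i).length :=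
    Finset.le_sup (f := fun i => (w i).length) (Finset.mem_univ i)
  refine List.ext_getElem? fun k => ?_
  rw [List.getElem?_map, getElem?_conv, List.getElem?_append, List.length_map, List.getElem?_map,
    List.getElem?_replicate]
  by_cases h1 : k < (w i).length
  · rw [if_pos (by omega), if_pos h1, List.getElem?_eq_getElem h1]
    simp [List.getElem?_eq_getElem h1]
  · by_cases h2 : k < Finset.univ.sup fun i => (w i).length
    · rw [if_pos h2, if_neg h1, if_pos (by omega)]
      simp [List.getElem?_eq_none (not_lt.1 h1)]
    · rw [if_neg h2, if_neg h1, if_neg (by omega)]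
      rfl

theorem getLast?_conv {A : Type} {n : ℕ} (w : Fin n → List A) :
    (conv w).getLast? ≠ some fun _ => none := by
  intro e
  rw [List.getLast?_eq_getElem?, getElem?_conv] at e
  split_ifs at e with hlt
  have hlen : (conv w).length = Finset.univ.sup fun i => (w i).length := by simp [conv]
  rw [hlen] at e hlt
  obtain ⟨i, -, hi⟩ := (Finset.lt_sup_iff.1 hlt)
  have := congrFun (Option.some.inj e) i
  rw [List.getElem?_eq_none_iff] at this
  omega

/-- Columns of the form "word, then padding" leave only the total length undetermined; a last letter
that is not pure padding fixes it. -/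
theorem eq_conv {A : Type} {n : ℕ} {v : List (Fin n → Option A)} {w : Fin n → List A} {k : Fin n → ℕ}
    (hw : ∀ i, v.map (fun c => c i) = (w i).map some ++ List.replicate (k i) none)
    (hv : v.getLast? ≠ some fun _ => none) : v = conv w := by
  have hlen : ∀ i, v.length = (w i).length + k i := fun i => by
    have := congrArg List.length (hw i)
    simpa using this
  have hget : ∀ (j : ℕ) (i) (hj : j < v.length), v[j] i = (w i)[j]? := by
    intro j i hj
    have := congrArg (fun l => l[j]?) (hw i)
    simp only [List.getElem?_map, List.getElem?_eq_getElem hj, Option.map_some] at this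
    rw [List.getElem?_append, List.length_map, List.getElem?_map, List.getElem?_replicate] at this
    by_cases h1 : j < (w i).length
    · rw [if_pos h1, List.getElem?_eq_getElem h1] at this
      rw [List.getElem?_eq_getElem h1]
      simpa using this
    · rw [if_neg h1, if_pos (by have := hlen i; omega)] at this
      rw [List.getElem?_eq_none (not_lt.1 h1)]
      simpa using this
  have hsup : v.length = Finset.univ.sup fun i => (w i).length := by
    refine le_antisymm (not_lt.1 fun hlt => hv ?_) (Finset.sup_le fun i _ => by
      have := hlen i; omega)
    have h0 : v.length - 1 < v.length := by omega
    rw [List.getLast?_eq_getElem?, List.getElem?_eq_getElem h0]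
    congr 1
    ext1 i
    rw [hget _ _ h0, List.getElem?_eq_none_iff]
    have : (w i).length ≤ Finset.univ.sup fun i => (w i).length :=
      Finset.le_sup (f := fun i => (w i).length) (Finset.mem_univ i)
    omega
  refine List.ext_getElem? fun j => ?_
  rw [getElem?_conv, ← hsup]
  split_ifs with hj
  · rw [List.getElem?_eq_getElem hj]
    congr 1
    ext1 i
    exact hget j i hj
  · exact List.getElem?_eq_none (not_lt.1 hj)

/-- Three regular conditions cut out the language: each column is a padded normal word, the last
letter is not pure padding, and the value lies in `A`. For the value, padding is read as the letter
`0`, which changes nothing. -/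
theorem Auto.isRegular_conv (h : IsSparseSpanning F S) (hS₀ : IsTransversal F S S₀) {n k : ℕ}
    {A : Set (Fin n → G)} (hA : Auto F S k A) :
    Language.IsRegular ({w | ∃ x ∈ A, w = conv fun i => normalWord h hS₀ (x i)} :
      _root_.Language (Fin n → Option (Fin S.card))) := by
  have h1 := isRegular_forall fun i : Fin n => isRegular_comap (isRegular_padded (S₀ := S₀) h)
    fun c : Fin n → Option (Fin S.card) => c i
  have h2 := isRegular_getLast?_ne (fun _ => none : Fin n → Option (Fin S.card))
  have h3 := isRegular_comap hA.isRegular fun (c : Fin n → Option (Fin S.card)) i =>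
    (c i).elim (⟨0, h.zero_mem⟩ : S) fun t => ⟨letter S t, letter_mem t⟩
  have key : ∀ (v : List (Fin n → Option (Fin S.card))) (i : Fin n) (w : List (Fin S.card)) (k : ℕ),
      v.map (fun c => c i) = w.map some ++ List.replicate k none →
      eval (powEnd F n) ((v.map fun (c : Fin n → Option (Fin S.card)) i =>
        (c i).elim (⟨0, h.zero_mem⟩ : S) fun t => ⟨letter S t, letter_mem t⟩).map
          fun c i => (c i : G)) i = eval F (w.map (letter S)) := by
    intro v i w k e
    rw [eval_powEnd_apply, List.map_map, List.map_map]
    rw [← eval_append_replicate_zero (w.map (letter S)) k]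
    have : (fun c : Fin n → Option (Fin S.card) => (((c i).elim (⟨0, h.zero_mem⟩ : S)
        fun t => ⟨letter S t, letter_mem t⟩ : S) : G)) =
        (fun o : Option (Fin S.card) => o.elim 0 (letter S)) ∘ fun c => c i := by
      ext c
      change _ = Option.elim (c i) 0 (letter S)
      cases c i <;> rfl
    change eval F (v.map (fun c : Fin n → Option (Fin S.card) => (((c i).elim (⟨0, h.zero_mem⟩ : S)
        fun t => ⟨letter S t, letter_mem t⟩ : S) : G))) = _
    rw [this, ← List.map_map, e]
    simp [Function.comp_def]
  refine isRegular_congr (h1.inf (h2.inf h3)) fun v => ?_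
  constructor
  · rintro ⟨x, hx, rfl⟩
    refine ⟨fun i => ⟨_, _, isNormal_normalWord h hS₀ (x i), conv_column _ i⟩, getLast?_conv _, ?_⟩
    exact (congrArg (· ∈ A) (funext fun i => (key _ i _ _ (conv_column _ i)).trans
      (eval_normalWord h hS₀ (x i)))).mpr hx
  · rintro ⟨hv1, hv2, hv3⟩
    choose w k hw e using hv1
    refine ⟨_, hv3, ?_⟩
    rw [eq_conv e hv2]
    congr 1
    ext1 i
    rw [key _ i (w i) (k i), normalWord_eval h hS₀ (hw i)]
    rw [← eq_conv e hv2]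
    exact e i

theorem isFAPresentable_gammaV (h : IsSparseSpanning F S) (hS₀ : IsTransversal F S S₀) :
    letI : (LV S).Structure G := gammaV F S S₀
    IsFAPresentable (LV S) G := by
  let _ : (LV S).Structure G := gammaV F S S₀
  obtain ⟨M, hM⟩ := exists_isAutoStructure h hS₀
  refine ⟨Fin S.card, inferInstance, normalWord h hS₀, ?_, ?_, ?_, ?_⟩
  · intro x y e
    rw [← eval_normalWord h hS₀ x, e, eval_normalWord]
  -- The normal words are the padded normal words that contain no padding symbol.
  · refine isRegular_congr (isRegular_comap (isRegular_padded (S₀ := S₀) h) some) fun w => ?_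
    constructor
    · rintro ⟨g, rfl⟩
      exact ⟨_, 0, isNormal_normalWord h hS₀ g, by simp⟩
    · rintro ⟨u, k, hu, e⟩
      have hk : k = 0 := by
        by_contra hk
        have : none ∈ u.map some ++ List.replicate k none := by simp [hk]
        rw [← e] at this
        simp at this
      subst hk
      have : w = u := by simpa using (List.map_injective_iff.2 (Option.some_injective _)) (by simpa using e)
      exact ⟨_, this ▸ normalWord_eval h hS₀ hu⟩
  · intro n r
    exact (hM.rel n r).isRegular_conv h hS₀
  · intro n f
    have := ((hM.fn n f).reindex (Sum.elim Fin.castSucc fun _ => Fin.last n)).isRegular_conv h hS₀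
    refine isRegular_congr (this) fun w => ?_
    constructor
    · rintro ⟨x, rfl⟩
      refine ⟨_, ?_, rfl⟩
      change FirstOrder.Language.Structure.funMap f (fun i => Fin.snoc (α := fun _ => G) x _ (Fin.castSucc i)) = _
      simp
    · rintro ⟨x, hx, rfl⟩
      refine ⟨x ∘ Fin.castSucc, ?_⟩
      congr 1
      ext1 i
      congr 1
      refine Fin.lastCases ?_ (fun i => ?_) i
      · rw [Fin.snoc_last]
        exact hx.symm
      · rw [Fin.snoc_castSucc]
        rfl

end Presentation

end FGamma
end

open scoped FirstOrder
noncomputable section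
namespace FGamma

/-! ### Primitive recursive evaluation of formulas -/

section PrimrecLemmas

open Primrec

variable {α β σ τ : Type*} [Primcodable α] [Primcodable β] [Primcodable σ] [Primcodable τ]

/-- Finite tables are primitive recursive. This turns the noncomputably given transitions of an
automaton into a primitive recursive function. -/
theorem exists_primrec_eqOn [Inhabited σ] (D : Finset α) (f : α → σ) :
    ∃ g : α → σ, Primrec g ∧ ∀ a ∈ D, g a = f a := by
  classical
  induction D using Finset.induction_on with
  | empty => exact ⟨fun _ => default, .const _, by simp⟩
  | insert a D _ ih =>
    obtain ⟨g, hg, e⟩ := ih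
    refine ⟨fun x => if x = a then f a else g x,
      Primrec.ite (Primrec.eq.comp .id (.const a)) (.const _) hg, fun x hx => ?_⟩
    by_cases hxa : x = a
    · simp [hxa]
    · simp only [hxa, if_false]
      exact e x (Finset.mem_of_mem_insert_of_ne hx hxa)

theorem primrec_nat_pow : Primrec₂ ((· ^ ·) : ℕ → ℕ → ℕ) :=
  Primrec₂.unpaired'.1 Nat.Primrec.pow

/-- If all entries of a list are defined, the list of these entries. -/
def gather (τ : Type*) [Inhabited τ] (l : List (Option τ)) : Option (List τ) :=
  if ∀ x ∈ l, x.isSome = true then some (l.map fun x => x.getD default) else none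

theorem gather_eq_some_iff {τ : Type*} [Inhabited τ] {l : List (Option τ)} {v : List τ} :
    gather τ l = some v ↔ l = v.map some := by
  rw [gather]
  constructor
  · intro e
    split_ifs at e with hl
    rw [← Option.some.inj e, List.map_map]
    conv_lhs => rw [← List.map_id l]
    refine List.map_congr_left fun x hx => ?_
    obtain ⟨y, rfl⟩ := Option.isSome_iff_exists.1 (hl x hx)
    rfl
  · rintro rfl
    rw [if_pos (by simp), List.map_map]
    congr 1
    exact List.map_id v

theorem primrec_gather [Inhabited τ] : Primrec (gather τ) := by
  refine Primrec.ite (PrimrecPred.forall_mem_list ?_) (option_some.comp (list_map .id ?_)) (.const _)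
  · exact Primrec.eq.comp option_isSome (.const true)
  · exact option_getD.comp snd (.const _)

/-- Combination of finitely many evaluation functions of given arities into one function. -/
theorem exists_primrec_symbols {ι : Type*} [Finite ι] (code : ι → ℕ)
    (hcode : Function.Injective code) (ar : ι → ℕ) (f : ι → List ℕ → σ) (hf : ∀ i, Primrec (f i)) :
    ∃ g : ℕ → List ℕ → Option σ, Primrec₂ g ∧
      ∀ c v y, g c v = some y ↔ ∃ i, code i = c ∧ v.length = ar i ∧ f i v = y := by
  classical
  have := Fintype.ofFinite ι
  suffices ∀ T : Finset ι, ∃ g : ℕ → List ℕ → Option σ, Primrec₂ g ∧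
      ∀ c v y, g c v = some y ↔ ∃ i ∈ T, code i = c ∧ v.length = ar i ∧ f i v = y by
    simpa using this Finset.univ
  intro T
  induction T using Finset.induction_on with
  | empty => exact ⟨fun _ _ => none, Primrec₂.const _, by simp⟩
  | insert i T hi ih =>
    obtain ⟨g, hg, e⟩ := ih
    refine ⟨fun c v => if c = code i ∧ v.length = ar i then some (f i v) else g c v, ?_, ?_⟩
    · refine Primrec.ite (.and (Primrec.eq.comp fst (.const _))
        (Primrec.eq.comp (list_length.comp snd) (.const _))) (option_some.comp ((hf i).comp snd)) ?_
      exact hg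
    · intro c v y
      change (if _ then _ else _) = _ ↔ _
      split_ifs with hc
      · rw [Option.some_inj]
        constructor
        · intro hy
          exact ⟨i, Finset.mem_insert_self _ _, hc.1.symm, hc.2, hy⟩
        · rintro ⟨j, -, hj, -, hy⟩
          rwa [hcode (hj.trans hc.1)] at hy
      · rw [e]
        constructor
        · rintro ⟨j, hj, hy⟩
          exact ⟨j, Finset.mem_insert_of_mem hj, hy⟩
        · rintro ⟨j, hj, h1, h2, h3⟩
          rcases Finset.mem_insert.1 hj with rfl | hj
          · exact absurd ⟨h1.symm, h2⟩ hc
          · exact ⟨j, hj, h1, h2, h3⟩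

/-- Course-of-values recursion in the form "a function with this equation exists": the list of
earlier values is built by ordinary recursion. -/
theorem exists_primrec_strong_rec {step : α → List σ → σ} (hstep : Primrec₂ step) :
    ∃ f : α → ℕ → σ, Primrec₂ f ∧ ∀ a n, f a n = step a ((List.range n).map (f a)) := by
  let hist : α → ℕ → List σ := fun a n => Nat.rec [] (fun _ l => l ++ [step a l]) n
  have hh : ∀ a n, hist a n = (List.range n).map fun k => step a (hist a k) := by
    intro a n
    induction n with
    | zero => rfl
    | succ n ih =>
      change hist a n ++ [step a (hist a n)] = _
      rw [List.range_succ, List.map_append]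
      exact congrArg (· ++ [step a (hist a n)]) ih
  have hf : ∀ a n, step a (hist a n) = step a ((List.range n).map fun k => step a (hist a k)) :=
    fun a n => congrArg (step a) (hh a n)
  exact ⟨fun a n => step a (hist a n),
    nat_strong_rec _ (g := fun a l => some (step a l)) (option_some.comp hstep)
      fun a n => congrArg some (hf a n).symm, hf⟩

/-- Recursion along a decreasing measure `m`, with the list of recursive calls `l a b` given
explicitly. Well-founded recursion provides the function, and the resulting equation makes it
primitive recursive. -/
theorem exists_primrec_omega_rec {m : β → ℕ} {l : α → β → List β} {g : α → β × List σ → σ}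
    (hm : Primrec m) (hl : Primrec₂ l) (hg : Primrec₂ g) (ord : ∀ a b, ∀ b' ∈ l a b, m b' < m b) :
    ∃ f : α → β → σ, Primrec₂ f ∧ ∀ a b, f a b = g a (b, (l a b).map (f a)) := by
  have wf : WellFounded fun b b' : β => m b < m b' := InvImage.wf m Nat.lt_wfRel.wf
  let f : α → β → σ := fun a => wf.fix fun b rec =>
    g a (b, (l a b).attach.map fun b' => rec b'.1 (ord a b b'.1 b'.2))
  have hf : ∀ a b, f a b = g a (b, (l a b).map (f a)) := by
    intro a b
    change wf.fix _ b = _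
    rw [wf.fix_eq]
    exact congrArg (fun t => g a (b, t)) (List.attach_map_val (f := f a))
  exact ⟨f, nat_omega_rec f (m := fun _ b => m b) (g := fun a p => some (g a p))
    (hm.comp snd) hl (option_some.comp hg) ord fun a b => congrArg some (hf a b).symm, hf⟩

theorem exists_primrec_search {p : α → ℕ → Bool} (hp : Primrec₂ p) {bd : α → ℕ} (hb : Primrec bd) :
    ∃ f : α → ℕ, Primrec f ∧ ∀ a, (∃ n < bd a, p a n = true) → p a (f a) = true := by
  refine ⟨fun a => (List.range (bd a)).findIdx (p a), list_findIdx (list_range.comp hb) hp, ?_⟩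
  rintro a ⟨n, hn, hpn⟩
  have := List.findIdx_getElem (p := p a) (xs := List.range (bd a))
    (w := List.findIdx_lt_length_of_exists ⟨n, by simpa using hn, hpn⟩)
  simpa using this

end PrimrecLemmas

/-! ### Elements as natural numbers -/

section Numbers

variable {G : Type u} [AddCommGroup G] {F : AddMonoid.End G} {S : Finset G}

variable (S) in
/-- The letters of `S`, enumerated by the digits in base `S.card + 1`. -/
def digitLetter (d : ℕ) : G :=
  if hd : 1 ≤ d ∧ d - 1 < S.card then letter S ⟨d - 1, hd.2⟩ else 0

/-- Digit `0` stands for the letter `0`, so leading zeros of a numeral do not matter. As `0 ∈ S`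
also has a positive digit, `decode` is onto but not injective. -/
theorem digitLetter_zero : digitLetter S 0 = 0 := by simp [digitLetter]

theorem exists_digitLetter {s : G} (hs : s ∈ S) : ∃ d < S.card + 1, digitLetter S d = s := by
  obtain ⟨t, rfl⟩ := exists_letter hs
  exact ⟨t + 1, by omega, by simp [digitLetter]⟩

variable (F S) in
/-- The element represented by the word of base `S.card + 1` digits of `n`. -/
def decode (n : ℕ) : G := eval F ((Nat.digits (S.card + 1) n).map (digitLetter S))

variable (F S) in
/-- The tuple of elements represented by a list of numbers. -/
def decodeFun (v : List ℕ) (n : ℕ) : Fin n → G := fun i => decode F S (v.getD i 0)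

theorem primrec_sum : Primrec fun v : List ℕ => v.foldr (· + ·) 0 :=
  Primrec.list_foldr .id (.const 0)
    (Primrec.nat_add.comp (Primrec.fst.comp .snd) (Primrec.snd.comp .snd)).to₂

theorem decode_zero : decode F S 0 = 0 := by simp [decode, eval]

variable (h : IsSparseSpanning F S)
include h

theorem digitLetter_mem (d : ℕ) : digitLetter S d ∈ S := by
  rw [digitLetter]
  split_ifs
  exacts [letter_mem _, h.zero_mem]

theorem two_le_base : 2 ≤ S.card + 1 := by
  have := Finset.card_pos.2 ⟨0, h.zero_mem⟩
  omega

theorem decode_eq (n : ℕ) : decode F S n = digitLetter S (n % (S.card + 1)) +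
    F (decode F S (n / (S.card + 1))) := by
  rcases Nat.eq_zero_or_pos n with rfl | hn
  · simp [decode_zero, digitLetter_zero]
  · conv_lhs => rw [decode, Nat.digits_def' (two_le_base h) hn]
    rfl

theorem decode_mem_ball {n ℓ : ℕ} (hn : n < (S.card + 1) ^ ℓ) : decode F S n ∈ Ball F S ℓ := by
  induction ℓ generalizing n with
  | zero =>
    obtain rfl : n = 0 := by simpa using hn
    exact decode_zero
  | succ ℓ ih =>
    rw [decode_eq h]
    exact ⟨_, digitLetter_mem h _, _, ih (Nat.div_lt_of_lt_mul (by rwa [← pow_succ'])), rfl⟩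

theorem exists_decode_eq {g : G} {ℓ : ℕ} (hg : g ∈ Ball F S ℓ) :
    ∃ n < (S.card + 1) ^ ℓ, decode F S n = g := by
  induction ℓ generalizing g with
  | zero => exact ⟨0, by simp, by rw [decode_zero]; exact (Set.mem_singleton_iff.1 hg).symm⟩
  | succ ℓ ih =>
    obtain ⟨s, hs, k, hk, rfl⟩ := hg
    obtain ⟨n, hn, rfl⟩ := ih hk
    obtain ⟨d, hd, rfl⟩ := exists_digitLetter hs
    refine ⟨d + (S.card + 1) * n, ?_, ?_⟩
    · calc d + (S.card + 1) * n < (S.card + 1) * (n + 1) := by rw [Nat.mul_succ]; omega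
        _ ≤ (S.card + 1) * (S.card + 1) ^ ℓ := Nat.mul_le_mul_left _ hn
        _ = _ := (pow_succ' _ _).symm
    · rw [decode_eq h, Nat.add_mul_mod_self_left, Nat.mod_eq_of_lt hd,
        Nat.add_mul_div_left _ _ (Nat.succ_pos _), Nat.div_eq_of_lt hd, zero_add]

theorem lt_base_pow_sum {v : List ℕ} {x : ℕ} (hx : x ∈ v) :
    x < (S.card + 1) ^ v.foldr (· + ·) 0 := by
  have : x ≤ v.foldr (· + ·) 0 := by
    induction v with
    | nil => simp at hx
    | cons y v ih =>
      rcases List.mem_cons.1 hx with rfl | hx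
      · exact Nat.le_add_right _ _
      · exact (ih hx).trans (Nat.le_add_left _ _)
  exact this.trans_lt (Nat.lt_pow_self (two_le_base h))

/-- Membership in a set with finitely many derivatives is primitive recursive. -/
theorem Auto.exists_primrec {k l : ℕ} {A : Set (Fin l → G)} (hA : Auto F S k A) :
    ∃ f : List ℕ → Bool, Primrec f ∧
      ∀ v, v.length = l → (f v = true ↔ decodeFun F S v l ∈ A) := by
  classical
  obtain ⟨𝒜, -, hA, h𝒜⟩ := hA
  let b := S.card + 1
  let letters : List ℕ → Fin l → S := fun d i => ⟨digitLetter S (d.getD i 0), digitLetter_mem h _⟩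
  let next : 𝒜 → List ℕ → 𝒜 := fun B d => ⟨_, h𝒜 B.1 B.2 (letters d)⟩
  let st : 𝒜 ≃ Fin 𝒜.card := 𝒜.equivFin
  have hfin : {d : List ℕ | d.length = l ∧ ∀ x ∈ d, x < b}.Finite := by
    have : {d : List ℕ | d.length = l ∧ ∀ x ∈ d, x < b} ⊆
        Set.range fun t : Fin l → Fin b => List.ofFn fun i => (t i : ℕ) := by
      rintro d ⟨rfl, hd⟩
      exact ⟨fun i => ⟨d[i], hd _ (List.getElem_mem _)⟩, by simp⟩
    exact (Set.finite_range _).subset this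
  have : Inhabited (Fin 𝒜.card) := ⟨st ⟨A, hA⟩⟩
  -- The transition table of the automaton whose states are the members of `𝒜`; only finitely many
  -- tuples of digits occur.
  obtain ⟨δ, hδ, eδ⟩ := exists_primrec_eqOn (Finset.univ ×ˢ hfin.toFinset)
    fun p : Fin 𝒜.card × List ℕ => st (next (st.symm p.1) p.2)
  let step : Fin 𝒜.card × List ℕ → Fin 𝒜.card × List ℕ := fun p =>
    (δ (p.1, p.2.map fun x => x % b), p.2.map fun x => x / b)
  have hstep : Primrec step := by
    refine .pair (hδ.comp (.pair .fst (Primrec.list_map .snd ?_))) (Primrec.list_map .snd ?_)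
    · exact Primrec.nat_mod.comp .snd (.const _)
    · exact Primrec.nat_div.comp .snd (.const _)
  -- Once all digits are consumed, the remaining tuple is zero.
  let acc : Fin 𝒜.card → Bool := fun q => decide ((fun _ => 0) ∈ (st.symm q).1)
  have key : ∀ N q (v : List ℕ), v.length = l → (∀ x ∈ v, x < b ^ N) →
      (acc (step^[N] (q, v)).1 = true ↔ decodeFun F S v l ∈ (st.symm q).1) := by
    intro N
    induction N with
    | zero =>
      intro q v hv hlt
      have : decodeFun F S v l = fun _ => 0 := by
        ext i
        have : v.getD i 0 = 0 := by
          rw [List.getD_eq_getElem _ _ (by omega)]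
          simpa using hlt _ (List.getElem_mem (by omega))
        rw [decodeFun, this, decode_zero]
      rw [this]
      simp [acc]
    | succ N ih =>
      intro q v hv hlt
      rw [Function.iterate_succ_apply, ih _ _ (by simpa using hv)]
      · have e1 : δ (q, v.map fun x => x % b) = st (next (st.symm q) (v.map fun x => x % b)) := by
          refine eδ (q, _) (Finset.mem_product.2 ⟨Finset.mem_univ _, ?_⟩)
          rw [Set.Finite.mem_toFinset]
          refine ⟨by simpa using hv, fun x hx => ?_⟩
          obtain ⟨y, -, rfl⟩ := List.mem_map.1 hx
          exact Nat.mod_lt _ (Nat.succ_pos _)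
        rw [e1, Equiv.symm_apply_apply]
        have e2 : (fun i => ((letters (v.map fun x => x % b) i : S) : G) +
            F (decodeFun F S (v.map fun x => x / b) l i)) = decodeFun F S v l := by
          ext i
          have hi : (i : ℕ) < v.length := by omega
          simp only [letters, decodeFun]
          rw [List.getD_eq_getElem _ _ (by simpa using hi), List.getElem_map,
            List.getD_eq_getElem _ _ (by simpa using hi), List.getElem_map,
            List.getD_eq_getElem _ _ hi, decode_eq h (v[(i : ℕ)])]
        rw [← e2]
        rfl
      · intro x hx
        obtain ⟨y, hy, rfl⟩ := List.mem_map.1 hx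
        exact Nat.div_lt_of_lt_mul (by rw [← pow_succ']; exact hlt y hy)
  -- The sum of the entries bounds the number of digits of each of them; superfluous steps read
  -- zeros.
  refine ⟨fun v => acc (step^[v.foldr (· + ·) 0] (st ⟨A, hA⟩, v)).1, ?_, fun v hv => ?_⟩
  · exact (Primrec.dom_finite acc).comp (Primrec.fst.comp (Primrec.nat_iterate primrec_sum
      (.pair (.const _) .id) (hstep.comp .snd).to₂))
  · rw [key _ _ v hv fun x hx => lt_base_pow_sum h hx, Equiv.symm_apply_apply]

/-- A function whose graph has finitely many derivatives is primitive recursive. -/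
theorem Auto.exists_primrec_fun {k l : ℕ} {f : (Fin l → G) → G}
    (hf : Auto F S k {v : Fin l ⊕ Unit → G | f (v ∘ Sum.inl) = v (Sum.inr ())}) :
    ∃ g : List ℕ → ℕ, Primrec g ∧
      ∀ v, v.length = l → decode F S (g v) = f (decodeFun F S v l) := by
  obtain ⟨p, hp, ep⟩ := (hf.reindex (Sum.elim Fin.castSucc fun _ => Fin.last l)).exists_primrec h
  have hp' : Primrec₂ fun (v : List ℕ) (n : ℕ) => p (v ++ [n]) :=
    hp.comp (Primrec.list_concat.comp .fst .snd)
  -- The value is found by bounded search: the arguments have at most as many digits as the sum of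
  -- the entries, and by `Auto.exists_mem_ball` the value needs at most `k` more.
  have hb : Primrec fun v : List ℕ => (S.card + 1) ^ (v.foldr (· + ·) 0 + k) :=
    primrec_nat_pow.comp (.const _) (Primrec.nat_add.comp primrec_sum (.const k))
  have key : ∀ v n, v.length = l →
      (p (v ++ [n]) = true ↔ f (decodeFun F S v l) = decode F S n) := by
    intro v n hv
    rw [ep _ (by simp [hv])]
    change f _ = decode F S _ ↔ _
    have e1 : (v ++ [n]).getD (Fin.last l) 0 = n := by
      rw [List.getD_eq_getElem _ _ (by simp [hv])]
      simp [← hv]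
    have e2 : (decodeFun F S (v ++ [n]) (l + 1) ∘ (Sum.elim Fin.castSucc fun _ : Unit => Fin.last l)) ∘
        Sum.inl = decodeFun F S v l := by
      ext i
      simp only [Function.comp_apply, Sum.elim_inl, decodeFun, Fin.val_castSucc]
      rw [List.getD_append _ _ _ _ (by omega)]
    have e3 : decode F S ((v ++ [n]).getD (Fin.last l) 0) = decode F S n := by rw [e1]
    rw [← e2, ← e3]
    rfl
  obtain ⟨g, hg, eg⟩ := exists_primrec_search hp' hb
  refine ⟨g, hg, fun v hv => ?_⟩
  refine ((key v _ hv).1 (eg v ?_)).symm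
  obtain ⟨y, hy, e⟩ := hf.exists_mem_ball h (v := decodeFun F S v l) (ℓ := v.foldr (· + ·) 0)
    (fun i => by
      refine decode_mem_ball h (lt_base_pow_sum h ?_)
      rw [List.getD_eq_getElem _ _ (by omega)]
      exact List.getElem_mem _)
    ⟨fun _ => f (decodeFun F S v l), rfl⟩
  obtain ⟨n, hn, e'⟩ := exists_decode_eq h (hy ())
  exact ⟨n, hn, (key v n hv).2 (Eq.trans e e'.symm)⟩

end Numbers

end FGamma
end

open scoped FirstOrder
noncomputable section
namespace FGamma

/-! ### Decidability -/

section Decidability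

open FirstOrder Language Primrec

theorem lt_of_mem_ofNat {n a : ℕ} (ha : a ∈ Denumerable.ofNat (List ℕ) n) : a < n := by
  have key : ∀ l : List ℕ, ∀ a ∈ l, a < Encodable.encode l := by
    intro l
    induction l with
    | nil => simp
    | cons b l ih =>
      intro a ha
      rw [Encodable.encode_list_cons]
      rcases List.mem_cons.1 ha with rfl | ha
      · exact Nat.lt_succ_of_le (Nat.left_le_pair _ _)
      · exact (ih a ha).trans_le ((Nat.right_le_pair _ _).trans (Nat.le_succ _))
  simpa using key _ a ha

theorem lt_pair_right {a b : ℕ} (ha : 1 ≤ a) : b < Nat.pair a b := by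
  have := Nat.add_le_pair a b
  omega

theorem exists_pair (n : ℕ) : ∃ a b, n = Nat.pair a b :=
  ⟨n.unpair.1, n.unpair.2, (Nat.pair_unpair n).symm⟩

/-- Evaluation of terms, relative to an evaluation `fe` of function symbols. -/
theorem exists_primrec_term {fe : ℕ → List ℕ → Option ℕ} (hfe : Primrec₂ fe) :
    ∃ te : List ℕ → ℕ → Option ℕ, Primrec₂ te ∧
      (∀ e i, te e (Nat.pair 0 i) = e[i]?) ∧
      (∀ e c (l : List ℕ), te e (Nat.pair 1 (Nat.pair c (Encodable.encode l))) =
        (gather ℕ (l.map (te e))).bind (fe c)) ∧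
      ∀ e a b, 2 ≤ a → te e (Nat.pair a b) = none := by
  -- The history lists the results for all smaller codes, so its length is the code under
  -- evaluation.
  let step : List ℕ → List (Option ℕ) → Option ℕ := fun e hist =>
    if hist.length.unpair.1 = 0 then e[hist.length.unpair.2]?
    else if hist.length.unpair.1 = 1 then
      (gather ℕ ((Denumerable.ofNat (List ℕ) hist.length.unpair.2.unpair.2).map
        fun a => hist.getD a none)).bind (fe hist.length.unpair.2.unpair.1)
    else none
  have hlen : Primrec fun p : List ℕ × List (Option ℕ) => p.2.length.unpair :=
    unpair.comp (list_length.comp snd)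
  have hlen2 : Primrec fun p : List ℕ × List (Option ℕ) => p.2.length.unpair.2.unpair :=
    unpair.comp (snd.comp hlen)
  have hstep : Primrec₂ step := by
    refine Primrec.ite (Primrec.eq.comp (fst.comp hlen) (.const _))
      (list_getElem?.comp fst (snd.comp hlen))
      (Primrec.ite (Primrec.eq.comp (fst.comp hlen) (.const _)) ?_ (.const _))
    refine option_bind (primrec_gather.comp (list_map ((Primrec.ofNat _).comp (snd.comp hlen2)) ?_)) ?_
    · exact (list_getD none).comp (snd.comp fst) snd
    · exact hfe.comp ((fst.comp hlen2).comp fst) snd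
  obtain ⟨te, hte, e⟩ := exists_primrec_strong_rec hstep
  refine ⟨te, hte, ?_, ?_, ?_⟩
  · intro v i
    rw [e]
    simp [step]
  · intro v c l
    rw [e]
    simp only [step, List.length_map, List.length_range, Nat.unpair_pair, Denumerable.ofNat_encode,
      one_ne_zero, if_false, if_true]
    congr 2
    refine List.map_congr_left fun a ha => ?_
    have h1 : a < Encodable.encode l := lt_of_mem_ofNat (by rwa [Denumerable.ofNat_encode])
    have h2 : a < Nat.pair 1 (Nat.pair c (Encodable.encode l)) :=
      h1.trans_le ((Nat.right_le_pair _ _).trans (Nat.right_le_pair _ _))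
    rw [List.getD_eq_getElem _ _ (by simpa using h2)]
    simp
  · intro v a b hab
    rw [e]
    simp only [step, List.length_map, List.length_range, Nat.unpair_pair]
    rw [if_neg (by omega), if_neg (by omega)]

/-- Evaluation of formulas, relative to an evaluation `te` of terms, `re` of relation symbols and
`ee` of equality; quantifiers range over the numbers below `bd K n`, where `n` is the number of
variables in scope. -/
theorem exists_primrec_formula {te : List ℕ → ℕ → Option ℕ} (hte : Primrec₂ te)
    {re : ℕ → List ℕ → Option Bool} (hre : Primrec₂ re) {ee : List ℕ → Bool} (hee : Primrec ee)
    {bd : ℕ → ℕ → ℕ} (hbd : Primrec₂ bd) :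
    ∃ ev : ℕ → List ℕ → ℕ → Option Bool, (Primrec fun p : ℕ × List ℕ × ℕ => ev p.1 p.2.1 p.2.2) ∧
      (∀ K v b, ev K v (Nat.pair 0 b) = if b = 0 then some false else none) ∧
      (∀ K v a b, ev K v (Nat.pair 1 (Nat.pair a b)) = (gather ℕ [te v a, te v b]).map ee) ∧
      (∀ K v c (l : List ℕ), ev K v (Nat.pair 2 (Nat.pair c (Encodable.encode l))) =
        (gather ℕ (l.map (te v))).bind (re c)) ∧
      (∀ K v a b, ev K v (Nat.pair 3 (Nat.pair a b)) =
        (gather Bool [ev K v a, ev K v b]).map fun l => !l.getD 0 false || l.getD 1 false) ∧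
      (∀ K v a, ev K v (Nat.pair 4 a) =
        (gather Bool ((List.range (bd K v.length)).map fun y => ev K (v ++ [y]) a)).map
          fun l => decide (∀ b ∈ l, b = true)) ∧
      ∀ K v a b, 5 ≤ a → ev K v (Nat.pair a b) = none := by
  -- The recursion is on the code alone: under a quantifier the assignment grows but the code
  -- decreases.
  let calls : ℕ → List ℕ × ℕ → List (List ℕ × ℕ) := fun K p =>
    if p.2.unpair.1 = 3 then [(p.1, p.2.unpair.2.unpair.1), (p.1, p.2.unpair.2.unpair.2)]
    else if p.2.unpair.1 = 4 then
      (List.range (bd K p.1.length)).map fun y => (p.1 ++ [y], p.2.unpair.2)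
    else []
  let step : ℕ → (List ℕ × ℕ) × List (Option Bool) → Option Bool := fun _ p =>
    if p.1.2.unpair.1 = 0 then if p.1.2.unpair.2 = 0 then some false else none
    else if p.1.2.unpair.1 = 1 then
      (gather ℕ [te p.1.1 p.1.2.unpair.2.unpair.1, te p.1.1 p.1.2.unpair.2.unpair.2]).map ee
    else if p.1.2.unpair.1 = 2 then
      (gather ℕ ((Denumerable.ofNat (List ℕ) p.1.2.unpair.2.unpair.2).map (te p.1.1))).bind
        (re p.1.2.unpair.2.unpair.1)
    else if p.1.2.unpair.1 = 3 then
      (gather Bool p.2).map fun l => !l.getD 0 false || l.getD 1 false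
    else if p.1.2.unpair.1 = 4 then (gather Bool p.2).map fun l => decide (∀ b ∈ l, b = true)
    else none
  have hcalls : Primrec₂ calls := by
    have h1 : Primrec fun p : ℕ × List ℕ × ℕ => p.2.2.unpair := unpair.comp (snd.comp snd)
    have h2 : Primrec fun p : ℕ × List ℕ × ℕ => p.2.2.unpair.2.unpair := unpair.comp (snd.comp h1)
    have hv : Primrec fun p : ℕ × List ℕ × ℕ => p.2.1 := fst.comp snd
    refine Primrec.ite (Primrec.eq.comp (fst.comp h1) (.const _)) ?_
      (Primrec.ite (Primrec.eq.comp (fst.comp h1) (.const _)) ?_ (.const _))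
    · exact list_cons.comp (hv.pair (fst.comp h2)) (list_cons.comp (hv.pair (snd.comp h2)) (.const _))
    · refine list_map (list_range.comp (hbd.comp fst (list_length.comp hv))) ?_
      exact Primrec.pair (list_concat.comp (hv.comp fst) snd) ((snd.comp h1).comp fst)
  have hstep : Primrec₂ step := by
    have h0 : Primrec fun p : ℕ × (List ℕ × ℕ) × List (Option Bool) => p.2.1 := fst.comp snd
    have hv : Primrec fun p : ℕ × (List ℕ × ℕ) × List (Option Bool) => p.2.1.1 := fst.comp h0
    have h1 : Primrec fun p : ℕ × (List ℕ × ℕ) × List (Option Bool) => p.2.1.2.unpair :=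
      unpair.comp (snd.comp h0)
    have h2 : Primrec fun p : ℕ × (List ℕ × ℕ) × List (Option Bool) => p.2.1.2.unpair.2.unpair :=
      unpair.comp (snd.comp h1)
    have hr : Primrec fun p : ℕ × (List ℕ × ℕ) × List (Option Bool) => p.2.2 := snd.comp snd
    have htag : ∀ k : ℕ, PrimrecPred fun p : ℕ × (List ℕ × ℕ) × List (Option Bool) =>
        p.2.1.2.unpair.1 = k := fun k => Primrec.eq.comp (fst.comp h1) (.const k)
    refine Primrec.ite (htag 0) (Primrec.ite (Primrec.eq.comp (snd.comp h1) (.const _)) (.const _)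
      (.const _)) (Primrec.ite (htag 1) ?_ (Primrec.ite (htag 2) ?_ (Primrec.ite (htag 3) ?_
        (Primrec.ite (htag 4) ?_ (.const _)))))
    · exact option_map (primrec_gather.comp (list_cons.comp (hte.comp hv (fst.comp h2))
        (list_cons.comp (hte.comp hv (snd.comp h2)) (.const _)))) (hee.comp snd)
    · refine option_bind (primrec_gather.comp (list_map ((Primrec.ofNat _).comp (snd.comp h2)) ?_)) ?_
      · exact hte.comp (hv.comp fst) snd
      · exact hre.comp ((fst.comp h2).comp fst) snd
    · refine option_map (primrec_gather.comp hr) ?_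
      exact Primrec.or.comp (Primrec.not.comp ((list_getD false).comp snd (.const 0)))
        ((list_getD false).comp snd (.const 1))
    · refine option_map (primrec_gather.comp hr) ?_
      have : PrimrecPred fun l : List Bool => ∀ b ∈ l, b = true :=
        PrimrecPred.forall_mem_list (Primrec.eq.comp .id (.const true))
      exact this.decide.comp snd
  obtain ⟨f, hf, e⟩ := exists_primrec_omega_rec (m := fun p : List ℕ × ℕ => p.2) snd hcalls hstep (by
    rintro K ⟨v, n⟩ p hp
    obtain ⟨a, b, rfl⟩ := exists_pair n
    simp only [calls, Nat.unpair_pair] at hp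
    split_ifs at hp with h3 h4
    · obtain ⟨c, d, rfl⟩ := exists_pair b
      rw [Nat.unpair_pair] at hp
      rcases List.mem_cons.1 hp with rfl | hp
      · exact (Nat.left_le_pair c d).trans_lt (lt_pair_right (by omega))
      · rw [List.mem_singleton.1 hp]
        exact (Nat.right_le_pair c d).trans_lt (lt_pair_right (by omega))
    · obtain ⟨y, -, rfl⟩ := List.mem_map.1 hp
      exact lt_pair_right (by omega)
    · simp at hp)
  refine ⟨fun K v n => f K (v, n), hf, ?_, ?_, ?_, ?_, ?_, ?_⟩
  · intro K v b
    simp only [e, step, Nat.unpair_pair, if_true]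
  · intro K v a b
    simp only [e, step, Nat.unpair_pair, one_ne_zero, if_true, if_false]
  · intro K v c l
    simp only [e, step, Nat.unpair_pair, Denumerable.ofNat_encode]
    rfl
  · intro K v a b
    change f K (v, _) = _
    rw [e]
    simp only [step, calls, Nat.unpair_pair]
    rfl
  · intro K v a
    change f K (v, _) = _
    rw [e]
    simp only [step, calls, Nat.unpair_pair, OfNat.ofNat_ne_zero, OfNat.ofNat_ne_one,
      Nat.reduceEqDiff, if_true, if_false, List.map_map]
    rfl
  · intro K v a b hab
    change f K (v, _) = _
    rw [e]
    simp only [step, Nat.unpair_pair]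
    rw [if_neg (by omega), if_neg (by omega), if_neg (by omega), if_neg (by omega),
      if_neg (by omega)]

section Rank

variable {L : FirstOrder.Language} {cf : (Σ n, L.Functions n) → ℕ}
  {cr : (Σ n, L.Relations n) → ℕ}

theorem sup_lt_encode_ofFn {l : ℕ} {r s : Fin l → ℕ} (hrs : ∀ i, r i ≤ s i) :
    (Finset.univ.sup r) ≤ Encodable.encode (List.ofFn s) :=
  Finset.sup_le fun i _ => (hrs i).trans (lt_of_mem_ofNat (by simp)).le

theorem termRank_le {α : Type} (cv : α → ℕ) (t : L.Term α) : termRank t ≤ termCode cf cv t := by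
  induction t with
  | var => exact Nat.zero_le _
  | func f ts ih =>
    exact ((sup_lt_encode_ofFn ih).trans (Nat.right_le_pair _ _)).trans_lt (lt_pair_right le_rfl)

/-- The Gödel number bounds the nesting depth, so a bound on the number of derivatives can be
computed from the code without decoding it. -/
theorem formulaRank_le {n : ℕ} (φ : L.BoundedFormula Empty n) :
    formulaRank φ ≤ formulaCode cf cr φ := by
  induction φ with
  | falsum => exact Nat.zero_le _
  | equal t₁ t₂ =>
    refine lt_of_le_of_lt ?_ (lt_pair_right le_rfl)
    exact max_le ((termRank_le _ _).trans (Nat.left_le_pair _ _))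
      ((termRank_le _ _).trans (Nat.right_le_pair _ _))
  | rel r ts =>
    refine lt_of_le_of_lt ?_ (lt_pair_right (by norm_num))
    exact (sup_lt_encode_ofFn fun i => termRank_le _ _).trans (Nat.right_le_pair _ _)
  | imp φ ψ ih₁ ih₂ =>
    refine lt_of_le_of_lt ?_ (lt_pair_right (by norm_num))
    exact max_le (ih₁.trans (Nat.left_le_pair _ _)) (ih₂.trans (Nat.right_le_pair _ _))
  | all φ ih => exact lt_of_le_of_lt ih (lt_pair_right (by norm_num))

end Rank

variable {G : Type u} [AddCommGroup G] {F : AddMonoid.End G} {S : Finset G}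
  {L : FirstOrder.Language} [L.Structure G] {M : ℕ}

theorem primrec_stateBound (M : ℕ) : Primrec (stateBound M) := by
  refine nat_iterate .id (.const M) ?_
  exact primrec_nat_pow.comp (.const 2) (primrec_nat_pow.comp snd (.const 3))

/-- The first-order theory of a structure whose basic relations have finitely many derivatives is
decidable. -/
theorem IsAutoStructure.hasDecidableTheory [Finite L.Symbols] (h : IsSparseSpanning F S)
    (hM : IsAutoStructure F S L M) : HasDecidableTheory L G := by
  intro cf cr hcf hcr
  have : Finite (Σ l, L.Functions l) := Finite.of_injective _ (Sum.inl_injective :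
    Function.Injective (Sum.inl : _ → L.Symbols))
  have : Finite (Σ l, L.Relations l) := Finite.of_injective _ (Sum.inr_injective :
    Function.Injective (Sum.inr : _ → L.Symbols))
  choose fe₀ hfe₀ efe₀ using fun f : Σ l, L.Functions l => (hM.fn f.1 f.2).exists_primrec_fun h
  choose re₀ hre₀ ere₀ using fun r : Σ l, L.Relations l => (hM.rel r.1 r.2).exists_primrec h
  obtain ⟨ee, hee, eee⟩ := hM.eq.exists_primrec h
  obtain ⟨fe, hfe, efe⟩ := exists_primrec_symbols cf hcf (fun f => f.1) fe₀ hfe₀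
  obtain ⟨re, hre, ere⟩ := exists_primrec_symbols cr hcr (fun r => r.1) re₀ hre₀
  obtain ⟨te, hte, te0, te1, te2⟩ := exists_primrec_term hfe
  -- Invariant: `n` variables in scope have values with at most `n * K` digits. If `K` bounds the
  -- number of derivatives, `K` further digits suffice for the next variable.
  have hbd : Primrec₂ fun K n : ℕ => (S.card + 1) ^ ((n + 1) * K) :=
    primrec_nat_pow.comp (.const _) (nat_mul.comp (succ.comp snd) fst)
  obtain ⟨ev, hev, ev0, ev1, ev2, ev3, ev4, ev5⟩ := exists_primrec_formula hte hre hee hbd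
  -- values of terms
  have term_val : ∀ (v : List ℕ) (t : L.Term (Empty ⊕ Fin v.length)),
      ∃ z, te v (termCode cf varCode t) = some z ∧
        decode F S z = t.realize (Sum.elim default (decodeFun F S v v.length)) := by
    intro v t
    induction t with
    | var x =>
      rcases x with ⟨⟨⟩⟩ | i
      refine ⟨v[i], ?_, ?_⟩
      · rw [termCode, te0]
        exact List.getElem?_eq_getElem i.2
      · simp [decodeFun]
    | @func l f ts ih =>
      choose z hz ez using ih
      refine ⟨fe₀ ⟨l, f⟩ (List.ofFn z), ?_, ?_⟩
      · rw [termCode, te1, (gather_eq_some_iff (v := List.ofFn z)).2, Option.bind_some, efe]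
        · exact ⟨_, rfl, by simp, rfl⟩
        · rw [List.map_ofFn, List.map_ofFn]
          congr 1
          ext1 i
          exact hz i
      · rw [efe₀ ⟨l, f⟩ _ (by simp)]
        simp only [Term.realize]
        congr 1
        ext i
        simp [decodeFun, ez]
  -- From here to `formula_code`: the evaluation is defined only on codes of well-formed
  -- expressions. This is needed because the decision procedure receives arbitrary numbers.
  have list_ofFn_code : ∀ (v : List ℕ) (l : List ℕ), (∀ a ∈ l, ∀ z, te v a = some z →
      ∃ t : L.Term (Empty ⊕ Fin v.length), termCode cf varCode t = a) →
      ∀ w, gather ℕ (l.map (te v)) = some w → ∀ n, w.length = n →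
      ∃ ts : Fin n → L.Term (Empty ⊕ Fin v.length),
        List.ofFn (fun i => termCode cf varCode (ts i)) = l := by
    rintro v l hl w hw n rfl
    rw [gather_eq_some_iff] at hw
    have hlen : l.length = w.length := by simpa using congrArg List.length hw
    have : ∀ i : Fin w.length, ∃ t : L.Term (Empty ⊕ Fin v.length),
        termCode cf varCode t = l[(i : ℕ)]'(by omega) := by
      intro i
      refine hl _ (List.getElem_mem _) w[i] ?_
      have := congrArg (fun x => x[(i : ℕ)]?) hw
      simpa [List.getElem?_eq_getElem, hlen] using this
    choose ts hts using this
    refine ⟨ts, ?_⟩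
    rw [funext hts]
    exact List.ext_getElem (by simp [hlen]) (by simp)
  have term_code : ∀ (v : List ℕ) (n z : ℕ), te v n = some z →
      ∃ t : L.Term (Empty ⊕ Fin v.length), termCode cf varCode t = n := by
    intro v n
    induction n using Nat.strong_induction_on with
    | _ n ih =>
      intro z hz
      obtain ⟨a, b, rfl⟩ := exists_pair n
      rcases Nat.lt_or_ge a 2 with ha | ha
      · interval_cases a
        · rw [te0] at hz
          obtain ⟨hb, -⟩ := List.getElem?_eq_some_iff.1 hz
          exact ⟨.var (Sum.inr ⟨b, hb⟩), rfl⟩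
        · obtain ⟨c, d, rfl⟩ := exists_pair b
          obtain ⟨l, rfl⟩ : ∃ l : List ℕ, d = Encodable.encode l :=
            ⟨Denumerable.ofNat _ d, (Denumerable.encode_ofNat d).symm⟩
          rw [te1, Option.bind_eq_some_iff] at hz
          obtain ⟨w, hw, hwz⟩ := hz
          obtain ⟨⟨m, f⟩, rfl, hm, -⟩ := (efe c w z).1 hwz
          have hlt : ∀ a ∈ l, a < Nat.pair 1 (Nat.pair (cf ⟨m, f⟩) (Encodable.encode l)) := by
            intro a ha
            refine (lt_of_mem_ofNat (n := Encodable.encode l) (by simpa using ha)).trans_le ?_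
            exact (Nat.right_le_pair _ _).trans (Nat.right_le_pair _ _)
          obtain ⟨ts, hts⟩ := list_ofFn_code v l (fun a ha z hz => ih a (hlt a ha) z hz) w hw m hm
          exact ⟨.func f ts, by rw [termCode, hts]⟩
      · rw [te2 _ _ _ ha] at hz
        cases hz
  -- every evaluated code is the code of a formula
  have formula_code : ∀ (K n : ℕ) (v : List ℕ) (b : Bool), ev K v n = some b →
      ∀ m, v.length = m → ∃ φ : L.BoundedFormula Empty m, formulaCode cf cr φ = n := by
    intro K n
    induction n using Nat.strong_induction_on with
    | _ n ih =>
      rintro v z hz m rfl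
      obtain ⟨a, b, rfl⟩ := exists_pair n
      rcases Nat.lt_or_ge a 5 with ha | ha
      · interval_cases a
        · rw [ev0] at hz
          split_ifs at hz with hb
          exact ⟨.falsum, by rw [hb]; rfl⟩
        · obtain ⟨c, d, rfl⟩ := exists_pair b
          rw [ev1, Option.map_eq_some_iff] at hz
          obtain ⟨w, hw, -⟩ := hz
          obtain ⟨ts, hts⟩ := list_ofFn_code v [c, d] (fun a _ z hz => term_code v a z hz) w hw 2 (by
            have := congrArg List.length (gather_eq_some_iff.1 hw)
            simpa using this.symm)
          have h1 : termCode cf varCode (ts 0) = c := by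
            simpa using congrArg (fun x : List ℕ => x.getD 0 0) hts
          have h2 : termCode cf varCode (ts 1) = d := by
            simpa using congrArg (fun x : List ℕ => x.getD 1 0) hts
          exact ⟨.equal (ts 0) (ts 1), by rw [formulaCode, h1, h2]⟩
        · obtain ⟨c, d, rfl⟩ := exists_pair b
          obtain ⟨l, rfl⟩ : ∃ l : List ℕ, d = Encodable.encode l :=
            ⟨Denumerable.ofNat _ d, (Denumerable.encode_ofNat d).symm⟩
          rw [ev2, Option.bind_eq_some_iff] at hz
          obtain ⟨w, hw, hwz⟩ := hz
          obtain ⟨⟨m, r⟩, rfl, hm, -⟩ := (ere c w z).1 hwz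
          obtain ⟨ts, hts⟩ := list_ofFn_code v l (fun a _ z hz => term_code v a z hz) w hw m hm
          exact ⟨.rel r ts, by rw [formulaCode, hts]⟩
        · obtain ⟨c, d, rfl⟩ := exists_pair b
          rw [ev3, Option.map_eq_some_iff] at hz
          obtain ⟨w, hw, -⟩ := hz
          rw [gather_eq_some_iff] at hw
          obtain ⟨x, y, rfl⟩ : ∃ x y, w = [x, y] :=
            List.length_eq_two.1 (by simpa using (congrArg List.length hw).symm)
          simp only [List.map_cons, List.map_nil, List.cons.injEq, and_true] at hw
          obtain ⟨φ, rfl⟩ := ih c ((Nat.left_le_pair c d).trans_lt (lt_pair_right (by norm_num)))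
            v x hw.1 _ rfl
          obtain ⟨ψ, rfl⟩ := ih d ((Nat.right_le_pair _ d).trans_lt (lt_pair_right (by norm_num)))
            v y hw.2 _ rfl
          exact ⟨.imp φ ψ, rfl⟩
        · rw [ev4, Option.map_eq_some_iff] at hz
          obtain ⟨w, hw, -⟩ := hz
          rw [gather_eq_some_iff] at hw
          -- The range of a quantifier is never empty; otherwise a quantifier in front of a
          -- malformed code would still receive a value.
          have hpos : 0 < (S.card + 1) ^ ((v.length + 1) * K) := Nat.pow_pos (Nat.succ_pos _)
          have h0 := congrArg (fun x => x[0]?) hw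
          simp only [List.getElem?_map, List.getElem?_range hpos, Option.map_some] at h0
          rcases hw0 : w[0]? with _ | x
          · simp [hw0] at h0
          · rw [hw0] at h0
            obtain ⟨φ, rfl⟩ := ih b (lt_pair_right (by norm_num)) _ x (by simpa using h0)
              (v.length + 1) (by simp)
            exact ⟨.all φ, rfl⟩
      · rw [ev5 _ _ _ _ ha] at hz
        cases hz
  -- values of formulas
  have formula_val : ∀ (K m : ℕ) (φ : L.BoundedFormula Empty m) (v : List ℕ), v.length = m →
      (∀ x ∈ v, decode F S x ∈ Ball F S (m * K)) → stateBound M (formulaRank φ) ≤ K →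
      ∃ b, ev K v (formulaCode cf cr φ) = some b ∧
        (b = true ↔ φ.Realize default (decodeFun F S v m)) := by
    intro K m φ
    induction φ with
    | falsum =>
      intro v _ _ _
      exact ⟨false, by rw [formulaCode, ev0, if_pos rfl], by simp [BoundedFormula.Realize]⟩
    | equal t₁ t₂ =>
      rintro v rfl _ _
      obtain ⟨z₁, h1, e1⟩ := term_val v t₁
      obtain ⟨z₂, h2, e2⟩ := term_val v t₂
      refine ⟨ee [z₁, z₂], ?_, ?_⟩
      · have hz : gather ℕ [some z₁, some z₂] = some [z₁, z₂] := gather_eq_some_iff.2 rfl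
        rw [formulaCode, ev1, h1, h2, hz, Option.map_some]
      · rw [eee _ rfl]
        change decode F S z₁ = decode F S z₂ ↔ _
        rw [e1, e2]
        rfl
    | @rel m l r ts =>
      rintro v rfl _ _
      choose z hz ez using fun i => term_val v (ts i)
      refine ⟨re₀ ⟨l, r⟩ (List.ofFn z), ?_, ?_⟩
      · rw [formulaCode, ev2, (gather_eq_some_iff (v := List.ofFn z)).2, Option.bind_some, ere]
        · exact ⟨_, rfl, by simp, rfl⟩
        · rw [List.map_ofFn, List.map_ofFn]
          congr 1
          ext1 i
          exact hz i
      · rw [ere₀ ⟨l, r⟩ _ (by simp)]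
        have : decodeFun F S (List.ofFn z) l =
            fun i => (ts i).realize (Sum.elim default (decodeFun F S v v.length)) := by
          ext i
          simp [decodeFun, ez]
        rw [this]
        rfl
    | imp φ ψ ih₁ ih₂ =>
      intro v hv hball hK
      obtain ⟨x, hx, ex⟩ := ih₁ v hv hball ((stateBound_mono M
        ((le_max_left _ _).trans (Nat.le_succ _))).trans hK)
      obtain ⟨y, hy, ey⟩ := ih₂ v hv hball ((stateBound_mono M
        ((le_max_right _ _).trans (Nat.le_succ _))).trans hK)
      refine ⟨!x || y, ?_, ?_⟩
      · have hz : gather Bool [some x, some y] = some [x, y] := gather_eq_some_iff.2 rfl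
        rw [formulaCode, ev3, hx, hy, hz]
        rfl
      · rw [BoundedFormula.realize_imp, ← ex, ← ey]
        cases x <;> cases y <;> simp
    | @all m φ ih =>
      intro v hv hball hK
      have hK' : stateBound M (formulaRank φ) ≤ K := (stateBound_mono M (Nat.le_succ _)).trans hK
      have hy : ∀ y < (S.card + 1) ^ ((m + 1) * K), ∃ b,
          ev K (v ++ [y]) (formulaCode cf cr φ) = some b ∧
            (b = true ↔ φ.Realize default (Fin.snoc (decodeFun F S v m) (decode F S y))) := by
        intro y hy
        have e : decodeFun F S (v ++ [y]) (m + 1) =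
            Fin.snoc (decodeFun F S v m) (decode F S y) := by
          ext i
          refine Fin.lastCases ?_ (fun i => ?_) i
          · rw [Fin.snoc_last, decodeFun, List.getD_eq_getElem _ _ (by simp [hv])]
            simp [← hv]
          · rw [Fin.snoc_castSucc, decodeFun, Fin.val_castSucc, List.getD_append _ _ _ _ (by omega)]
            rfl
        rw [← e]
        refine ih (v ++ [y]) (by simp [hv]) (fun x hx => ?_) hK'
        rcases List.mem_append.1 hx with hx | hx
        · exact h.ball_mono (Nat.mul_le_mul_right K m.le_succ) (hball x hx)
        · rw [List.mem_singleton.1 hx]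
          exact decode_mem_ball h hy
      choose! b hb eb using hy
      refine ⟨decide (∀ x ∈ (List.range ((S.card + 1) ^ ((m + 1) * K))).map b, x = true), ?_, ?_⟩
      · rw [formulaCode, ev4, hv, (gather_eq_some_iff (v := (List.range ((S.card + 1) ^ ((m + 1) * K))).map b)).2]
        · rfl
        · rw [List.map_map]
          exact List.map_congr_left fun y hy => hb y (List.mem_range.1 hy)
      · rw [decide_eq_true_iff, BoundedFormula.realize_all]
        have e1 : (∀ x ∈ (List.range ((S.card + 1) ^ ((m + 1) * K))).map b, x = true) ↔
            ∀ y < (S.card + 1) ^ ((m + 1) * K),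
              φ.Realize default (Fin.snoc (decodeFun F S v m) (decode F S y)) := by
          simp only [List.mem_map, List.mem_range, forall_exists_index, and_imp,
            forall_apply_eq_imp_iff₂]
          exact forall₂_congr eb
        rw [e1]
        refine ⟨fun H => ?_, fun H y _ => H _⟩
        -- If a counterexample exists, `Auto.exists_mem_ball`, applied to the complement of the set
        -- defined by `φ`, gives one within the bounded range.
        by_contra! hne
        obtain ⟨a, ha⟩ := hne
        have hA := ((hM.auto_formula h φ).compl).reindex (Sum.elim (Sum.inl ∘ Sum.inl)
          (Fin.lastCases (Sum.inr ()) fun i => Sum.inl (Sum.inr i)) :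
            Empty ⊕ Fin (m + 1) → (Empty ⊕ Fin m) ⊕ Unit)
        have key : ∀ y : Unit → G, (Sum.elim (Sum.elim default (decodeFun F S v m) : Empty ⊕ Fin m → G) y ∈
            {w : (Empty ⊕ Fin m) ⊕ Unit → G | w ∘ (Sum.elim (Sum.inl ∘ Sum.inl)
              (Fin.lastCases (Sum.inr ()) fun i => Sum.inl (Sum.inr i)) :
                Empty ⊕ Fin (m + 1) → (Empty ⊕ Fin m) ⊕ Unit) ∈
                  {w : Empty ⊕ Fin (m + 1) → G | φ.Realize (w ∘ Sum.inl) (w ∘ Sum.inr)}ᶜ}) ↔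
            ¬ φ.Realize default (Fin.snoc (decodeFun F S v m) (y ())) := by
          intro y
          change ¬ φ.Realize _ _ ↔ _
          refine not_congr (iff_of_eq (congrArg₂ φ.Realize (Subsingleton.elim _ _) ?_))
          ext i
          refine Fin.lastCases ?_ (fun i => ?_) i <;> simp
        obtain ⟨y, hy, hyA⟩ := hA.exists_mem_ball h (ℓ := m * K) (by
          rintro (⟨⟨⟩⟩ | i)
          refine hball _ ?_
          rw [List.getD_eq_getElem _ _ (by omega)]
          exact List.getElem_mem _) ⟨fun _ => a, (key _).2 ha⟩
        -- The counterexample has at most `m * K + stateBound M (formulaRank φ) ≤ (m + 1) * K`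
        -- digits.
        obtain ⟨n, hn, e2⟩ := exists_decode_eq h (h.ball_mono (n := (m + 1) * K) (by
          rw [Nat.succ_mul]; omega) (hy ()))
        exact (key y).1 hyA (e2 ▸ H n hn)
  -- the decision procedure
  have hp : PrimrecPred fun k : ℕ => ev (stateBound M k) [] k = some true :=
    Primrec.eq.comp (hev.comp ((primrec_stateBound M).pair ((Primrec.const []).pair .id)))
      (.const _)
  refine hp.computablePred.of_eq fun k => ?_
  have hval : ∀ φ : L.Sentence, formulaCode cf cr φ = k →
      ∃ b, ev (stateBound M k) [] k = some b ∧ (b = true ↔ G ⊨ φ) := by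
    rintro φ rfl
    obtain ⟨b, hb, eb⟩ := formula_val (stateBound M (formulaCode cf cr φ)) 0 φ [] rfl (by simp)
      (stateBound_mono M (formulaRank_le φ))
    refine ⟨b, hb, eb.trans ?_⟩
    rw [Sentence.Realize, Formula.Realize, iff_iff_eq]
    congr 1
    exact Subsingleton.elim _ _
  constructor
  · intro hk
    obtain ⟨φ, hφ⟩ := formula_code _ _ _ _ hk 0 rfl
    obtain ⟨b, hb, eb⟩ := hval φ hφ
    rw [hk] at hb
    exact ⟨φ, hφ, eb.1 (Option.some.inj hb).symm⟩
  · rintro ⟨φ, hφ, hφG⟩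
    obtain ⟨b, hb, eb⟩ := hval φ hφ
    rw [hb, eb.2 hφG]

end Decidability

end FGamma
end

open scoped FirstOrder
noncomputable section
namespace FGamma

/-! ### Sparse sums `∑_{i ∈ X} Fⁱ s` -/

section Sparse

variable {G : Type u} [AddCommGroup G] {F : AddMonoid.End G} {S : Finset G}

variable (F) in
/-- `g ∈ Fⁿ(G)`. -/
def PowDvd (n : ℕ) (g : G) : Prop := ∃ c, g = (F ^ n) c

theorem PowDvd.mono {m n : ℕ} (hmn : m ≤ n) {g : G} (hg : PowDvd F n g) : PowDvd F m g := by
  obtain ⟨c, rfl⟩ := hg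
  obtain ⟨k, rfl⟩ := Nat.exists_eq_add_of_le hmn
  exact ⟨_, pow_add_apply _ _ _⟩

theorem PowDvd.sub {n : ℕ} {a b : G} (ha : PowDvd F n a) (hb : PowDvd F n b) :
    PowDvd F n (a - b) := by
  obtain ⟨a, rfl⟩ := ha
  obtain ⟨b, rfl⟩ := hb
  exact ⟨a - b, (map_sub _ _ _).symm⟩

theorem PowDvd.add {n : ℕ} {a b : G} (ha : PowDvd F n a) (hb : PowDvd F n b) :
    PowDvd F n (a + b) := by
  obtain ⟨a, rfl⟩ := ha
  obtain ⟨b, rfl⟩ := hb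
  exact ⟨a + b, (map_add _ _ _).symm⟩

/-- Distinct elements of `X` differ by at least `3`. -/
def Gap (X : Finset ℕ) : Prop := ∀ i ∈ X, ∀ j ∈ X, i < j → i + 3 ≤ j

variable (F) in
/-- The element `∑_{i ∈ X} Fⁱ s`. -/
def powSum (s : G) (X : Finset ℕ) : G := ∑ i ∈ X, (F ^ i) s

/-- The elements of `X` below `m`. -/
def below (X : Finset ℕ) (m : ℕ) : Finset ℕ := X.filter (· < m)

theorem below_eq_of_forall {X : Finset ℕ} {m n : ℕ} (hX : ∀ i ∈ X, (i < m ↔ i < n)) :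
    below X m = below X n :=
  Finset.filter_congr hX

theorem below_succ_of_mem {X : Finset ℕ} {m : ℕ} (hm : m ∈ X) :
    below X (m + 1) = insert m (below X m) := by
  ext i
  simp only [below, Finset.mem_filter, Finset.mem_insert]
  constructor
  · rintro ⟨hi, h⟩
    rcases Nat.lt_succ_iff_lt_or_eq.1 h with h | h
    exacts [Or.inr ⟨hi, h⟩, Or.inl h]
  · rintro (rfl | ⟨hi, h⟩)
    exacts [⟨hm, Nat.lt_succ_self _⟩, ⟨hi, h.trans (Nat.lt_succ_self _)⟩]

theorem below_succ_of_notMem {X : Finset ℕ} {m : ℕ} (hm : m ∉ X) : below X (m + 1) = below X m :=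
  below_eq_of_forall fun i hi => by
    have : i ≠ m := fun e => hm (e ▸ hi)
    omega

theorem powSum_below_succ (s : G) {X : Finset ℕ} {m : ℕ} (hm : m ∈ X) :
    powSum F s (below X (m + 1)) = powSum F s (below X m) + (F ^ m) s := by
  rw [below_succ_of_mem hm, powSum, Finset.sum_insert (by simp [below]), add_comm]
  rfl

theorem powDvd_powSum_sub (s : G) (X : Finset ℕ) (m : ℕ) :
    PowDvd F m (powSum F s X - powSum F s (below X m)) := by
  have : powSum F s X - powSum F s (below X m) = ∑ i ∈ X.filter (¬ · < m), (F ^ i) s := by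
    rw [sub_eq_iff_eq_add', powSum, powSum, below, Finset.sum_filter_add_sum_filter_not]
  rw [this]
  refine Finset.sum_induction _ (PowDvd F m) (fun _ _ => PowDvd.add) ⟨0, (map_zero _).symm⟩ ?_
  intro i hi
  exact PowDvd.mono (not_lt.1 (Finset.mem_filter.1 hi).2) ⟨s, rfl⟩

theorem add_pow_mem_ball {n : ℕ} {p s : G} (hp : p ∈ Ball F S n) (hs : s ∈ S) :
    p + (F ^ n) s ∈ Ball F S (n + 1) := by
  induction n generalizing p with
  | zero => simpa [Set.mem_singleton_iff.1 hp] using mem_ball_one hs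
  | succ n ih =>
    obtain ⟨a, ha, k, hk, rfl⟩ := hp
    exact ⟨a, ha, _, ih hk, by rw [map_add, pow_succ_apply', add_assoc]⟩

/-- Geometric sum: `z = b + F^d b + ⋯ + F^{dn} b` satisfies `(F^d - 1) z = F^{dn+d} b - b`, and by
hypothesis `F^d - 1` is injective. The sum of variable length thus becomes one equation in a single
exponent divisible by `d`. -/
theorem mem_K_iff {d : ℕ} (hd : ∀ x y : G, (F ^ d) x - x = (F ^ d) y - y → x = y) (b z : G) :
    z ∈ K b (F ^ d) ↔ ∃ i, d ∣ i ∧ (F ^ d) z + b = z + (F ^ (i + d)) b := by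
  have geom : ∀ n : ℕ, (F ^ d) (∑ j ∈ Finset.range (n + 1), ((F ^ d) ^ j) b) + b =
      (∑ j ∈ Finset.range (n + 1), ((F ^ d) ^ j) b) + (F ^ (d * n + d)) b := by
    intro n
    rw [map_sum, ← Nat.mul_succ, pow_mul, ← Finset.sum_range_succ,
      Finset.sum_range_succ' _ (n + 1), pow_zero, AddMonoid.End.coe_one, id]
    congr 1
    exact Finset.sum_congr rfl fun j _ => (pow_succ_apply' (F := F ^ d) j b).symm
  constructor
  · rintro ⟨n, rfl⟩
    exact ⟨d * n, dvd_mul_right _ _, geom n⟩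
  · rintro ⟨_, ⟨n, rfl⟩, hz⟩
    refine ⟨n, hd _ _ ?_⟩
    have := geom n
    rw [sub_eq_sub_iff_add_eq_add]
    have e1 : (F ^ d) z = z + (F ^ (d * n + d)) b - b := eq_sub_of_add_eq hz
    have e2 := eq_sub_of_add_eq this
    rw [e1, e2]
    abel

namespace IsSparseSpanning

variable (h : IsSparseSpanning F S)
include h

theorem powSum_below_mem_ball {s : G} (hs : s ∈ S) (X : Finset ℕ) (n : ℕ) :
    powSum F s (below X n) ∈ Ball F S n := by
  induction n with
  | zero => simp [below, powSum, Ball]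
  | succ n ih =>
    by_cases hn : n ∈ X
    · rw [powSum_below_succ s hn]
      exact add_pow_mem_ball ih hs
    · rw [below_succ_of_notMem hn]
      exact h.ball_succ_subset _ ih

theorem not_powDvd_pow {s : G} (hs : s ∈ S) (hs0 : s ≠ 0) (m : ℕ) :
    ¬ PowDvd F (m + 1) ((F ^ m) s) := by
  rintro ⟨c, hc⟩
  rw [pow_succ_apply] at hc
  exact hs0 (h.eq_zero s hs ⟨c, h.pow_inj m hc⟩)

/-- A short approximation of a sparse sum is a partial sum. -/
theorem eq_below_of_short {s : G} (hs : s ∈ S) (hs0 : s ≠ 0) {X : Finset ℕ} (hX : Gap X) {m : ℕ}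
    {p : G} (hp : p ∈ Ball F S (m - 2)) (hd : PowDvd F m (powSum F s X - p))
    (hd' : ¬ PowDvd F (m + 1) (powSum F s X - p)) : m ∈ X ∧ p = powSum F s (below X m) := by
  have hq : PowDvd F m (p - powSum F s (below X m)) := by
    have := (powDvd_powSum_sub (F := F) s X m).sub hd
    rwa [sub_sub_sub_cancel_left] at this
  have key : p = powSum F s (below X m) := by
    rcases m with _ | m
    · rw [show p = 0 from hp]
      simp [below, powSum]
    by_cases hm : m ∈ X
    · exfalso
      -- Suppose the position just under the cut, now called `m`, lies in `X`. By the gap, the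
      -- earlier terms have at most `m - 1` digits, like `p`, so they agree with `p`; but then `F ^
      -- (m + 1)` would divide the remaining term `Fᵐ s`.
      have e : below X m = below X (m + 1 - 2) := below_eq_of_forall fun i hi => by
        have := hX i hi m hm
        omega
      have hq' : p = powSum F s (below X (m + 1 - 2)) := by
        rcases m with _ | m
        · rw [show p = 0 from hp]
          simp [below, powSum]
        · obtain ⟨c, hc⟩ := (hq.mono (Nat.le_succ (m + 1))).add
            (⟨s, rfl⟩ : PowDvd F (m + 1) ((F ^ (m + 1)) s))
          refine h.eq_of_sub_eq hp (h.powSum_below_mem_ball hs X _) (c := c) ?_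
          rw [powSum_below_succ s hm, e] at hc
          simp only [Nat.reduceSubDiff, ← sub_sub, sub_add_cancel] at hc ⊢
          exact hc
      refine h.not_powDvd_pow hs hs0 m ?_
      have := hq
      rw [powSum_below_succ s hm, e, ← hq', sub_add_cancel_left] at this
      have h0 : PowDvd F (m + 1) (0 : G) := ⟨0, (map_zero _).symm⟩
      simpa using h0.sub this
    · rw [below_succ_of_notMem hm] at hq ⊢
      obtain ⟨c, hc⟩ := hq
      exact h.eq_of_sub_eq (h.ball_mono (by omega) hp) (h.powSum_below_mem_ball hs X m) hc
  refine ⟨?_, key⟩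
  by_contra hm
  apply hd'
  rw [key, ← below_succ_of_notMem hm]
  exact powDvd_powSum_sub s X (m + 1)

/-- The witness is the partial sum below `m`. Gaps of at least `3` give it at most `m - 2` digits,
as the criterion requires. The criterion refers to the sum only and not to `X`, so it is definable.
-/
theorem mem_iff_of_gap {s : G} (hs : s ∈ S) (hs0 : s ≠ 0) {X : Finset ℕ} (hX : Gap X) (m : ℕ) :
    m ∈ X ↔ ∃ p, p ∈ Ball F S (m - 2) ∧ PowDvd F m (powSum F s X - p) ∧
      ¬ PowDvd F (m + 1) (powSum F s X - p) := by
  constructor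
  · intro hm
    refine ⟨powSum F s (below X m), ?_, powDvd_powSum_sub s X m, ?_⟩
    · rw [below_eq_of_forall (n := m - 2) fun i hi => by
        have := hX i hi m hm
        omega]
      exact h.powSum_below_mem_ball hs X _
    · intro hd
      refine h.not_powDvd_pow hs hs0 m ?_
      have := hd.sub (powDvd_powSum_sub (F := F) s X (m + 1))
      rwa [powSum_below_succ s hm, sub_sub_sub_cancel_left, add_sub_cancel_left] at this
  · rintro ⟨p, hp, hd, hd'⟩
    exact (h.eq_below_of_short hs hs0 hX hp hd hd').1

/-- Greedy reading. Whenever a short approximation is exact up to `Fᵐ` and no further, the condition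
says that `Fᵐ s` is the next term and that the two positions after it are empty. Starting from `∅`
this collects `X`, and it stops because `g` has finitely many digits. -/
theorem exists_gap_iff {s : G} (hs : s ∈ S) (hs0 : s ≠ 0) (g : G) :
    (∃ X, Gap X ∧ g = powSum F s X) ↔
      ∀ m p, p ∈ Ball F S (m - 2) → PowDvd F m (g - p) → ¬ PowDvd F (m + 1) (g - p) →
        PowDvd F (m + 3) (g - p - (F ^ m) s) := by
  constructor
  · rintro ⟨X, hX, rfl⟩ m p hp hd hd'
    obtain ⟨hm, rfl⟩ := h.eq_below_of_short hs hs0 hX hp hd hd'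
    rw [sub_sub, ← powSum_below_succ s hm, below_eq_of_forall (n := m + 3) fun i hi => by
        have := hX m hm i hi
        omega]
    exact powDvd_powSum_sub s X _
  · intro H
    obtain ⟨N, hN⟩ := h.exists_mem_ball g
    have key : ∀ k m : ℕ, N + 1 ≤ m + k → ∀ X, Gap X → (∀ i ∈ X, i + 3 ≤ m) →
        PowDvd F m (g - powSum F s X) → ∃ X, Gap X ∧ g = powSum F s X := by
      intro k
      induction k with
      | zero =>
        intro m hm X hX hXm hd
        obtain ⟨m, rfl⟩ : ∃ l, m = l + 1 := ⟨m - 1, by omega⟩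
        have e : X = below X m := (Finset.filter_true_of_mem fun i hi => by
          have := hXm i hi
          omega).symm
        obtain ⟨c, hc⟩ := hd
        exact ⟨X, hX, h.eq_of_sub_eq (h.ball_mono (by omega) hN)
          (e ▸ h.powSum_below_mem_ball hs X m) hc⟩
      | succ k ih =>
        intro m hm X hX hXm hd
        by_cases hd' : PowDvd F (m + 1) (g - powSum F s X)
        · exact ih (m + 1) (by omega) X hX (fun i hi => (hXm i hi).trans (Nat.le_succ m)) hd'
        · have e : X = below X (m - 2) := (Finset.filter_true_of_mem fun i hi => by
            have := hXm i hi
            omega).symm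
          have hd3 := H m (powSum F s X) (e ▸ h.powSum_below_mem_ball hs X (m - 2)) hd hd'
          have hmX : m ∉ X := fun hmX => by
            have := hXm m hmX
            omega
          refine ih (m + 3) (by omega) (insert m X) ?_ ?_ ?_
          · intro i hi j hj hij
            rcases Finset.mem_insert.1 hi with rfl | hi' <;>
              rcases Finset.mem_insert.1 hj with rfl | hj'
            · omega
            · have := hXm j hj'
              omega
            · exact hXm i hi'
            · exact hX i hi' j hj' hij
          · intro i hi
            rcases Finset.mem_insert.1 hi with rfl | hi
            · exact le_rfl
            · exact (hXm i hi).trans (by omega)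
          · rw [powSum, Finset.sum_insert hmX, add_comm ((F ^ m) s), ← sub_sub]
            exact hd3
    exact key (N + 1) 0 (by omega) ∅ (by simp [Gap]) (by simp) ⟨g, by simp [powSum]⟩

theorem powSum_injOn {s : G} (hs : s ∈ S) (hs0 : s ≠ 0) {X Y : Finset ℕ} (hX : Gap X) (hY : Gap Y)
    (e : powSum F s X = powSum F s Y) : X = Y := by
  ext m
  rw [h.mem_iff_of_gap hs hs0 hX, e, ← h.mem_iff_of_gap hs hs0 hY]

end IsSparseSpanning

/-- A finite chain descending in steps of `D` can only end at `0`. The assumption `D ≥ 3` makes the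
multiples of `D` a set with gaps. -/
theorem dvd_iff_exists_gap {D : ℕ} (hD : 3 ≤ D) (i : ℕ) :
    D ∣ i ↔ ∃ X, Gap X ∧ i ∈ X ∧ ∀ j ∈ X, j = 0 ∨ ∃ k ∈ X, j = k + D := by
  constructor
  · rintro ⟨n, rfl⟩
    refine ⟨(Finset.range (n + 1)).image (D * ·), ?_, Finset.mem_image_of_mem _ (by simp), ?_⟩
    · intro i hi j hj hij
      obtain ⟨a, -, rfl⟩ := Finset.mem_image.1 hi
      obtain ⟨b, -, rfl⟩ := Finset.mem_image.1 hj
      have hab : a < b := lt_of_mul_lt_mul_left hij (Nat.zero_le D)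
      calc D * a + 3 ≤ D * a + D := by omega
        _ = D * (a + 1) := rfl
        _ ≤ D * b := Nat.mul_le_mul_left D hab
    · intro j hj
      obtain ⟨a, ha, rfl⟩ := Finset.mem_image.1 hj
      rcases a with _ | a
      · exact Or.inl rfl
      · exact Or.inr ⟨_, Finset.mem_image_of_mem _ (Finset.mem_range.2 (by
          have := Finset.mem_range.1 ha
          omega)), rfl⟩
  · rintro ⟨X, -, hi, H⟩
    induction i using Nat.strong_induction_on with
    | _ i ih =>
      rcases H i hi with rfl | ⟨k, hk, rfl⟩
      · exact dvd_zero D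
      · exact (ih k (by omega) hk).add (dvd_refl D)

/-- Replaces a modulus `d > 0` by `3 * d ≥ 3`, for which the multiples have the required gaps. -/
theorem dvd_iff_exists_lt_three (d i : ℕ) :
    d ∣ i ↔ ∃ r : Fin 3, ∃ j, 3 * d ∣ j ∧ i = j + d * r := by
  constructor
  · rintro ⟨n, rfl⟩
    refine ⟨⟨n % 3, Nat.mod_lt _ (by norm_num)⟩, 3 * d * (n / 3), dvd_mul_right _ _, ?_⟩
    conv_lhs => rw [← Nat.div_add_mod n 3]
    ring
  · rintro ⟨r, j, hj, rfl⟩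
    exact ((dvd_mul_left d 3).trans hj).add (dvd_mul_right _ _)

end Sparse

end FGamma
end

open scoped FirstOrder
noncomputable section
namespace FGamma

/-! ### Definable predicates and functions -/

section DefPred

variable {L : FirstOrder.Language.{0, u}} {M : Type u} [L.Structure M] {α : Type}

variable (L) in
/-- The predicate `P` on tuples is definable without parameters. -/
def DefPred (P : (α → M) → Prop) : Prop := (∅ : Set M).Definable L {v | P v}

variable (L) in
/-- The function `f` on tuples is definable without parameters. -/
def DefFun (f : (α → M) → M) : Prop := (∅ : Set M).DefinableFun L f

variable {P Q : (α → M) → Prop}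

theorem DefPred.congr (hP : DefPred L P) (e : ∀ v, Q v ↔ P v) : DefPred L Q := by
  rwa [show Q = P from funext fun v => propext (e v)]

theorem DefPred.and (hP : DefPred L P) (hQ : DefPred L Q) : DefPred L fun v => P v ∧ Q v :=
  Set.Definable.inter hP hQ

theorem DefPred.or (hP : DefPred L P) (hQ : DefPred L Q) : DefPred L fun v => P v ∨ Q v :=
  Set.Definable.union hP hQ

theorem DefPred.not (hP : DefPred L P) : DefPred L fun v => ¬ P v :=
  Set.Definable.compl hP

theorem DefPred.imp (hP : DefPred L P) (hQ : DefPred L Q) : DefPred L fun v => P v → Q v :=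
  (hP.not.or hQ).congr fun _ => imp_iff_not_or

theorem DefPred.const (p : Prop) : DefPred L fun _ : α → M => p := by
  by_cases hp : p
  · simp [DefPred, hp]
  · simp [DefPred, hp]

theorem DefPred.exists_finite {ι : Type*} [Finite ι] {P : ι → (α → M) → Prop}
    (hP : ∀ i, DefPred L (P i)) : DefPred L fun v => ∃ i, P i v := by
  have := Set.definable_iUnion_of_finite hP
  refine DefPred.congr (P := (· ∈ ⋃ i, {v | P i v})) this fun v => ?_
  simp

theorem DefPred.forall_finite {ι : Type*} [Finite ι] {P : ι → (α → M) → Prop}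
    (hP : ∀ i, DefPred L (P i)) : DefPred L fun v => ∀ i, P i v :=
  (DefPred.exists_finite fun i => (hP i).not).not.congr fun v => by simp

theorem DefPred.reindex {β : Type} {P : (β → M) → Prop} (hP : DefPred L P) (f : β → α) :
    DefPred L fun v : α → M => P fun b => v (f b) :=
  Set.Definable.preimage_comp f hP

theorem DefPred.exists_pi {β : Type} [Finite β] {P : (α → M) → (β → M) → Prop}
    (hP : DefPred L fun w : α ⊕ β → M => P (fun a => w (.inl a)) fun b => w (.inr b)) :
    DefPred L fun v => ∃ x, P v x :=
  Set.Definable.exists_of_finite hP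

theorem DefPred.ex {P : (α → M) → M → Prop}
    (hP : DefPred L fun w : Option α → M => P (fun a => w (some a)) (w none)) :
    DefPred L fun v => ∃ x, P v x := by
  refine (DefPred.exists_pi (β := Unit) (P := fun v x => P v (x ()))
    (hP.reindex fun a : Option α => a.elim (Sum.inr ()) Sum.inl)).congr fun v => ?_
  exact ⟨fun ⟨x, hx⟩ => ⟨fun _ => x, hx⟩, fun ⟨x, hx⟩ => ⟨x (), hx⟩⟩

theorem DefPred.all {P : (α → M) → M → Prop}
    (hP : DefPred L fun w : Option α → M => P (fun a => w (some a)) (w none)) :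
    DefPred L fun v => ∀ x, P v x :=
  (DefPred.ex (P := fun v x => ¬ P v x) hP.not).not.congr fun v => by simp

theorem DefPred.comp {β : Type} [Finite β] {P : (β → M) → Prop} (hP : DefPred L P)
    {g : β → (α → M) → M} (hg : ∀ b, DefFun L (g b)) : DefPred L fun v => P fun b => g b v :=
  Set.Definable.preimage_map (F := fun v b => g b v) hg hP

theorem DefPred.comp₂ {P : M → M → Prop} (hP : DefPred L fun v : Fin 2 → M => P (v 0) (v 1))
    {f g : (α → M) → M} (hf : DefFun L f) (hg : DefFun L g) : DefPred L fun v => P (f v) (g v) :=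
  hP.comp (g := ![f, g]) (Fin.forall_fin_two.2 ⟨hf, hg⟩)

theorem DefFun.var (a : α) : DefFun L fun v : α → M => v a :=
  Set.DefinableFun.proj L

theorem DefFun.comp {β : Type} [Finite β] {f : (β → M) → M} (hf : DefFun L f)
    {g : β → (α → M) → M} (hg : ∀ b, DefFun L (g b)) : DefFun L fun v => f fun b => g b v :=
  Set.DefinableFun.comp (g := fun v b => g b v) hg hf

theorem DefFun.of_graph {f : (α → M) → M}
    (hf : DefPred L fun w : Option α → M => w none = f fun a => w (some a)) : DefFun L f := by
  refine DefPred.congr hf fun w => ?_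
  exact eq_comm

theorem DefFun.reindex {β : Type} {f : (β → M) → M} (hf : DefFun L f) (g : β → α) :
    DefFun L fun v : α → M => f fun b => v (g b) :=
  DefPred.reindex hf (Option.map g)

theorem DefPred.eq {f g : (α → M) → M} (hf : DefFun L f) (hg : DefFun L g) :
    DefPred L fun v => f v = g v :=
  Set.DefinableFun.ofPred_eq hf hg

/-- A structure whose basic relations are definable in another structure with the same domain,
and that has no basic functions, is a definable reduct of it. -/
theorem definable_of_relational {L' : FirstOrder.Language.{0, u}} [L'.Structure M]
    (hfun : ∀ n, IsEmpty (L'.Functions n))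
    (hrel : ∀ (n : ℕ) (r : L'.Relations n), DefPred L fun v : Fin n → M =>
      FirstOrder.Language.Structure.RelMap r v)
    {A : Set (α → M)} (hA : (∅ : Set M).Definable L' A) :
    (∅ : Set M).Definable L A := by
  have hterm : ∀ {β : Type} (t : L'.Term β), ∃ b, ∀ v : β → M, t.realize v = v b := by
    intro β t
    cases t with
    | var b => exact ⟨b, fun _ => rfl⟩
    | func f => exact (hfun _).elim f
  have key : ∀ {n : ℕ} (φ : L'.BoundedFormula α n), DefPred L fun w : α ⊕ Fin n → M =>
      φ.Realize (fun a => w (.inl a)) fun i => w (.inr i) := by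
    intro n φ
    induction φ with
    | falsum => exact (DefPred.const False).congr fun _ => Iff.rfl
    | equal t₁ t₂ =>
      obtain ⟨b₁, e₁⟩ := hterm t₁
      obtain ⟨b₂, e₂⟩ := hterm t₂
      refine (DefPred.eq (.var b₁) (.var b₂)).congr fun w => ?_
      change t₁.realize _ = t₂.realize _ ↔ _
      rw [e₁, e₂]
      rcases b₁ with _ | _ <;> rcases b₂ with _ | _ <;> rfl
    | rel r ts =>
      choose b e using fun i => hterm (ts i)
      refine ((hrel _ r).reindex b).congr fun w => ?_
      change FirstOrder.Language.Structure.RelMap r _ ↔ _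
      refine iff_of_eq (congrArg _ (funext fun i => ?_))
      rw [e]
      rcases b i with _ | _ <;> rfl
    | imp φ ψ ih₁ ih₂ => exact ih₁.imp ih₂
    | @all n φ ih =>
      refine (DefPred.all (P := fun (w : α ⊕ Fin n → M) x =>
        φ.Realize (fun a => w (.inl a)) (Fin.snoc (fun i => w (.inr i)) x))
        ((ih.reindex (Sum.elim (fun a => some (.inl a))
          (Fin.lastCases none fun i => some (.inr i)))).congr fun w => ?_)).congr fun w => Iff.rfl
      refine iff_of_eq (congrArg (φ.Realize _) (funext fun i => ?_))
      refine Fin.lastCases ?_ (fun i => ?_) i <;> simp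
  obtain ⟨φ, rfl⟩ := Set.empty_definable_iff.1 hA
  refine ((key φ).reindex (Sum.elim id Fin.elim0 : α ⊕ Fin 0 → α)).congr fun v => ?_
  exact iff_of_eq (congrArg (FirstOrder.Language.BoundedFormula.Realize φ v)
    (Subsingleton.elim (default : Fin 0 → M) _))

end DefPred

/-! ### Structures that define base-`F` arithmetic -/

section Expressive

variable {G : Type u} [AddCommGroup G]

/-- The structure defines, without parameters, the operations `+` and `F`, and the relations
`g ∈ Fⁿ(G)`, `g ∈ Ball n` and `g = Fⁿ s`, where `n` is represented by `Fⁿ a`. -/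
structure IsExpressive (F : AddMonoid.End G) (S : Finset G) (L : FirstOrder.Language.{0, u})
    [L.Structure G] (a : G) : Prop where
  mem : a ∈ S
  ne_zero : a ≠ 0
  add : DefFun L fun v : Fin 2 → G => v 0 + v 1
  map : DefFun L fun v : Fin 1 → G => F (v 0)
  powDvd : DefPred L fun v : Fin 2 → G => ∃ n, v 0 = (F ^ n) a ∧ PowDvd F n (v 1)
  ball : DefPred L fun v : Fin 2 → G => ∃ n, v 0 = (F ^ n) a ∧ v 1 ∈ Ball F S n
  pow : ∀ s ∈ S, s ≠ 0 → DefPred L fun v : Fin 2 → G => ∃ n, v 0 = (F ^ n) a ∧ v 1 = (F ^ n) s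

open Classical in
/-- The number represented by `u`: `n` if `u = Fⁿ a`, and `0` if there is no such `n`. -/
def index (F : AddMonoid.End G) (a u : G) : ℕ := if h : ∃ n : ℕ, u = (F ^ n) a then h.choose else 0

open Classical in
/-- The set represented by `x`: the finite set `X` with gaps such that `x = ∑_{i ∈ X} Fⁱ a`, and
`∅` if there is no such `X`. -/
def support (F : AddMonoid.End G) (a x : G) : Finset ℕ :=
  if h : ∃ X : Finset ℕ, Gap X ∧ x = powSum F a X then h.choose else ∅

theorem gap_support (F : AddMonoid.End G) (a x : G) : Gap (support F a x) := by
  unfold support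
  split_ifs with h
  · exact h.choose_spec.1
  · simp [Gap]

variable {F : AddMonoid.End G} {S : Finset G}

section

variable (h : IsSparseSpanning F S) {a : G} (ha : a ∈ S) (ha0 : a ≠ 0)
include h ha ha0

theorem index_pow (n : ℕ) : index F a ((F ^ n) a) = n := by
  have hex : ∃ m : ℕ, (F ^ n) a = (F ^ m) a := ⟨n, rfl⟩
  rw [index, dif_pos hex]
  exact (h.pow_apply_eq_pow_apply ha ha ha0 ha0 hex.choose_spec).1.symm

theorem support_powSum {X : Finset ℕ} (hX : Gap X) : support F a (powSum F a X) = X := by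
  have hex : ∃ Y : Finset ℕ, Gap Y ∧ powSum F a X = powSum F a Y := ⟨X, hX, rfl⟩
  rw [support, dif_pos hex]
  exact (h.powSum_injOn ha ha0 hX hex.choose_spec.1 hex.choose_spec.2).symm

/-- Quantifiers over numbers become quantifiers over elements. The default value of `index` does no
harm, being itself a number; likewise the default `∅` of `support` has gaps. -/
theorem exists_index_iff {P : ℕ → Prop} : (∃ n, P n) ↔ ∃ u, P (index F a u) :=
  ⟨fun ⟨n, hn⟩ => ⟨(F ^ n) a, by rwa [index_pow h ha ha0]⟩, fun ⟨_, hu⟩ => ⟨_, hu⟩⟩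

theorem exists_support_iff {P : Finset ℕ → Prop} :
    (∃ X, Gap X ∧ P X) ↔ ∃ x, P (support F a x) :=
  ⟨fun ⟨X, hX, hP⟩ => ⟨powSum F a X, by rwa [support_powSum h ha ha0 hX]⟩,
    fun ⟨x, hx⟩ => ⟨_, gap_support F a x, hx⟩⟩

end

variable (F) in
/-- The function `f` with values in `ℕ` is definable, `n` being represented by `Fⁿ a`. -/
def DefNum (L : FirstOrder.Language.{0, u}) [L.Structure G] (a : G) {α : Type}
    (f : (α → G) → ℕ) : Prop := DefFun L fun v => (F ^ f v) a

namespace IsExpressive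

variable {L : FirstOrder.Language.{0, u}} [L.Structure G] {a : G} (E : IsExpressive F S L a)
  {α : Type} {f g : (α → G) → G} {p q : (α → G) → ℕ}

include E

theorem defFun_add (hf : DefFun L f) (hg : DefFun L g) : DefFun L fun v => f v + g v :=
  E.add.comp (g := ![f, g]) (Fin.forall_fin_two.2 ⟨hf, hg⟩)

theorem defFun_map (hf : DefFun L f) : DefFun L fun v => F (f v) :=
  E.map.comp (g := fun _ => f) fun _ => hf

theorem defFun_pow_map (hf : DefFun L f) (n : ℕ) : DefFun L fun v => (F ^ n) (f v) := by
  induction n with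
  | zero => simpa using hf
  | succ n ih =>
    simp only [pow_succ_apply']
    exact E.defFun_map ih

theorem defFun_zero : DefFun L fun _ : α → G => (0 : G) := by
  refine DefFun.of_graph ((DefPred.eq (E.defFun_add (.var none) (.var none))
    (.var none)).congr fun w => ?_)
  simp

theorem defFun_neg (hf : DefFun L f) : DefFun L fun v => -f v := by
  have hn : DefFun L fun v : Fin 1 → G => -v 0 := by
    refine DefFun.of_graph ((DefPred.eq (E.defFun_add (.var none) (.var (some 0)))
      E.defFun_zero).congr fun w => ?_)
    exact eq_neg_iff_add_eq_zero
  exact hn.comp (g := fun _ => f) fun _ => hf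

theorem defFun_sub (hf : DefFun L f) (hg : DefFun L g) : DefFun L fun v => f v - g v := by
  simp only [sub_eq_add_neg]
  exact E.defFun_add hf (E.defFun_neg hg)

theorem defFun_sum {ι : Type*} {f : ι → (α → G) → G} (hf : ∀ i, DefFun L (f i)) (s : Finset ι) :
    DefFun L fun v => ∑ i ∈ s, f i v := by
  classical
  induction s using Finset.induction_on with
  | empty => simpa using E.defFun_zero
  | insert i s hi ih =>
    simp only [Finset.sum_insert hi]
    exact E.defFun_add (hf i) ih

theorem defNum_add (hp : DefNum F L a p) (k : ℕ) : DefNum F L a fun v => p v + k := by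
  simp only [DefNum, add_comm _ k, pow_add_apply]
  exact E.defFun_pow_map hp k

theorem defPred_isPow (hf : DefFun L f) : DefPred L fun v => ∃ n, f v = (F ^ n) a :=
  (DefPred.comp₂ (P := fun u g => ∃ n, u = (F ^ n) a ∧ PowDvd F n g) E.powDvd hf hf).congr
    fun _ => ⟨fun ⟨n, hn⟩ => ⟨n, hn, a, hn⟩, fun ⟨n, hn, _⟩ => ⟨n, hn⟩⟩

section

variable (h : IsSparseSpanning F S)
include h

theorem defPred_powDvd (hp : DefNum F L a p) (hf : DefFun L f) :
    DefPred L fun v => PowDvd F (p v) (f v) := by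
  refine (DefPred.comp₂ (P := fun u g => ∃ n, u = (F ^ n) a ∧ PowDvd F n g)
    E.powDvd hp hf).congr fun v => ⟨fun hd => ⟨_, rfl, hd⟩, ?_⟩
  rintro ⟨n, e, hd⟩
  rwa [(h.pow_apply_eq_pow_apply E.mem E.mem E.ne_zero E.ne_zero e).1]

theorem defPred_ball (hp : DefNum F L a p) (hf : DefFun L f) :
    DefPred L fun v => f v ∈ Ball F S (p v) := by
  refine (DefPred.comp₂ (P := fun u g => ∃ n, u = (F ^ n) a ∧ g ∈ Ball F S n)
    E.ball hp hf).congr fun v => ⟨fun hd => ⟨_, rfl, hd⟩, ?_⟩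
  rintro ⟨n, e, hd⟩
  rwa [(h.pow_apply_eq_pow_apply E.mem E.mem E.ne_zero E.ne_zero e).1]

theorem defPred_num_eq (hp : DefNum F L a p) (hq : DefNum F L a q) :
    DefPred L fun v => p v = q v :=
  (DefPred.eq hp hq).congr fun _ =>
    ⟨fun e => by rw [e], fun e => (h.pow_apply_eq_pow_apply E.mem E.mem E.ne_zero E.ne_zero e).1⟩

/-- `F⁰ a = a` is the only element of the orbit of `a` that is not the image under `F` of another
element of the orbit. -/
theorem defNum_zero : DefNum F L a fun _ : α → G => 0 := by
  have hD : DefPred L fun w : Option α → G => ∃ x, (∃ n, x = (F ^ n) a) ∧ w none = F x :=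
    .ex ((E.defPred_isPow (.var none)).and
      (DefPred.eq (.var (some none)) (E.defFun_map (.var none))))
  refine DefFun.of_graph (((E.defPred_isPow (.var none)).and hD.not).congr fun w => ?_)
  constructor
  · intro e
    refine ⟨⟨0, e⟩, ?_⟩
    rintro ⟨_, ⟨n, rfl⟩, hn⟩
    rw [e, ← pow_succ_apply'] at hn
    have : 0 = n + 1 := (h.pow_apply_eq_pow_apply E.mem E.mem E.ne_zero E.ne_zero hn).1
    omega
  · rintro ⟨⟨n, hn⟩, H⟩
    rcases n with _ | n
    · exact hn
    · exact absurd ⟨_, ⟨n, rfl⟩, hn.trans (pow_succ_apply' _ _)⟩ H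

theorem defNum_index (i : α) : DefNum F L a fun v : α → G => index F a (v i) := by
  refine DefFun.of_graph ((((E.defPred_isPow (.var (some i))).and
    (DefPred.eq (.var none) (.var (some i)))).or
    ((E.defPred_isPow (.var (some i))).not.and
      (DefPred.eq (.var none) (E.defNum_zero h)))).congr fun w => ?_)
  by_cases hw : ∃ n : ℕ, w (some i) = (F ^ n) a
  · obtain ⟨n, hn⟩ := hw
    have hex : ∃ m : ℕ, (F ^ n) a = (F ^ m) a := ⟨n, rfl⟩
    simp only [hn, index_pow h E.mem E.ne_zero, hex, true_and, not_true, false_and, or_false]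
  · have e : index F a (w (some i)) = 0 := dif_neg hw
    simp only [e, hw, not_false_iff, true_and, false_and, false_or]

theorem defPred_exists_num {P : (α → G) → ℕ → Prop}
    (hP : DefPred L fun w : Option α → G => P (fun i => w (some i)) (index F a (w none))) :
    DefPred L fun v => ∃ n, P v n :=
  (DefPred.ex (P := fun v x => P v (index F a x)) hP).congr fun _ =>
    exists_index_iff h E.mem E.ne_zero

theorem defPred_forall_num {P : (α → G) → ℕ → Prop}
    (hP : DefPred L fun w : Option α → G => P (fun i => w (some i)) (index F a (w none))) :
    DefPred L fun v => ∀ n, P v n :=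
  (E.defPred_exists_num h (P := fun v n => ¬ P v n) hP.not).not.congr fun v => by simp

theorem defPred_exists_gap {P : (α → G) → Finset ℕ → Prop}
    (hP : DefPred L fun w : Option α → G => P (fun i => w (some i)) (support F a (w none))) :
    DefPred L fun v => ∃ X, Gap X ∧ P v X :=
  (DefPred.ex (P := fun v x => P v (support F a x)) hP).congr fun _ =>
    exists_support_iff h E.mem E.ne_zero

theorem defFun_pow_letter (hp : DefNum F L a p) {s : G} (hs : s ∈ S) :
    DefFun L fun v => (F ^ p v) s := by
  by_cases hs0 : s = 0
  · simpa [hs0] using E.defFun_zero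
  refine DefFun.of_graph ((DefPred.comp₂ (P := fun u g => ∃ n, u = (F ^ n) a ∧ g = (F ^ n) s)
    (E.pow s hs hs0) (f := fun w => (F ^ p fun i => w (some i)) a) (DefFun.reindex hp some)
    (.var none)).congr fun w => ⟨fun e => ⟨_, rfl, e⟩, ?_⟩)
  rintro ⟨n, e, hd⟩
  rwa [(h.pow_apply_eq_pow_apply E.mem E.mem E.ne_zero E.ne_zero e).1]

/-- Induction on the number of digits of `t`, since `Fⁿ(s + F t) = Fⁿ s + F(Fⁿ t)`. -/
theorem defFun_pow_const (hp : DefNum F L a p) (t : G) : DefFun L fun v => (F ^ p v) t := by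
  obtain ⟨n, hn⟩ := h.exists_mem_ball t
  induction n generalizing t with
  | zero => simpa [Set.mem_singleton_iff.1 hn] using E.defFun_zero
  | succ n ih =>
    obtain ⟨s, hs, t, ht, rfl⟩ := hn
    simp only [map_add, ← pow_succ_apply (F := F), pow_succ_apply' (F := F)]
    exact E.defFun_add (E.defFun_pow_letter h hp hs) (E.defFun_map (ih t ht))

theorem defFun_const (t : G) : DefFun L fun _ : α → G => t := by
  simpa using E.defFun_pow_const h (E.defNum_zero h (α := α)) t

theorem defPred_exists_ball {P : (α → G) → G → Prop} (hp : DefNum F L a p)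
    (hP : DefPred L fun w : Option α → G => P (fun i => w (some i)) (w none)) :
    DefPred L fun v => ∃ x, x ∈ Ball F S (p v - 2) ∧ P v x := by
  -- Truncated subtraction: for `p v < 2` the ball is `{0}`, which the second alternative provides.
  have hball : DefPred L fun w : Option α → G =>
      (∃ n, n + 2 = (p fun i => w (some i)) ∧ w none ∈ Ball F S n) ∨ w none = 0 :=
    .or (E.defPred_exists_num h ((E.defPred_num_eq h
      (E.defNum_add (E.defNum_index h none) 2) (hp.reindex (some ∘ some))).and
        (E.defPred_ball h (E.defNum_index h none) (.var (some none)))))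
      (DefPred.eq (.var none) E.defFun_zero)
  refine (DefPred.ex (P := fun v x => ((∃ n, n + 2 = p v ∧ x ∈ Ball F S n) ∨ x = 0) ∧ P v x)
    (hball.and hP)).congr fun v => exists_congr fun x => and_congr_left fun _ => ?_
  constructor
  · intro hx
    rcases Nat.lt_or_ge (p v) 2 with h2 | h2
    · rw [Nat.sub_eq_zero_of_le h2.le] at hx
      exact Or.inr hx
    · exact Or.inl ⟨p v - 2, by omega, hx⟩
  · rintro (⟨n, hn, hx⟩ | rfl)
    · rwa [← hn]
    · exact h.zero_mem_ball _

theorem defPred_forall_ball {P : (α → G) → G → Prop} (hp : DefNum F L a p)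
    (hP : DefPred L fun w : Option α → G => P (fun i => w (some i)) (w none)) :
    DefPred L fun v => ∀ x, x ∈ Ball F S (p v - 2) → P v x :=
  (E.defPred_exists_ball h (P := fun v x => ¬ P v x) hp hP.not).not.congr fun v => by simp

theorem defPred_exists_powSum {s : G} (hs : s ∈ S) (hs0 : s ≠ 0) (hf : DefFun L f) :
    DefPred L fun v => ∃ X, Gap X ∧ f v = powSum F s X := by
  simp only [h.exists_gap_iff hs hs0]
  have hm := E.defNum_index h (α := Option (Option α)) (some none)
  have hd := E.defFun_sub (hf.reindex (α := Option (Option α)) (some ∘ some)) (.var none)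
  exact E.defPred_forall_num h <| E.defPred_forall_ball h (E.defNum_index h none) <|
    (E.defPred_powDvd h hm hd).imp <| (E.defPred_powDvd h (E.defNum_add hm 1) hd).not.imp <|
      E.defPred_powDvd h (E.defNum_add hm 3) (E.defFun_sub hd (E.defFun_pow_letter h hm hs))

/-- The predicate that expresses `n ∈ X` in terms of `∑_{i ∈ X} Fⁱ s`. -/
theorem defPred_position (hp : DefNum F L a p) (hf : DefFun L f) :
    DefPred L fun v => ∃ x, x ∈ Ball F S (p v - 2) ∧ PowDvd F (p v) (f v - x) ∧
      ¬ PowDvd F (p v + 1) (f v - x) := by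
  have hm : DefNum F L a fun w : Option α → G => p fun i => w (some i) := hp.reindex some
  have hd : DefFun L fun w : Option α → G => f (fun i => w (some i)) - w none :=
    E.defFun_sub (hf.reindex some) (.var none)
  exact E.defPred_exists_ball h hp <| (E.defPred_powDvd h hm hd).and
    (E.defPred_powDvd h (E.defNum_add hm 1) hd).not

theorem defPred_mem_support (hp : DefNum F L a p) (hf : DefFun L f) :
    DefPred L fun v => p v ∈ support F a (f v) := by
  refine ((E.defPred_exists_powSum h E.mem E.ne_zero hf).and (E.defPred_position h hp hf)).congr
    fun v => ?_
  by_cases hv : ∃ X, Gap X ∧ f v = powSum F a X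
  · obtain ⟨X, hX, e⟩ := hv
    rw [e, support_powSum h E.mem E.ne_zero hX, ← h.mem_iff_of_gap E.mem E.ne_zero hX]
    exact (and_iff_right ⟨X, hX, rfl⟩).symm
  · rw [support, dif_neg hv]
    simp [hv]

/-- Changes the coefficient while keeping `X`. For a nonzero letter `s`, the value is the unique
sparse sum with coefficient `s` that has the same positions as the given one; other `t` are treated
digit by digit. -/
theorem defFun_powSum (hf : DefFun L f) (t : G) :
    DefFun L fun v => powSum F t (support F a (f v)) := by
  obtain ⟨n, hn⟩ := h.exists_mem_ball t
  induction n generalizing t with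
  | zero => simpa [Set.mem_singleton_iff.1 hn, powSum] using E.defFun_zero
  | succ n ih =>
    obtain ⟨s, hs, t, ht, rfl⟩ := hn
    have e : ∀ X, powSum F (s + F t) X = powSum F s X + F (powSum F t X) := by
      intro X
      simp only [powSum, map_add, Finset.sum_add_distrib, map_sum, ← pow_succ_apply (F := F),
        pow_succ_apply' (F := F)]
    simp only [e]
    refine E.defFun_add ?_ (E.defFun_map (ih t ht))
    by_cases hs0 : s = 0
    · simpa [hs0, powSum] using E.defFun_zero
    have hg : DefFun L fun w : Option (Option α) → G => f fun i => w (some (some i)) :=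
      hf.reindex (some ∘ some)
    have hm := E.defNum_index h (α := Option (Option α)) none
    have h1 : DefPred L fun w : Option α → G => ∀ m, (m ∈ support F a (f fun i => w (some i))) ↔
        ∃ x, x ∈ Ball F S (m - 2) ∧ PowDvd F m (w none - x) ∧ ¬ PowDvd F (m + 1) (w none - x) := by
      refine E.defPred_forall_num h ?_
      have h2 := E.defPred_mem_support h hm hg
      have h3 := E.defPred_position h hm (.var (some none))
      exact ((h2.imp h3).and (h3.imp h2)).congr fun w => iff_iff_implies_and_implies
    refine DefFun.of_graph (((E.defPred_exists_powSum h hs hs0 (.var none)).and h1).congr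
      fun w => ?_)
    constructor
    · intro e
      rw [e]
      exact ⟨⟨_, gap_support F a _, rfl⟩, h.mem_iff_of_gap hs hs0 (gap_support F a _)⟩
    · rintro ⟨⟨X, hX, e⟩, H⟩
      rw [e] at H ⊢
      congr 1
      ext m
      rw [H, ← h.mem_iff_of_gap hs hs0 hX]

theorem defPred_exists_forall_powSum {n : ℕ} {f : Fin n → (α → G) → G} (hf : ∀ i, DefFun L (f i))
    (t : Fin n → G) : DefPred L fun v => ∃ X, Gap X ∧ ∀ i, f i v = powSum F (t i) X :=
  E.defPred_exists_gap h <| .forall_finite fun i =>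
    DefPred.eq ((hf i).reindex some) (E.defFun_powSum h (.var none) (t i))

theorem defPred_dvd_of_le {D : ℕ} (hD : 3 ≤ D) (hp : DefNum F L a p) :
    DefPred L fun v => D ∣ p v := by
  simp only [dvd_iff_exists_gap hD]
  refine E.defPred_exists_gap h ((E.defPred_mem_support h (hp.reindex some) (.var none)).and
    (E.defPred_forall_num h ((E.defPred_mem_support h (E.defNum_index h none)
      (.var (some none))).imp ((E.defPred_num_eq h (E.defNum_index h none) (E.defNum_zero h)).or
        (E.defPred_exists_num h ((E.defPred_mem_support h (E.defNum_index h none)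
          (.var (some (some none)))).and (E.defPred_num_eq h (E.defNum_index h (some none))
            (E.defNum_add (E.defNum_index h none) D))))))))

theorem defPred_dvd {d : ℕ} (hd : 0 < d) (hp : DefNum F L a p) : DefPred L fun v => d ∣ p v := by
  simp only [dvd_iff_exists_lt_three d]
  exact .exists_finite fun r => E.defPred_exists_num h
    ((E.defPred_dvd_of_le h (by omega) (E.defNum_index h none)).and
      (E.defPred_num_eq h (hp.reindex some) (E.defNum_add (E.defNum_index h none) (d * r))))

theorem defPred_mem_K {n d : ℕ} (hd : 0 < d) {f : Fin n → (α → G) → G}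
    (hf : ∀ i, DefFun L (f i)) (b : Fin n → G) :
    DefPred L fun v => ∃ i, d ∣ i ∧
      ∀ c, (F ^ d) (f c v) + b c = f c v + (F ^ (i + d)) (b c) :=
  E.defPred_exists_num h ((E.defPred_dvd h hd (E.defNum_index h none)).and
    (.forall_finite fun c => DefPred.eq
      (E.defFun_add (E.defFun_pow_map ((hf c).reindex some) d) (E.defFun_const h (b c)))
      (E.defFun_add ((hf c).reindex some)
        (E.defFun_pow_const h (E.defNum_add (E.defNum_index h none) d) (b c)))))

end

end IsExpressive

end Expressive

end FGamma
end

open scoped FirstOrder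
noncomputable section
namespace FGamma

/-! ### Definability in `Γ_V` -/

section Definability

variable {G : Type u} [AddCommGroup G] {F : AddMonoid.End G} {S S₀ : Finset G}

/-- The lowest term of `g ≠ 0` is `F^m b` with `b ∉ F(G)`, and this `m` is the largest power of `F`
that divides `g`. -/
theorem preceq_V_iff (h : IsSparseSpanning F S) (hS₀ : IsTransversal F S S₀) {a : G} (ha : a ∈ S)
    (ha0 : a ≠ 0) (i : ℕ) (g : G) : Preceq F S ((F ^ i) a) (V F S S₀ g) ↔ PowDvd F i g := by
  by_cases hg : g = 0
  · subst hg
    rw [V_zero]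
    exact ⟨fun _ => ⟨0, (map_zero _).symm⟩, fun _ => Or.inr (Or.inl ⟨⟨a, ha, ha0, i, rfl⟩, rfl⟩)⟩
  obtain ⟨m, b, w, hb, hb0, -, e, eV⟩ := isLowestTerm_V h.span h.eq_zero hS₀ hg
  rw [eV]
  have hbS := hS₀.subset hb
  constructor
  · rintro (⟨i', j, a', ha', b', hb', ha0', hb0', e1, e2, hij⟩ | ⟨-, e0⟩ | ⟨-, e0⟩)
    · obtain ⟨rfl, -⟩ := h.pow_apply_eq_pow_apply ha ha' ha0 ha0' e1
      obtain ⟨rfl, -⟩ := h.pow_apply_eq_pow_apply hbS hb' hb0 hb0' e2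
      exact PowDvd.mono hij ⟨_, e⟩
    all_goals exact absurd (h.pow_inj m (e0.trans (map_zero _).symm)) hb0
  · rintro ⟨c, hc⟩
    refine Or.inl ⟨i, m, a, ha, b, hbS, ha0, hb0, rfl, rfl, ?_⟩
    by_contra! hlt
    obtain ⟨k, rfl⟩ := Nat.exists_eq_add_of_lt hlt
    rw [e, add_assoc, pow_add_apply, pow_succ_apply'] at hc
    have hc := h.pow_inj m hc
    refine hb0 (h.eq_zero b hbS ⟨(F ^ k) c - eval F w, ?_⟩)
    rw [map_sub, ← hc, eval, add_sub_cancel_right]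

/-- After trailing zeros are removed, `R` yields the position of the last letter. A last position
`n` means length `n + 1`, which explains `F y` in place of `y`. -/
theorem mem_ball_iff_exists_R (h : IsSparseSpanning F S) {a : G} (ha : a ∈ S) (ha0 : a ≠ 0)
    (i : ℕ) (g : G) :
    g ∈ Ball F S i ↔ g = 0 ∨ ∃ y, R F S g y ∧ y ≠ 0 ∧ Preceq F S (F y) ((F ^ i) a) := by
  constructor
  · intro hg
    by_cases hg0 : g = 0
    · exact Or.inl hg0
    refine Or.inr ?_
    obtain ⟨w, hw, rfl, rfl⟩ := mem_ball_iff.1 hg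
    clear hg
    induction w using List.reverseRecOn with
    | nil => exact absurd rfl hg0
    | append_singleton w s ih =>
      have hw' : IsWord S w := fun x hx => hw x (List.mem_append_left _ hx)
      have hs : s ∈ S := hw s (by simp)
      by_cases hs0 : s = 0
      · have e : ∀ w : List G, eval F (w ++ [s]) = eval F w := by
          intro w
          induction w with
          | nil => simp [eval, hs0]
          | cons x w ih => simp only [List.cons_append, eval, ih]
        rw [e] at hg0 ⊢
        obtain ⟨y, hy, hy0, hp⟩ := ih hw' hg0
        refine ⟨y, hy, hy0, ?_⟩
        rcases hp with ⟨j, k, b, hb, c, hc, hb0, hc0, e1, e2, hjk⟩ | ⟨-, e0⟩ | ⟨-, e0⟩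
        · obtain ⟨rfl, -⟩ := h.pow_apply_eq_pow_apply ha hc ha0 hc0 e2
          exact Or.inl ⟨j, _, b, hb, a, ha, hb0, ha0, e1, rfl, hjk.trans (by simp)⟩
        all_goals exact absurd (h.pow_inj _ (e0.trans (map_zero _).symm)) ha0
      · refine ⟨(F ^ w.length) s, Or.inl ⟨w, s, hs, hw', hs0, rfl, rfl⟩, fun e0 =>
          hs0 (h.pow_inj _ (e0.trans (map_zero _).symm)), Or.inl ⟨w.length + 1, _, s, hs, a, ha,
          hs0, ha0, (pow_succ_apply' _ _).symm, rfl, by simp⟩⟩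
  · rintro (rfl | ⟨y, ⟨w, s, hs, hw, hs0, rfl, rfl⟩ | ⟨-, rfl⟩, hy0, hp⟩)
    · exact h.zero_mem_ball i
    · rw [← pow_succ_apply'] at hp
      rcases hp with ⟨j, k, b, hb, c, hc, hb0, hc0, e1, e2, hjk⟩ | ⟨-, e0⟩ | ⟨-, e0⟩
      · obtain ⟨rfl, -⟩ := h.pow_apply_eq_pow_apply ha hc ha0 hc0 e2
        obtain ⟨rfl, -⟩ := h.pow_apply_eq_pow_apply hs hb hs0 hb0 e1
        refine h.ball_mono hjk (mem_ball_iff.2 ⟨w ++ [s], ?_, by simp, rfl⟩)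
        intro x hx
        rcases List.mem_append.1 hx with hx | hx
        · exact hw x hx
        · rwa [List.mem_singleton.1 hx]
      all_goals exact absurd (h.pow_inj _ (e0.trans (map_zero _).symm)) ha0
    · exact absurd rfl hy0

/-- The exponents agree exactly when the two elements are below each other in the preorder. -/
theorem exists_pow_eq_iff (h : IsSparseSpanning F S) {a s : G} (ha : a ∈ S) (ha0 : a ≠ 0)
    (hs : s ∈ S) (hs0 : s ≠ 0) (x y : G) : (∃ n : ℕ, x = (F ^ n) a ∧ y = (F ^ n) s) ↔
      (x ∈ orbit F a ∧ y ∈ orbit F s) ∧ Preceq F S x y ∧ Preceq F S y x := by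
  constructor
  · rintro ⟨n, rfl, rfl⟩
    exact ⟨⟨⟨n, rfl⟩, n, rfl⟩, Or.inl ⟨n, n, a, ha, s, hs, ha0, hs0, rfl, rfl, le_rfl⟩,
      Or.inl ⟨n, n, s, hs, a, ha, hs0, ha0, rfl, rfl, le_rfl⟩⟩
  · have key : ∀ {a s : G} {m n : ℕ}, a ∈ S → a ≠ 0 → s ∈ S → s ≠ 0 →
        Preceq F S ((F ^ m) a) ((F ^ n) s) → m ≤ n := by
      rintro a s m n ha ha0 hs hs0
        (⟨j, k, b, hb, c, hc, hb0, hc0, e1, e2, hjk⟩ | ⟨-, e0⟩ | ⟨-, e0⟩)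
      · rwa [(h.pow_apply_eq_pow_apply ha hb ha0 hb0 e1).1,
          (h.pow_apply_eq_pow_apply hs hc hs0 hc0 e2).1]
      all_goals exact absurd (h.pow_inj _ (e0.trans (map_zero _).symm)) hs0
    rintro ⟨⟨⟨m, rfl⟩, n, rfl⟩, h1, h2⟩
    obtain rfl := le_antisymm (key ha ha0 hs hs0 h1) (key hs hs0 ha ha0 h2)
    exact ⟨m, rfl, rfl⟩

theorem isExpressive_gammaV (h : IsSparseSpanning F S) (hS₀ : IsTransversal F S S₀) {a : G}
    (ha : a ∈ S) (ha0 : a ≠ 0) :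
    letI := gammaV F S S₀
    IsExpressive F S (LV S) a := by
  let := gammaV F S S₀
  have hrel : ∀ {n : ℕ} (r : (LV S).Relations n),
      DefPred (LV S) fun v : Fin n → G => FirstOrder.Language.Structure.RelMap r v := fun r =>
    Set.empty_definable_iff.2 ⟨r.formula fun i => FirstOrder.Language.Term.var i, by
      ext v
      rw [Set.mem_ofPred_eq, Set.mem_ofPred_eq, FirstOrder.Language.Formula.realize_rel]
      rfl⟩
  have hfun : ∀ {n : ℕ} (f : (LV S).Functions n),
      DefFun (LV S) fun v : Fin n → G => FirstOrder.Language.Structure.funMap f v :=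
    fun f => Set.DefinableFun.fun_symbol f
  have hF : DefFun (LV S) fun v : Fin 1 → G => F (v 0) := hfun (n := 1) VFunc.F
  have hV : DefFun (LV S) fun v : Fin 1 → G => V F S S₀ (v 0) := hfun (n := 1) VFunc.V
  have hadd : DefFun (LV S) fun v : Fin 2 → G => v 0 + v 1 := hfun (n := 2) VFunc.add
  have hle : DefPred (LV S) fun v : Fin 2 → G => Preceq F S (v 0) (v 1) :=
    hrel (n := 2) VRel.preceq
  have hR : DefPred (LV S) fun v : Fin 2 → G => R F S (v 0) (v 1) := hrel (n := 2) VRel.R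
  have horb : ∀ s ∈ S, s ≠ 0 → DefPred (LV S) fun v : Fin 1 → G => v 0 ∈ orbit F s :=
    fun s hs hs0 => hrel (n := 1) (VRel.orbit ⟨s, hs, hs0⟩)
  have hzero : DefFun (LV S) fun _ : Fin 2 → G => (0 : G) := by
    refine DefFun.of_graph ((DefPred.eq (hadd.comp (g := fun _ v => v none) fun _ => .var none)
      (.var none)).congr fun w => ?_)
    simp
  refine ⟨ha, ha0, hadd, hF, ?_, ?_, ?_⟩
  · refine (((horb a ha ha0).reindex fun _ => 0).and (hle.comp₂ (.var 0)
      (hV.comp (g := fun _ v => v 1) fun _ => .var 1))).congr fun v => ?_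
    constructor
    · rintro ⟨n, e, hd⟩
      exact ⟨⟨n, e⟩, by rw [e]; exact (preceq_V_iff h hS₀ ha ha0 n _).2 hd⟩
    · rintro ⟨⟨n, e⟩, hd⟩
      replace e : v 0 = (F ^ n) a := e
      rw [e] at hd
      exact ⟨n, e, (preceq_V_iff h hS₀ ha ha0 n _).1 hd⟩
  · refine (((horb a ha ha0).reindex fun _ => 0).and ((DefPred.eq (.var 1) hzero).or
      (DefPred.ex (P := fun v y => R F S (v 1) y ∧ y ≠ 0 ∧ Preceq F S (F y) (v 0)) ((hR.comp₂ (.var (some 1)) (.var none)).and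
        ((DefPred.eq (.var none) (hzero.reindex some)).not.and
        (hle.comp₂ (hF.comp (g := fun _ v => v none) fun _ => .var none)
          (.var (some 0)))))))).congr fun v => ?_
    constructor
    · rintro ⟨n, e, hd⟩
      refine ⟨⟨n, e⟩, ?_⟩
      rw [e]
      exact (mem_ball_iff_exists_R h ha ha0 n _).1 hd
    · rintro ⟨⟨n, e⟩, hd⟩
      replace e : v 0 = (F ^ n) a := e
      rw [e] at hd
      exact ⟨n, e, (mem_ball_iff_exists_R h ha ha0 n _).2 hd⟩
  · intro s hs hs0
    refine ((((horb a ha ha0).reindex fun _ => 0).and ((horb s hs hs0).reindex fun _ => 1)).and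
      (hle.and (hle.comp₂ (.var 1) (.var 0)))).congr fun v => ?_
    exact exists_pow_eq_iff h ha ha0 hs hs0 _ _

end Definability

/-! ### Definability of `F`-sets -/

section FSets

variable {G : Type u} [AddCommGroup G] {F : AddMonoid.End G} {S : Finset G}

theorem powEnd_pow_apply (F : AddMonoid.End G) (n d : ℕ) (x : Fin n → G) (i : Fin n) :
    ((powEnd F n ^ d) x) i = (F ^ d) (x i) := by
  induction d generalizing x with
  | zero => simp
  | succ d ih =>
    rw [pow_succ_apply', pow_succ_apply', ← ih]
    rfl

variable {L : FirstOrder.Language.{0, u}} [L.Structure G] {a : G}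

/-- The summands are quantified as an `m × n` array of elements. In each row one exponent `k` serves
all coordinates, which expresses that the coordinates of a summand have the same number of terms. -/
theorem IsExpressive.definable_of_isElementaryFSet (E : IsExpressive F S L a)
    (h : IsSparseSpanning F S) {n : ℕ} {A : Set (Fin n → G)}
    (hA : IsElementaryFSet (powEnd F n) A) : DefPred L fun v => v ∈ A := by
  obtain ⟨a₀, m, b, d, hd, rfl⟩ := hA
  have hinj : ∀ i, ∀ x y : Fin n → G, (powEnd F n ^ d i) x - x = (powEnd F n ^ d i) y - y →
      x = y := by
    intro i x y e
    ext c
    have := congrFun e c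
    simp only [Pi.sub_apply, powEnd_pow_apply] at this
    exact h.pow_sub_injective (hd i) this
  have hK : DefPred L fun w : Fin n ⊕ (Fin m × Fin n) → G =>
      ∀ i, ∃ k, d i ∣ k ∧ ∀ c, (F ^ d i) (w (.inr (i, c))) + b i c =
        w (.inr (i, c)) + (F ^ (k + d i)) (b i c) :=
    .forall_finite fun i => E.defPred_mem_K h (hd i) (fun c => .var (Sum.inr (i, c))) (b i)
  have hsum : DefPred L fun w : Fin n ⊕ (Fin m × Fin n) → G =>
      ∀ c, w (.inl c) = a₀ c + ∑ i, w (.inr (i, c)) :=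
    .forall_finite fun c => .eq (.var _)
      (E.defFun_add (E.defFun_const h _) (E.defFun_sum (fun i => .var _) _))
  refine (DefPred.exists_pi (P := fun (v : Fin n → G) (x : Fin m × Fin n → G) =>
    (∀ i, ∃ k, d i ∣ k ∧ ∀ c, (F ^ d i) (x (i, c)) + b i c = x (i, c) + (F ^ (k + d i)) (b i c)) ∧
      ∀ c, v c = a₀ c + ∑ i, x (i, c)) (hK.and hsum)).congr fun v => ?_
  have hmem : ∀ (i : Fin m) (z : Fin n → G), z ∈ K (b i) (powEnd F n ^ d i) ↔
      ∃ k, d i ∣ k ∧ ∀ c, (F ^ d i) (z c) + b i c = z c + (F ^ (k + d i)) (b i c) := by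
    intro i z
    rw [mem_K_iff (hinj i)]
    refine exists_congr fun k => and_congr_right fun _ => ?_
    simp only [funext_iff, Pi.add_apply, powEnd_pow_apply]
  constructor
  · rintro ⟨x, hx, rfl⟩
    exact ⟨fun p => x p.1 p.2, fun i => (hmem i (x i)).1 (hx i), fun c => by
      simp [Finset.sum_apply]⟩
  · rintro ⟨x, hx, hv⟩
    refine ⟨fun i c => x (i, c), fun i => (hmem i _).2 (hx i), ?_⟩
    ext c
    simp [hv c, Finset.sum_apply]

theorem IsExpressive.definable_of_isFSet (E : IsExpressive F S L a)
    (h : IsSparseSpanning F S) {n : ℕ}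
    (hsub : ∀ H : AddSubgroup (Fin n → G), (∀ x ∈ H, powEnd F n x ∈ H) →
      DefPred L fun v => v ∈ H)
    {A : Set (Fin n → G)} (hA : IsFSet (powEnd F n) A) : DefPred L fun v => v ∈ A := by
  obtain ⟨k, B, H, hB, hH, rfl⟩ := hA
  refine (DefPred.exists_finite (P := fun (i : Fin k) (v : Fin n → G) =>
    ∃ e : Fin n → G, e ∈ B i ∧ (fun c => v c - e c) ∈ H i) fun i => DefPred.exists_pi
      (((E.definable_of_isElementaryFSet h (hB i)).reindex Sum.inr).and
        ((hsub (H i) (hH i)).comp fun c => E.defFun_sub (.var _) (.var _)))).congr fun v => ?_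
  refine exists_congr fun i => ⟨?_, ?_⟩
  · rintro ⟨e, he, x, hx, rfl⟩
    exact ⟨e, he, by simpa using hx⟩
  · rintro ⟨e, he, hx⟩
    exact ⟨e, he, _, hx, by ext c; simp⟩

end FSets

end FGamma
end

open scoped FirstOrder
noncomputable section
namespace FGamma

/-! ### Invariant subgroups -/

section Subgroups

variable {G : Type u} [AddCommGroup G] {F : AddMonoid.End G} {S : Finset G}

theorem sum_range_succ_pow (F : AddMonoid.End G) (j : ℕ) (τ : ℕ → G) :
    ∑ i ∈ Finset.range (j + 1), (F ^ i) (τ i) =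
      τ 0 + F (∑ i ∈ Finset.range j, (F ^ i) (τ (i + 1))) := by
  rw [Finset.sum_range_succ', map_sum, pow_zero_apply, add_comm]
  congr 1
  exact Finset.sum_congr rfl fun i _ => pow_succ_apply' _ _

theorem pow_mem_of_forall_mem {H : AddSubgroup G} (hH : ∀ x ∈ H, F x ∈ H) (i : ℕ) {x : G}
    (hx : x ∈ H) : (F ^ i) x ∈ H := by
  induction i with
  | zero => simpa using hx
  | succ i ih => exact pow_succ_apply' (F := F) i x ▸ hH _ ih

namespace IsSparseSpanning

variable (h : IsSparseSpanning F S)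
include h

/-- Sums with coefficients of `c` digits are split into `c` shifted sums with letters as
coefficients; each layer costs one digit for the shift and one for the addition. -/
theorem sum_pow_mem_ball (c : ℕ) {τ : ℕ → G} (hτ : ∀ i, τ i ∈ Ball F S c) (j : ℕ) :
    ∑ i ∈ Finset.range j, (F ^ i) (τ i) ∈ Ball F S (j + 2 * c) := by
  induction c generalizing τ with
  | zero =>
    have hτ0 : ∀ i, τ i = 0 := hτ
    simpa only [hτ0, map_zero, Finset.sum_const_zero] using h.zero_mem_ball _
  | succ c ih =>
    choose s hs τ' hτ' e using hτ
    have h1 : ∑ i ∈ Finset.range j, (F ^ i) (s i) ∈ Ball F S j := by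
      clear ih e
      induction j with
      | zero => exact h.zero_mem_ball 0
      | succ j ih =>
        rw [Finset.sum_range_succ]
        exact add_pow_mem_ball ih (hs j)
    have h2 : F (∑ i ∈ Finset.range j, (F ^ i) (τ' i)) ∈ Ball F S (j + 2 * c + 1) :=
      ⟨0, h.zero_mem, _, ih hτ', (zero_add _).symm⟩
    have e2 : ∑ i ∈ Finset.range j, (F ^ i) (τ i) =
        ∑ i ∈ Finset.range j, (F ^ i) (s i) + F (∑ i ∈ Finset.range j, (F ^ i) (τ' i)) := by
      rw [map_sum, ← Finset.sum_add_distrib]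
      refine Finset.sum_congr rfl fun i _ => ?_
      rw [e, map_add, ← pow_succ_apply, pow_succ_apply']
    rw [e2]
    exact h.add_mem_ball (h.ball_mono (show j ≤ j + 2 * c + 1 by omega) h1) h2

theorem mem_ball_of_pow_mem_ball {m n : ℕ} {y : G} (hy : (F ^ m) y ∈ Ball F S (m + n)) :
    y ∈ Ball F S n := by
  induction m with
  | zero => simpa using hy
  | succ m ih =>
    rw [Nat.add_right_comm] at hy
    obtain ⟨s, hs, k, hk, e⟩ := hy
    rw [pow_succ_apply'] at e
    have hs0 : s = 0 := h.eq_zero s hs ⟨(F ^ m) y - k, by rw [map_sub, e, add_sub_cancel_right]⟩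
    rw [hs0, zero_add] at e
    exact ih (h.inj e ▸ hk)

theorem finite_ball (n : ℕ) : (Ball F S n).Finite := by
  refine ((Set.finite_Iio ((S.card + 1) ^ n)).image (decode F S)).subset fun g hg => ?_
  obtain ⟨k, hk, e⟩ := exists_decode_eq h hg
  exact ⟨k, hk, e⟩

theorem exists_forall_mem_ball {T : Set G} (hT : T.Finite) : ∃ c, ∀ t ∈ T, t ∈ Ball F S c := by
  choose f hf using h.exists_mem_ball
  obtain ⟨c, hc⟩ := (hT.image f).bddAbove
  exact ⟨c, fun t ht => h.ball_mono (hc (Set.mem_image_of_mem f ht)) (hf t)⟩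

/-- An invariant subgroup `H` is covered by finitely many cosets of `F(H)`. -/
theorem exists_finite_cosets {H : AddSubgroup G} (hH : ∀ x ∈ H, F x ∈ H) :
    ∃ T : Set G, T.Finite ∧ T ⊆ H ∧ ∀ x ∈ H, ∃ t ∈ T, ∃ y ∈ H, x = t + F y := by
  let π : G → G ⧸ H.map F := fun x => x
  have hπ : ∀ x y : G, π x = π y ↔ ∃ z ∈ H, F z = -x + y := fun x y => QuotientAddGroup.eq
  rcases (π '' H).finite_or_infinite with hfin | hinf
  · obtain ⟨T, hTH, e⟩ := Set.exists_subset_bijOn (H : Set G) π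
    refine ⟨T, e.finite_iff_finite.2 hfin, hTH, fun x hx => ?_⟩
    obtain ⟨t, ht, hxt⟩ := e.surjOn (Set.mem_image_of_mem π hx)
    obtain ⟨y, hy, hy'⟩ := (hπ t x).1 hxt
    exact ⟨t, ht, y, hy, by rw [hy', add_neg_cancel_left]⟩
  · exfalso
    -- Suppose there are `2 * q` different cosets. Their representatives act as digits that can be
    -- read off uniquely, so there are `(2 * q) ^ j` sums of length `j`; all of them have at most `j
    -- + 2 * c` digits, which leaves room for at most `q ^ (j + 2 * c)` elements.
    let q := S.card + 1
    obtain ⟨f⟩ : Nonempty (Fin (2 * q) ↪ (π '' H)) := by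
      have := hinf.to_subtype
      exact ⟨Fin.valEmbedding.trans (Infinite.natEmbedding _)⟩
    choose τ hτH hτ using fun i => (f i).2
    have hτinj : ∀ i j, ∀ y ∈ H, ∀ z ∈ H, τ i + F y = τ j + F z → i = j ∧ y = z := by
      intro i j y hy z hz e
      have hij : i = j := f.injective (Subtype.ext (by
        rw [← hτ, ← hτ, hπ]
        refine ⟨y - z, H.sub_mem hy hz, ?_⟩
        rw [map_sub, sub_eq_iff_eq_add, add_assoc, ← e, neg_add_cancel_left]))
      subst hij
      exact ⟨rfl, h.inj (add_left_cancel e)⟩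
    have hsum : ∀ (j : ℕ) (f : ℕ → Fin (2 * q)),
        ∑ i ∈ Finset.range j, (F ^ i) (τ (f i)) ∈ H := fun j f =>
      H.sum_mem fun i _ => pow_mem_of_forall_mem hH i (hτH _)
    have hinj : ∀ (j : ℕ) (f g : ℕ → Fin (2 * q)),
        ∑ i ∈ Finset.range j, (F ^ i) (τ (f i)) = ∑ i ∈ Finset.range j, (F ^ i) (τ (g i)) →
        ∀ i < j, f i = g i := by
      intro j
      induction j with
      | zero => intro f g _ i hi; exact absurd hi (Nat.not_lt_zero i)
      | succ j ih =>
        intro f g e i hi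
        rw [sum_range_succ_pow F j fun i => τ (f i), sum_range_succ_pow F j fun i => τ (g i)] at e
        obtain ⟨e0, e1⟩ := hτinj _ _ _ (hsum j fun i => f (i + 1)) _ (hsum j fun i => g (i + 1)) e
        rcases i with _ | i
        · exact e0
        · exact ih _ _ e1 i (Nat.lt_of_succ_lt_succ hi)
    obtain ⟨c, hc⟩ := h.exists_forall_mem_ball (Set.finite_range τ)
    have hcode : ∀ (j : ℕ) (f : ℕ → Fin (2 * q)), ∃ k < q ^ (j + 2 * c),
        decode F S k = ∑ i ∈ Finset.range j, (F ^ i) (τ (f i)) := fun j f =>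
      exists_decode_eq h (h.sum_pow_mem_ball c (fun i => hc _ (Set.mem_range_self (f i))) j)
    have hq : 0 < q := Nat.succ_pos _
    have hcard : ∀ j, (2 * q) ^ j ≤ q ^ (j + 2 * c) := by
      intro j
      let ext : (Fin j → Fin (2 * q)) → ℕ → Fin (2 * q) := fun f i =>
        if hi : i < j then f ⟨i, hi⟩ else ⟨0, by omega⟩
      choose k hk ek using fun f => hcode j (ext f)
      have := Fintype.card_le_of_injective (fun f => (⟨k f, hk f⟩ : Fin (q ^ (j + 2 * c)))) (by
        intro f g e
        have e : k f = k g := congrArg Fin.val e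
        ext1 i
        have := hinj j (ext f) (ext g) (by rw [← ek, ← ek, e]) i i.2
        simpa [ext] using this)
      simpa using this
    -- For `j = q ^ (2 * c)`, cancelling `q ^ j` leaves `2 ^ j ≤ j`.
    have := hcard (q ^ (2 * c))
    rw [mul_pow, pow_add, mul_comm] at this
    exact absurd (Nat.le_of_mul_le_mul_left this (Nat.pow_pos hq)) (not_le.2 Nat.lt_two_pow_self)

/-- The elements of an invariant subgroup are the sums `∑ Fⁱ tᵢ` with `tᵢ` in a finite subset. -/
theorem exists_finset_sum_pow {H : AddSubgroup G} (hH : ∀ x ∈ H, F x ∈ H) :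
    ∃ T : Finset G, (∀ t ∈ T, t ∈ H) ∧
      ∀ x ∈ H, ∃ (j : ℕ) (τ : ℕ → G), (∀ i, τ i ∈ T) ∧ x = ∑ i ∈ Finset.range j, (F ^ i) (τ i) := by
  classical
  obtain ⟨T, hT, hTH, hcov⟩ := h.exists_finite_cosets hH
  obtain ⟨c, hc⟩ := h.exists_forall_mem_ball hT
  -- The possible last coefficients. If `x` has `m` digits, the remainder `Fᵐ y` after `m` steps is
  -- a difference of elements with at most `m + 2 * c` digits, so `y` has at most `2 * c + 1`.
  have hB : (Ball F S (2 * c + 1) ∩ H).Finite := (h.finite_ball _).inter_of_left _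
  refine ⟨hT.toFinset ∪ hB.toFinset, ?_, fun x hx => ?_⟩
  · intro t ht
    rcases Finset.mem_union.1 ht with ht | ht
    · exact hTH (hT.mem_toFinset.1 ht)
    · exact (hB.mem_toFinset.1 ht).2
  · have key : ∀ j, ∃ τ : ℕ → G, (∀ i, τ i ∈ T) ∧ ∃ y ∈ H,
        x = ∑ i ∈ Finset.range j, (F ^ i) (τ i) + (F ^ j) y := by
      intro j
      induction j with
      | zero =>
        obtain ⟨t, ht, -⟩ := hcov 0 H.zero_mem
        exact ⟨fun _ => t, fun _ => ht, x, hx, by simp⟩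
      | succ j ih =>
        obtain ⟨τ, hτ, y, hy, e⟩ := ih
        obtain ⟨t, ht, z, hz, rfl⟩ := hcov y hy
        refine ⟨fun i => if i = j then t else τ i, fun i => ?_, z, hz, ?_⟩
        · dsimp only
          split_ifs
          exacts [ht, hτ i]
        · rw [Finset.sum_range_succ]
          beta_reduce
          rw [if_pos rfl, e, map_add, pow_succ_apply, add_assoc]
          congr 1
          refine Finset.sum_congr rfl fun i hi => ?_
          rw [if_neg (Finset.mem_range.1 hi).ne]
    obtain ⟨m, hm⟩ := h.exists_mem_ball x
    obtain ⟨τ, hτ, y, hy, e⟩ := key m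
    have hyB : y ∈ Ball F S (2 * c + 1) := by
      refine h.mem_ball_of_pow_mem_ball (m := m) ?_
      rw [← sub_eq_of_eq_add' e]
      exact h.ball_mono (by omega) (h.sub_mem_ball (h.ball_mono (by omega) hm)
        (h.sum_pow_mem_ball c (fun i => hc _ (hτ i)) m))
    refine ⟨m + 1, fun i => if i = m then y else τ i, fun i => ?_, ?_⟩
    · dsimp only
      split_ifs
      · exact Finset.mem_union_right _ (hB.mem_toFinset.2 ⟨hyB, hy⟩)
      · exact Finset.mem_union_left _ (hT.mem_toFinset.2 (hτ i))
    · rw [Finset.sum_range_succ]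
      beta_reduce
      rw [if_pos rfl, e]
      congr 1
      refine Finset.sum_congr rfl fun i hi => ?_
      rw [if_neg (Finset.mem_range.1 hi).ne]

/-- The elements of an invariant subgroup are the finite sums of sparse sums with coefficients in
a finite subset. -/
theorem exists_sparse_generators {H : AddSubgroup G} (hH : ∀ x ∈ H, F x ∈ H) :
    ∃ T : Finset G, ∀ x, x ∈ H ↔ ∃ X : T × Fin 3 → Finset ℕ, (∀ k, Gap (X k)) ∧
      x = ∑ k, powSum F (k.1 : G) (X k) := by
  classical
  obtain ⟨T, hTH, hT⟩ := h.exists_finset_sum_pow hH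
  refine ⟨T, fun x => ⟨fun hx => ?_, ?_⟩⟩
  · obtain ⟨j, τ, hτ, rfl⟩ := hT x hx
    -- Indices with the same coefficient and the same residue mod `3` form a set with gaps.
    let r : ℕ → T × Fin 3 := fun i => (⟨τ i, hτ i⟩, ⟨i % 3, Nat.mod_lt _ (by norm_num)⟩)
    refine ⟨fun k => (Finset.range j).filter fun i => r i = k, ?_, ?_⟩
    · rintro k a ha b hb hab
      have ha := congrArg (fun k : T × Fin 3 => (k.2 : ℕ)) (Finset.mem_filter.1 ha).2
      have hb := congrArg (fun k : T × Fin 3 => (k.2 : ℕ)) (Finset.mem_filter.1 hb).2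
      have e : a % 3 = b % 3 := ha.trans hb.symm
      omega
    · rw [← Finset.sum_fiberwise (Finset.range j) r]
      refine Finset.sum_congr rfl fun k _ => Finset.sum_congr rfl fun i hi => ?_
      rw [← (Finset.mem_filter.1 hi).2]
  · rintro ⟨X, -, rfl⟩
    exact H.sum_mem fun k _ => H.sum_mem fun i _ => pow_mem_of_forall_mem hH i (hTH _ k.1.2)

/-- Powers inherit sparse spanning sets. -/
theorem pi (n : ℕ) : IsSparseSpanning (powEnd F n) (Fintype.piFinset fun _ : Fin n => S) := by
  have hball : ∀ (m : ℕ) (g : Fin n → G), (∀ i, g i ∈ Ball F S m) →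
      g ∈ Ball (powEnd F n) (Fintype.piFinset fun _ : Fin n => S) m := by
    intro m
    induction m with
    | zero => exact fun g hg => funext hg
    | succ m ih =>
      intro g hg
      choose s hs k hk e using hg
      exact ⟨s, Fintype.mem_piFinset.2 hs, k, ih k hk, funext e⟩
  refine ⟨fun x y e => funext fun i => h.inj (congrFun e i), ⟨?_, ?_, ?_, ?_, ?_⟩, ?_⟩
  · exact Fintype.mem_piFinset.2 fun _ => h.zero_mem
  · exact fun a ha => Fintype.mem_piFinset.2 fun i =>
      h.span.neg_mem _ (Fintype.mem_piFinset.1 ha i)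
  · intro g
    obtain ⟨c, hc⟩ := h.exists_forall_mem_ball (Set.finite_range g)
    obtain ⟨w, hw, -, e⟩ := mem_ball_iff.1 (hball c g fun i => hc _ (Set.mem_range_self i))
    exact ⟨w, hw, e⟩
  · intro a ha b hb c hc
    choose d hd e he hde using fun i => h.span.add_mem (a i) (Fintype.mem_piFinset.1 ha i) (b i)
      (Fintype.mem_piFinset.1 hb i) (c i) (Fintype.mem_piFinset.1 hc i)
    exact ⟨d, Fintype.mem_piFinset.2 hd, e, Fintype.mem_piFinset.2 he, funext hde⟩
  · exact fun a ha b hb c e => Fintype.mem_piFinset.2 fun i =>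
      h.span.carry_mem (a i) (Fintype.mem_piFinset.1 ha i) (b i) (Fintype.mem_piFinset.1 hb i)
        (c i) (congrFun e i)
  · rintro a ha ⟨c, hc⟩
    exact funext fun i => h.eq_zero (a i) (Fintype.mem_piFinset.1 ha i) ⟨c i, congrFun hc i⟩

end IsSparseSpanning

/-- For each generator and each residue mod `3`, one tuple of variables carries the sparse sum. A
common `X` for all coordinates makes the tuple a sparse sum in `Γⁿ`. -/
theorem IsExpressive.definable_of_invariant {L : FirstOrder.Language.{0, u}} [L.Structure G] {a : G}
    (E : IsExpressive F S L a) (h : IsSparseSpanning F S) {n : ℕ} {H : AddSubgroup (Fin n → G)}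
    (hH : ∀ x ∈ H, powEnd F n x ∈ H) : DefPred L fun v => v ∈ H := by
  obtain ⟨T, hT⟩ := (h.pi n).exists_sparse_generators hH
  let ι := Fin (Fintype.card (T × Fin 3))
  let e : ι ≃ T × Fin 3 := (Fintype.equivFin _).symm
  have h1 : DefPred L fun w : Fin n ⊕ (ι × Fin n) → G => ∀ k, ∃ X, Gap X ∧
      ∀ c, w (.inr (k, c)) = powSum F ((e k).1.1 c) X :=
    .forall_finite fun k => E.defPred_exists_forall_powSum h (fun c => .var (Sum.inr (k, c))) _
  have h2 : DefPred L fun w : Fin n ⊕ (ι × Fin n) → G =>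
      ∀ c, w (.inl c) = ∑ k, w (.inr (k, c)) :=
    .forall_finite fun c => .eq (.var _) (E.defFun_sum (fun k => .var _) _)
  refine (DefPred.exists_pi (P := fun (v : Fin n → G) (x : ι × Fin n → G) =>
    (∀ k, ∃ X, Gap X ∧ ∀ c, x (k, c) = powSum F ((e k).1.1 c) X) ∧
      ∀ c, v c = ∑ k, x (k, c)) (h1.and h2)).congr fun v => ?_
  have hsum : ∀ (t : Fin n → G) (X : Finset ℕ) (c : Fin n),
      powSum (powEnd F n) t X c = powSum F (t c) X := by
    intro t X c
    simp only [powSum, Finset.sum_apply, powEnd_pow_apply]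
  rw [hT]
  constructor
  · rintro ⟨X, hX, rfl⟩
    refine ⟨fun p => powSum F ((e p.1).1.1 p.2) (X (e p.1)), fun k => ⟨_, hX (e k), fun c => rfl⟩,
      fun c => ?_⟩
    rw [← e.sum_comp, Finset.sum_apply]
    exact Finset.sum_congr rfl fun k _ => hsum _ _ _
  · rintro ⟨x, hx, hv⟩
    choose X hX hx using hx
    refine ⟨fun k => X (e.symm k), fun k => hX _, funext fun c => ?_⟩
    rw [← e.sum_comp, Finset.sum_apply, hv]
    refine Finset.sum_congr rfl fun k _ => ?_
    rw [hsum, hx]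
    beta_reduce
    rw [e.symm_apply_apply]

end Subgroups

end FGamma
end

open scoped FirstOrder
noncomputable section
namespace FGamma

/-! ### Definable reducts and automaticity of definable sets -/

section Reduct

variable {G : Type u} [AddCommGroup G] {F : AddMonoid.End G} {S S₀ : Finset G}

theorem IsAutoStructure.isFAutomatic_of_definable {L : FirstOrder.Language.{0, u}} [L.Structure G]
    {M : ℕ} (hM : IsAutoStructure F S L M) (h : IsSparseSpanning F S) {n : ℕ}
    {A : Set (Fin n → G)} (hA : (∅ : Set G).Definable L A) : IsFAutomatic F A := by
  obtain ⟨φ, rfl⟩ := Set.empty_definable_iff.1 hA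
  refine Auto.isFAutomatic h (Auto.congr ((hM.auto_formula h φ).reindex
    (Sum.elim id Fin.elim0 : Fin n ⊕ Fin 0 → Fin n)) ?_)
  ext v
  exact iff_of_eq (congrArg (FirstOrder.Language.BoundedFormula.Realize φ v)
    (Subsingleton.elim (default : Fin 0 → G) _))

theorem definable_of_isFSet (h : IsSparseSpanning F S) (hS₀ : IsTransversal F S S₀) {n : ℕ}
    {A : Set (Fin n → G)} (hA : IsFSet (powEnd F n) A) :
    letI : (LV S).Structure G := gammaV F S S₀
    (∅ : Set G).Definable (LV S) A := by
  let _ : (LV S).Structure G := gammaV F S S₀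
  by_cases hS : ∃ a ∈ S, a ≠ 0
  · obtain ⟨a, ha, ha0⟩ := hS
    have E := isExpressive_gammaV h hS₀ ha ha0
    exact E.definable_of_isFSet h (fun H hH => E.definable_of_invariant h hH) hA
  -- Without a nonzero letter there is no `a` to represent numbers, but then the group is trivial.
  · have hG : ∀ g : G, g = 0 := by
      intro g
      obtain ⟨n, hn⟩ := h.exists_mem_ball g
      induction n generalizing g with
      | zero => exact hn
      | succ n ih =>
        obtain ⟨s, hs, k, hk, rfl⟩ := hn
        rw [ih k hk, map_zero, add_zero]
        by_contra hs0
        exact hS ⟨s, hs, hs0⟩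
    have : Subsingleton G := ⟨fun x y => (hG x).trans (hG y).symm⟩
    rcases Set.eq_empty_or_nonempty A with rfl | hne
    · exact Set.definable_empty
    · rw [Subsingleton.eq_univ_of_nonempty hne]
      exact Set.definable_univ

end Reduct

end FGamma
end

theorem proposition4p16 {Γ : Type u} [AddCommGroup Γ] (F : AddMonoid.End Γ)
    (hF : Function.Injective F) (S S₀ : Finset Γ) (hS : FGamma.IsSpanning F S)
    (hSF : ∀ a ∈ S, (∃ c, a = F c) → a = 0) (hS₀ : FGamma.IsTransversal F S S₀) :
    letI : (FGamma.LV S).Structure Γ := FGamma.gammaV F S S₀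
    letI : (FGamma.LF F).Structure Γ := FGamma.gammaF F
    FGamma.IsFAPresentable (FGamma.LV S) Γ ∧
    FGamma.HasDecidableTheory (FGamma.LV S) Γ ∧
    (∀ n : ℕ, 0 < n → ∀ A : Set (Fin n → Γ), FGamma.IsFSet (FGamma.powEnd F n) A →
      (∅ : Set Γ).Definable (FGamma.LV S) A) ∧
    (∀ (n : ℕ) (A : Set (Fin n → Γ)), (∅ : Set Γ).Definable (FGamma.LF F) A →
      (∅ : Set Γ).Definable (FGamma.LV S) A) ∧
    (∀ n : ℕ, 0 < n → ∀ A : Set (Fin n → Γ), FGamma.IsFSet (FGamma.powEnd F n) A →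
      FGamma.IsFAutomatic F A) := by
  let _ : (FGamma.LV S).Structure Γ := FGamma.gammaV F S S₀
  let _ : (FGamma.LF F).Structure Γ := FGamma.gammaF F
  have h : FGamma.IsSparseSpanning F S := ⟨hF, hS, hSF⟩
  obtain ⟨M, hM⟩ := FGamma.exists_isAutoStructure h hS₀
  exact ⟨FGamma.isFAPresentable_gammaV h hS₀, hM.hasDecidableTheory h,
    fun n _ A hA => FGamma.definable_of_isFSet h hS₀ hA,
    fun n A hA => FGamma.definable_of_relational (L := FGamma.LV S) (L' := FGamma.LF F)
      (fun _ => inferInstanceAs (IsEmpty Empty))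
      (fun _ r => FGamma.definable_of_isFSet h hS₀ r.2.2) hA,
    fun n _ A hA => hM.isFAutomatic_of_definable h (FGamma.definable_of_isFSet h hS₀ hA)⟩
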